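/- **Conventions.** Let $(M^n,g)$ be a Riemannian manifold, $|\cdot|$ the Euclidean volume and area, and $I_n=|\partial B|^n/|B|^{n-1}$, where $B$ is the unit ball of $\mathbb R^n$. A *regular domain* is a relatively compact connected open set with smooth boundary. The *$\delta$-almost Euclidean isoperimetric inequality* holds in a set $A$ with respect to $g$ if $\mathrm{Area}_g(\partial\Omega)^n\ge(1-\delta)\,I_n\,\mathrm{Vol}_g(\Omega)^{n-1}$ for every regular domain $\Omega\subset A$. $S$ denotes scalar curvature, $B_g(x,s)$ the open geodesic ball and $d$ the distance of $g$. **Lemma.** For every $n\ge 2$ and $\delta_1>0$ there are constants $C=C(n,\delta_1)>0$ and $c=c(n,\delta_1)>0$ with the following property. Let $(M^n,g)$ be a connected complete smooth Riemannian manifold with $\mathrm{Ric}\ge -l$, where $l>0$, let $p\in M$, and let $\lambda,\Lambda,C_0>0$. Let $\gamma:M\to[0,\infty)$ be a function such that at all points $x$ with $d(x,p)\ge C_0/\sqrt l$ it is smooth and satisfies $$\lambda\, d(x,p)\le\gamma(x)\le\Lambda\, d(x,p),\qquad |\nabla\gamma|\le C_0,\qquad |\Delta\gamma|\le C_0\sqrt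 l .$$ (Such a $\gamma$ is the Schoen–Yau distance-like function.) Put $U_\sigma=\gamma^{-1}([0,\sigma))$ for real $\sigma$. Let $k\ge 0$, $r>0$ and $\rho>2c\,C_0\,r\sqrt{l+1}$, and suppose that * $B_g(p,C_0/\sqrt l)\subset U_{\rho-c\,C_0 r\sqrt{l+1}}$, that is, the ball on which $\gamma$ is not controlled lies in the part of $U_\rho$ where the metric is not going to be changed (this holds for instance if $\gamma\le\Lambda d(\cdot,p)$ on that ball and $\rho\ge 2\Lambda C_0/\sqrt l$); * $S\ge -k$ on $U_\rho$; * the $\delta_1$-almost Euclidean isoperimetric inequality with respect to $g$ holds in every geodesic ball $B_g(x,s)\subset U_\rho$ of radius $0<s\le r$. Then $U_\rho$ is open and there is a smooth metric $h$ on $U_\rho$, conformal to $g$ (that is, $h=e^{2u}g$ with $u\in C^\infty(U_\rho)$), such that 1. $(U_\rho,h)$ is a complete Riemannian manifold with uniformly bounded curvature, and $h=g$ on $U_{\rho-c\,C_0\,r\sqrt{l+1}}$; 2. $S_h\ge -k-C\max\{1/r,\,1/r^2\}$ on $U_\rho$; 3. for every $y\in U_\rho$, the $2\delta_1$-almost Euclidean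 isoperimetric inequality with respect to $h$ holds in the geodesic ball $B_h(y,r/8)$ of $(U_\rho,h)$. -/

import Mathlib

open Set Filter Topology MeasureTheory Bundle Manifold
open scoped ContDiff ENNReal Manifold

noncomputable section

/- Euclidean space is a manifold through its identity chart. -/
attribute [instance 2000] chartedSpaceSelf

section RiemannianGeometry

variable {n : ℕ} {M : Type*} [TopologicalSpace M] [ChartedSpace (EuclideanSpace ℝ (Fin n)) M]

/-- A field of bilinear forms (covariant 2-tensor) on an `n`-dimensional manifold.  It is used below
only for the given smooth Riemannian metric and, on an open set, for metrics conformal to it. -/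
abbrev MetricField (n : ℕ) (M : Type*) [TopologicalSpace M]
    [ChartedSpace (EuclideanSpace ℝ (Fin n)) M] : Type _ :=
  ∀ x : M, TangentSpace (𝓡 n) x → TangentSpace (𝓡 n) x → ℝ

/-- The tensor field of the Riemannian metric carried by the tangent bundle. -/
def riemannianField (n : ℕ) (M : Type*) [TopologicalSpace M]
    [ChartedSpace (EuclideanSpace ℝ (Fin n)) M]
    [RiemannianBundle (fun x : M ↦ TangentSpace (𝓡 n) x)] : MetricField n M :=
  fun _ v w ↦ inner ℝ v w

/-- The flat metric of Euclidean space. -/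
def flatField (n : ℕ) : MetricField n (EuclideanSpace ℝ (Fin n)) :=
  fun _ (v w : EuclideanSpace ℝ (Fin n)) ↦ inner ℝ v w

/-- `h` is a smooth metric on the open set `U` that is conformal to `g`: `h = e^{2u} g` on `U` for a
smooth function `u` on `U`. -/
def IsConformalMetricOn (U : Set M) (g h : MetricField n M) : Prop :=
  IsOpen U ∧ ∃ u : M → ℝ, ContMDiffOn (𝓡 n) 𝓘(ℝ, ℝ) ∞ u U ∧
    ∀ x ∈ U, ∀ v w : TangentSpace (𝓡 n) x, h x v w = Real.exp (2 * u x) * g x v w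

/-! ### Local coordinates and curvature -/

/-- Coordinate vectors of `ℝ^n`. -/
def stdVec {n : ℕ} (i : Fin n) : EuclideanSpace ℝ (Fin n) := EuclideanSpace.single i 1

/-- Partial derivative `∂_i f` of a function on `ℝ^n`. -/
def pderivCoord {n : ℕ} (i : Fin n) (f : EuclideanSpace ℝ (Fin n) → ℝ)
    (z : EuclideanSpace ℝ (Fin n)) : ℝ :=
  fderiv ℝ f z (stdVec i)

/-- The coordinate point of `x` in the preferred chart around `x`. -/
def coordCenter (x : M) : EuclideanSpace ℝ (Fin n) := extChartAt (𝓡 n) x x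

/-- The matrix `g_{ij}(z) = g(∂_i, ∂_j)` of `G` in the preferred chart around `x`. -/
def metricCoord (G : MetricField n M) (x : M) (z : EuclideanSpace ℝ (Fin n)) :
    Matrix (Fin n) (Fin n) ℝ :=
  Matrix.of fun i j ↦ G ((extChartAt (𝓡 n) x).symm z)
    (mfderiv (𝓡 n) (𝓡 n) (extChartAt (𝓡 n) x).symm z (stdVec i))
    (mfderiv (𝓡 n) (𝓡 n) (extChartAt (𝓡 n) x).symm z (stdVec j))

/-- Christoffel symbols
`Γ^k_{ij} = 1/2 ∑_m g^{km} (∂_i g_{jm} + ∂_j g_{im} - ∂_m g_{ij})`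
in the preferred chart around `x`. -/
def christoffel (G : MetricField n M) (x : M) (k i j : Fin n)
    (z : EuclideanSpace ℝ (Fin n)) : ℝ :=
  (1 / 2 : ℝ) * ∑ m, (metricCoord G x z)⁻¹ k m *
    (pderivCoord i (fun w ↦ metricCoord G x w j m) z
      + pderivCoord j (fun w ↦ metricCoord G x w i m) z
      - pderivCoord m (fun w ↦ metricCoord G x w i j) z)

/-- Components `R^a_{ijk}` of the Riemann tensor at `x`, with
`R(∂_i, ∂_j) ∂_k = ∇_i ∇_j ∂_k - ∇_j ∇_i ∂_k = ∑_a R^a_{ijk} ∂_a`. -/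
def riemannCoord (G : MetricField n M) (x : M) (a i j k : Fin n) : ℝ :=
  pderivCoord i (christoffel G x a j k) (coordCenter x)
    - pderivCoord j (christoffel G x a i k) (coordCenter x)
    + ∑ m, (christoffel G x a i m (coordCenter x) * christoffel G x m j k (coordCenter x)
      - christoffel G x a j m (coordCenter x) * christoffel G x m i k (coordCenter x))

/-- The Ricci tensor at `x`: `Ric_{jk}` is the trace of `X ↦ R(X, ∂_j) ∂_k`. -/
def ricciCoord (G : MetricField n M) (x : M) : Matrix (Fin n) (Fin n) ℝ :=
  Matrix.of fun j k ↦ ∑ i, riemannCoord G x i i j k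

/-- `Ric ≥ -l` at `x`, that is `Ric(v, v) ≥ -l g(v, v)` for all tangent vectors
`v = ∑_i v^i ∂_i` at `x`. -/
def RicciLowerBoundAt (G : MetricField n M) (l : ℝ) (x : M) : Prop :=
  ∀ v : Fin n → ℝ,
    -l * ∑ i, ∑ j, metricCoord G x (coordCenter x) i j * v i * v j
      ≤ ∑ i, ∑ j, ricciCoord G x i j * v i * v j

/-- The scalar curvature `S = ∑ g^{jk} Ric_{jk}`. -/
def scalarCurv (G : MetricField n M) (x : M) : ℝ :=
  ∑ j, ∑ k, (metricCoord G x (coordCenter x))⁻¹ j k * ricciCoord G x j k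

/-- The squared norm of the Riemann tensor,
`|Rm|² = ∑ g_{aa'} g^{ii'} g^{jj'} g^{kk'} R^a_{ijk} R^{a'}_{i'j'k'}`. -/
def riemannNormSq (G : MetricField n M) (x : M) : ℝ :=
  ∑ a, ∑ i, ∑ j, ∑ k, ∑ a', ∑ i', ∑ j', ∑ k',
    metricCoord G x (coordCenter x) a a'
      * (metricCoord G x (coordCenter x))⁻¹ i i'
      * (metricCoord G x (coordCenter x))⁻¹ j j'
      * (metricCoord G x (coordCenter x))⁻¹ k k'
      * riemannCoord G x a i j k * riemannCoord G x a' i' j' k'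

/-- The curvature of `G` is uniformly bounded on `U`: `sup_U |Rm| < ∞`. -/
def HasBoundedCurvatureOn (U : Set M) (G : MetricField n M) : Prop :=
  ∃ K : ℝ, ∀ x ∈ U, Real.sqrt (riemannNormSq G x) ≤ K

/-- A function read in the preferred chart around `x`. -/
def funCoord (f : M → ℝ) (x : M) (z : EuclideanSpace ℝ (Fin n)) : ℝ :=
  f ((extChartAt (𝓡 n) x).symm z)

/-- The length `|∇f|` of the gradient: `|∇f|² = ∑ g^{ij} ∂_i f ∂_j f`. -/
def gradNorm (G : MetricField n M) (f : M → ℝ) (x : M) : ℝ :=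
  Real.sqrt (∑ i, ∑ j, (metricCoord G x (coordCenter x))⁻¹ i j
    * pderivCoord i (funCoord f x) (coordCenter x)
    * pderivCoord j (funCoord f x) (coordCenter x))

/-- The Laplace–Beltrami operator `Δf = ∑ g^{ij} (∂_i ∂_j f - ∑_k Γ^k_{ij} ∂_k f)`. -/
def laplaceBeltrami (G : MetricField n M) (f : M → ℝ) (x : M) : ℝ :=
  ∑ i, ∑ j, (metricCoord G x (coordCenter x))⁻¹ i j
    * (pderivCoord i (pderivCoord j (funCoord f x)) (coordCenter x)
      - ∑ k, christoffel G x k i j (coordCenter x)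
          * pderivCoord k (funCoord f x) (coordCenter x))

/-! ### Distance and completeness of a metric on an open set -/

/-- The length of a curve `c : [0, 1] → M` with respect to `G`. -/
def curveLength (G : MetricField n M) (c : ℝ → M) : ℝ≥0∞ :=
  ∫⁻ t in Icc (0 : ℝ) 1, ENNReal.ofReal (Real.sqrt
    (G (c t) (mfderiv 𝓘(ℝ, ℝ) (𝓡 n) c t (1 : ℝ)) (mfderiv 𝓘(ℝ, ℝ) (𝓡 n) c t (1 : ℝ))))

/-- The Riemannian distance of `(U, G)`: the infimum of the lengths of the `C^1` curves in `U`
between the two points (it is `∞` between different connected components of `U`). -/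
def distIn (U : Set M) (G : MetricField n M) (x y : M) : ℝ≥0∞ :=
  ⨅ (c : ℝ → M) (_ : ContMDiffOn 𝓘(ℝ, ℝ) (𝓡 n) 1 c (Icc 0 1)) (_ : MapsTo c (Icc 0 1) U)
    (_ : c 0 = x) (_ : c 1 = y), curveLength G c

/-- The open geodesic ball of `(U, G)`. -/
def ballIn (U : Set M) (G : MetricField n M) (x : M) (s : ℝ) : Set M :=
  {y | y ∈ U ∧ distIn U G x y < ENNReal.ofReal s}

/-- Metric completeness of `(U, G)`: Cauchy sequences for the Riemannian distance of `(U, G)`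
converge in `U`. -/
def IsCompleteMetricOn (U : Set M) (G : MetricField n M) : Prop :=
  ∀ s : ℕ → M, (∀ i, s i ∈ U) →
    (∀ ε : ℝ≥0∞, 0 < ε → ∃ N, ∀ i ≥ N, ∀ j ≥ N, distIn U G (s i) (s j) < ε) →
    ∃ x ∈ U, Tendsto (fun i ↦ distIn U G (s i) x) atTop (𝓝 0)

/-! ### Volume, area and the isoperimetric inequality -/

/-- The `m`-dimensional volume element `√det (G(∂_a ψ, ∂_b ψ))` of a parametrization `ψ`. -/
def volumeElement (m : ℕ) (G : MetricField n M) (ψ : EuclideanSpace ℝ (Fin m) → M)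
    (z : EuclideanSpace ℝ (Fin m)) : ℝ :=
  Real.sqrt (Matrix.det (Matrix.of fun a b : Fin m ↦
    G (ψ z) (mfderiv (𝓡 m) (𝓡 n) ψ z (stdVec a)) (mfderiv (𝓡 m) (𝓡 n) ψ z (stdVec b))))

/-- The `m`-dimensional Riemannian volume of an `m`-dimensional submanifold `S`: the supremum, over
the finite families of disjoint pieces of `S` that are injectively and smoothly parametrized by open
sets `W i` of `ℝ^m`, of the sum of the volumes `∫_{W i} √det (G(∂_a ψ_i, ∂_b ψ_i))` of the pieces.
For `m = n` and `S` open this is the Riemannian volume of `S`; for `m = n - 1` and `S` a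
smooth hypersurface it is the area of `S`. -/
def riemannianVol (m : ℕ) (G : MetricField n M) (S : Set M) : ℝ≥0∞ :=
  ⨆ (N : ℕ) (W : Fin N → Set (EuclideanSpace ℝ (Fin m)))
    (ψ : Fin N → EuclideanSpace ℝ (Fin m) → M)
    (_ : ∀ i, IsOpen (W i) ∧ ContMDiffOn (𝓡 m) (𝓡 n) ∞ (ψ i) (W i) ∧ InjOn (ψ i) (W i) ∧
      MapsTo (ψ i) (W i) S)
    (_ : ∀ i j, i ≠ j → Disjoint (ψ i '' W i) (ψ j '' W j)),
    ∑ i, ∫⁻ z in W i, ENNReal.ofReal (volumeElement m G (ψ i) z)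

/-- A regular domain: a relatively compact connected open set with smooth boundary, i.e. near each
boundary point it is a sublevel set `{F < 0}` of a smooth function with `F = 0` and `dF ≠ 0` at that
point. -/
def IsRegularDomain (n : ℕ) {M : Type*} [TopologicalSpace M]
    [ChartedSpace (EuclideanSpace ℝ (Fin n)) M] (Ω : Set M) : Prop :=
  IsOpen Ω ∧ IsConnected Ω ∧ IsCompact (closure Ω) ∧
    ∀ x ∈ frontier Ω, ∃ (V : Set M) (F : M → ℝ), IsOpen V ∧ x ∈ V ∧
      ContMDiffOn (𝓡 n) 𝓘(ℝ, ℝ) ∞ F V ∧ F x = 0 ∧ mfderiv (𝓡 n) 𝓘(ℝ, ℝ) F x ≠ 0 ∧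
      Ω ∩ V = {y | y ∈ V ∧ F y < 0}

/-- The Euclidean isoperimetric constant `I_n = |∂B|^n / |B|^{n-1}`, `B` the unit ball of `ℝ^n`. -/
def isoperimetricConst (n : ℕ) : ℝ≥0∞ :=
  riemannianVol (n - 1) (flatField n) (Metric.sphere (0 : EuclideanSpace ℝ (Fin n)) 1) ^ n /
    riemannianVol n (flatField n) (Metric.ball (0 : EuclideanSpace ℝ (Fin n)) 1) ^ (n - 1)

/-- The `δ`-almost Euclidean isoperimetric inequality for `G` in the set `B`:
`Area(∂Ω)^n ≥ (1 - δ) I_n Vol(Ω)^{n-1}` for every regular domain `Ω ⊆ B`. -/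
def AlmostEuclideanIsoperimetric (G : MetricField n M) (δ : ℝ) (B : Set M) : Prop :=
  ∀ Ω : Set M, IsRegularDomain n Ω → Ω ⊆ B →
    ENNReal.ofReal (1 - δ) * isoperimetricConst n * riemannianVol n G Ω ^ (n - 1)
      ≤ riemannianVol (n - 1) G (frontier Ω) ^ n

end RiemannianGeometry

/-! ### Distance-like functions -/

/-- `γ ≥ 0` is a distance-like function with base point `p` and constants `lam`, `Lam`, `C₀` (for
`Ric ≥ -l`): at the points with `d(x, p) ≥ C₀ / √l` it is smooth, and
`lam d(x, p) ≤ γ ≤ Lam d(x, p)`, `|∇γ| ≤ C₀`, `|Δγ| ≤ C₀ √l`. -/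
structure IsDistanceLike {n : ℕ} {M : Type*} [MetricSpace M]
    [ChartedSpace (EuclideanSpace ℝ (Fin n)) M] (g : MetricField n M)
    (p : M) (l lam Lam C₀ : ℝ) (γ : M → ℝ) : Prop where
  nonneg : ∀ x, 0 ≤ γ x
  smooth : ∀ x, C₀ / Real.sqrt l ≤ dist x p → ContMDiffAt (𝓡 n) 𝓘(ℝ, ℝ) ∞ γ x
  lower : ∀ x, C₀ / Real.sqrt l ≤ dist x p → lam * dist x p ≤ γ x
  upper : ∀ x, C₀ / Real.sqrt l ≤ dist x p → γ x ≤ Lam * dist x p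
  grad : ∀ x, C₀ / Real.sqrt l ≤ dist x p → gradNorm g γ x ≤ C₀
  lap : ∀ x, C₀ / Real.sqrt l ≤ dist x p → |laplaceBeltrami g γ x| ≤ C₀ * Real.sqrt l

/-- The sublevel set `U_ρ = γ⁻¹([0, ρ))`. -/
def sublevel {M : Type*} (γ : M → ℝ) (ρ : ℝ) : Set M := γ ⁻¹' Ico 0 ρ

end

/-! Let φ be a smooth step function of γ, equal to 1 up to the level ρ - w and to 0 from the level ρ
on, with w = c C₀ r √(l+1). The metric is h = φ⁻² g on {φ > 0} = U_ρ. On the ball where γ is not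
controlled φ is locally the constant 1, so φ is smooth on all of M. If A bounds the first two
derivatives of the step, the bounds on γ give |∇φ| ≤ K := A/(cr) and |Δφ| ≤ A/(cr)² + A/(cr). All
the conclusions follow from this.

Scalar curvature: S_h = φ² S + 2(n-1) φ Δφ - n(n-1)|∇φ|² (`scalarCurv_conformalField`). Only the
Laplacian of φ enters, not its Hessian, so the quantitative bounds on γ suffice
(`scalarCurv_estimate`).

Full curvature: here the Hessian of φ enters, but no explicit bound is needed. Multiplied by φ², the
curvature tensor of h is polynomial in φ, ∇φ, ∇²φ, the metric and the curvature of g. These are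
bounded on U_ρ, which lies in a closed ball, compact by Hopf–Rinow. The powers of φ in the h-norms
balance, so nothing blows up where φ tends to 0 (`riemannNormSq_conformalField_le`).

Completeness: |d log φ|_h = |dφ|_g ≤ K, so log φ is K-Lipschitz for h (`abs_differentialAt_log_le`).
Since φ ≤ 1, an h-Cauchy sequence is g-Cauchy and has a g-limit. Along it φ stays away from 0, so
the limit lies in U_ρ (`isCompleteMetricOn_conformalField`).

Isoperimetry: on an h-ball of radius r/8 centred at y, φ differs from φ(y) by a factor at most e^ε
either way, with ε = Kr/8. Hence h is almost a constant multiple of g there, and the isoperimetric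
ratio is scale invariant. The loss e^(2n(n-1)ε) turns 1 - δ₁ into at least 1 - 2δ₁ as soon as n² A/c
≤ δ₁, which determines c. The h-ball also lies in a g-ball of radius at most r inside U_ρ, where the
hypothesis applies (`almostEuclideanIsoperimetric_conformalField`). -/

/-! ### Connections, Hessians and curvature on a normed space: change of coordinates and conformal
change -/

section LocalCalculus

set_option synthInstance.maxHeartbeats 200000

variable {E F G' : Type*} [NormedAddCommGroup E] [NormedSpace ℝ E]
  [NormedAddCommGroup F] [NormedSpace ℝ F] [NormedAddCommGroup G'] [NormedSpace ℝ G']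

/-- `Γ` satisfies the Koszul identity of the metric `g` at `z`. -/
def IsLeviCivitaAt (g : E → E →L[ℝ] E →L[ℝ] ℝ) (Γ : E → E →L[ℝ] E →L[ℝ] E) (z : E) : Prop :=
  ∀ u v w, 2 * g z (Γ z u v) w = fderiv ℝ g z u v w + fderiv ℝ g z v u w - fderiv ℝ g z w u v

/-- A bilinear form with trivial kernel. -/
def NondegenerateForm (b : E →L[ℝ] E →L[ℝ] ℝ) : Prop := ∀ x, (∀ w, b x w = 0) → x = 0

/-- The curvature `R(u, v) w` of the connection `Γ`. -/
noncomputable def curvForm (Γ : E → E →L[ℝ] E →L[ℝ] E) (z u v w : E) : E :=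
  fderiv ℝ Γ z u v w - fderiv ℝ Γ z v u w + Γ z u (Γ z v w) - Γ z v (Γ z u w)

/-- The covariant Hessian of `φ` for the connection `Γ`. -/
noncomputable def hessForm (Γ : E → E →L[ℝ] E →L[ℝ] E) (φ : E → ℝ) (z u v : E) : ℝ :=
  fderiv ℝ (fderiv ℝ φ) z u v - fderiv ℝ φ z (Γ z u v)

lemma NondegenerateForm.eq_of_forall {b : E →L[ℝ] E →L[ℝ] ℝ} (hb : NondegenerateForm b) {x y : E}
    (h : ∀ w, b x w = b y w) : x = y :=
  sub_eq_zero.1 (hb _ fun w ↦ by simp [h w])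

lemma fderiv_clm_apply_apply {B : E → F →L[ℝ] F →L[ℝ] G'} {z : E} (hB : DifferentiableAt ℝ B z)
    (u : E) (v w : F) : fderiv ℝ (fun y ↦ B y v w) z u = fderiv ℝ B z u v w := by
  have h := (hB.hasFDerivAt.clm_apply (hasFDerivAt_const v z)).clm_apply (hasFDerivAt_const w z)
  rw [h.fderiv]
  simp

lemma fderiv_form_symm {g : E → E →L[ℝ] E →L[ℝ] ℝ} {z : E} (hg : DifferentiableAt ℝ g z)
    (hs : ∀ᶠ y in 𝓝 z, ∀ u v, g y u v = g y v u) (u v w : E) :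
    fderiv ℝ g z u v w = fderiv ℝ g z u w v := by
  rw [← fderiv_clm_apply_apply hg, ← fderiv_clm_apply_apply hg]
  congr 1
  exact Filter.EventuallyEq.fderiv_eq (hs.mono fun y hy ↦ hy v w)

/-- Vanishing torsion: the right-hand side of the Koszul identity is symmetric in its first two
arguments once g is, and nondegeneracy carries this over to Γ. -/
lemma IsLeviCivitaAt.symm {g : E → E →L[ℝ] E →L[ℝ] ℝ} {Γ : E → E →L[ℝ] E →L[ℝ] E} {z : E}
    (h : IsLeviCivitaAt g Γ z) (hn : NondegenerateForm (g z)) (hg : DifferentiableAt ℝ g z)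
    (hs : ∀ᶠ y in 𝓝 z, ∀ u v, g y u v = g y v u) (u v : E) : Γ z u v = Γ z v u := by
  refine hn.eq_of_forall fun w ↦ ?_
  have h1 := h u v w
  have h2 := h v u w
  have h3 := fderiv_form_symm hg hs w u v
  linarith

/-- Metric compatibility: adding two Koszul identities leaves only this derivative of g. -/
lemma IsLeviCivitaAt.fderiv_eq {g : E → E →L[ℝ] E →L[ℝ] ℝ} {Γ : E → E →L[ℝ] E →L[ℝ] E} {z : E}
    (h : IsLeviCivitaAt g Γ z) (hg : DifferentiableAt ℝ g z)
    (hs : ∀ᶠ y in 𝓝 z, ∀ u v, g y u v = g y v u) (u v w : E) :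
    fderiv ℝ g z u v w = g z (Γ z u v) w + g z v (Γ z u w) := by
  rw [hs.self_of_nhds v]
  have h1 := h u v w
  have h2 := h u w v
  have h3 := fderiv_form_symm hg hs u v w
  have h4 := fderiv_form_symm hg hs v u w
  have h5 := fderiv_form_symm hg hs w u v
  linarith

lemma hasFDerivAt_form_comp_apply {B : E → F →L[ℝ] F →L[ℝ] G'} {ψ : E → E} {p q : E → F}
    {z : E} {p' q' : E →L[ℝ] F} (hB : DifferentiableAt ℝ B (ψ z)) (hψ : DifferentiableAt ℝ ψ z)
    (hp : HasFDerivAt p p' z) (hq : HasFDerivAt q q' z) :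
    DifferentiableAt ℝ (fun y ↦ B (ψ y) (p y) (q y)) z ∧ ∀ a,
      fderiv ℝ (fun y ↦ B (ψ y) (p y) (q y)) z a =
        fderiv ℝ B (ψ z) (fderiv ℝ ψ z a) (p z) (q z) + B (ψ z) (p' a) (q z)
          + B (ψ z) (p z) (q' a) := by
  have h1 : HasFDerivAt (fun y ↦ B (ψ y)) ((fderiv ℝ B (ψ z)).comp (fderiv ℝ ψ z)) z :=
    HasFDerivAt.comp (g := B) z hB.hasFDerivAt hψ.hasFDerivAt
  have h3 := (h1.clm_apply hp).clm_apply hq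
  refine ⟨h3.differentiableAt, fun a ↦ ?_⟩
  rw [h3.fderiv]
  simp
  abel

lemma isLinearMap_curvForm_left (Γ : E → E →L[ℝ] E →L[ℝ] E) (z v w : E) :
    IsLinearMap ℝ fun u ↦ curvForm Γ z u v w where
  map_add a b := by
    have h := (fderiv ℝ Γ z).map_add a b
    simp only [curvForm, h, (Γ z).map_add, ContinuousLinearMap.map_add, add_apply]
    abel
  map_smul c a := by
    have h := (fderiv ℝ Γ z).map_smul c a
    simp only [curvForm, h, (Γ z).map_smul, ContinuousLinearMap.map_smul, smul_apply]
    module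

lemma isLinearMap_curvForm_mid (Γ : E → E →L[ℝ] E →L[ℝ] E) (z u w : E) :
    IsLinearMap ℝ fun v ↦ curvForm Γ z u v w where
  map_add a b := by
    have h := (fderiv ℝ Γ z).map_add a b
    simp only [curvForm, h, (Γ z).map_add, ContinuousLinearMap.map_add, add_apply]
    abel
  map_smul c a := by
    have h := (fderiv ℝ Γ z).map_smul c a
    simp only [curvForm, h, (Γ z).map_smul, ContinuousLinearMap.map_smul, smul_apply]
    module

lemma isLinearMap_curvForm_right (Γ : E → E →L[ℝ] E →L[ℝ] E) (z u v : E) :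
    IsLinearMap ℝ fun w ↦ curvForm Γ z u v w where
  map_add a b := by
    simp only [curvForm, ContinuousLinearMap.map_add]
    abel
  map_smul c a := by
    simp only [curvForm, ContinuousLinearMap.map_smul]
    module

/-- Differentiating the pulled back metric produces second derivatives of ψ. In the Koszul
combination their symmetry cancels all of them except twice g(D²ψ(u, v), Dψ w). As Dψ is onto, the
vectors Dψ w suffice to test equality. -/
lemma pullback_christoffel {g g' : E → E →L[ℝ] E →L[ℝ] ℝ} {Γ Γ' : E → E →L[ℝ] E →L[ℝ] E}
    {ψ : E → E} {z : E} (hg : DifferentiableAt ℝ g (ψ z)) (hg' : DifferentiableAt ℝ g' z)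
    (hψ : ContDiffAt ℝ 2 ψ z)
    (hgg' : ∀ᶠ y in 𝓝 z, ∀ u v, g' y u v = g (ψ y) (fderiv ℝ ψ y u) (fderiv ℝ ψ y v))
    (hsurj : Function.Surjective (fderiv ℝ ψ z))
    (hs : ∀ u v, g (ψ z) u v = g (ψ z) v u) (hn : NondegenerateForm (g (ψ z)))
    (hΓ : IsLeviCivitaAt g Γ (ψ z)) (hΓ' : IsLeviCivitaAt g' Γ' z) (u v : E) :
    fderiv ℝ ψ z (Γ' z u v) =
      fderiv ℝ (fderiv ℝ ψ) z u v + Γ (ψ z) (fderiv ℝ ψ z u) (fderiv ℝ ψ z v) := by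
  have hψ1 : DifferentiableAt ℝ ψ z := hψ.differentiableAt (by norm_num)
  have hψ2 : DifferentiableAt ℝ (fderiv ℝ ψ) z :=
    (hψ.fderiv_right (m := 1) (by norm_num)).differentiableAt (by norm_num)
  have hsymm : ∀ a b, fderiv ℝ (fderiv ℝ ψ) z a b = fderiv ℝ (fderiv ℝ ψ) z b a := fun a b ↦
    (hψ.isSymmSndFDerivAt (by simp)).eq a b
  have key : ∀ a b c, fderiv ℝ g' z a b c =
      fderiv ℝ g (ψ z) (fderiv ℝ ψ z a) (fderiv ℝ ψ z b) (fderiv ℝ ψ z c)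
      + g (ψ z) (fderiv ℝ (fderiv ℝ ψ) z a b) (fderiv ℝ ψ z c)
      + g (ψ z) (fderiv ℝ ψ z b) (fderiv ℝ (fderiv ℝ ψ) z a c) := by
    intro a b c
    rw [← fderiv_clm_apply_apply hg']
    have e : (fun y ↦ g' y b c) =ᶠ[𝓝 z]
        fun y ↦ g (ψ y) (fderiv ℝ ψ y b) (fderiv ℝ ψ y c) := hgg'.mono fun y hy ↦ hy b c
    rw [e.fderiv_eq]
    have h2 : ∀ d : E, HasFDerivAt (fun y ↦ fderiv ℝ ψ y d) _ z := fun d ↦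
      hψ2.hasFDerivAt.clm_apply (hasFDerivAt_const d z)
    rw [(hasFDerivAt_form_comp_apply hg hψ1 (h2 b) (h2 c)).2]
    simp
  refine hn.eq_of_forall fun w ↦ ?_
  obtain ⟨w, rfl⟩ := hsurj w
  rw [← hgg'.self_of_nhds]
  have h0 := hΓ' u v w
  rw [key, key, key] at h0
  have h1 := hΓ (fderiv ℝ ψ z u) (fderiv ℝ ψ z v) (fderiv ℝ ψ z w)
  rw [hsymm v u, hsymm w u, hsymm w v] at h0
  have e1 := hs (fderiv ℝ ψ z v) (fderiv ℝ (fderiv ℝ ψ) z u w)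
  have e2 := hs (fderiv ℝ ψ z u) (fderiv ℝ (fderiv ℝ ψ) z v w)
  simp only [map_add, add_apply]
  linarith

/-- The second derivative of ψ produced by the chain rule is cancelled by the inhomogeneous term of
the transformation law of Γ. -/
lemma pullback_hessForm {Γ Γ' : E → E →L[ℝ] E →L[ℝ] E} {ψ : E → E} {z : E} {φ φ' : E → ℝ}
    (hψ : ContDiffAt ℝ 2 ψ z) (hφ : ContDiffAt ℝ 2 φ (ψ z)) (hφφ' : φ' =ᶠ[𝓝 z] φ ∘ ψ)
    (hΓ : ∀ u v, fderiv ℝ ψ z (Γ' z u v) =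
      fderiv ℝ (fderiv ℝ ψ) z u v + Γ (ψ z) (fderiv ℝ ψ z u) (fderiv ℝ ψ z v)) (u v : E) :
    hessForm Γ' φ' z u v = hessForm Γ φ (ψ z) (fderiv ℝ ψ z u) (fderiv ℝ ψ z v) := by
  have hψ1 : DifferentiableAt ℝ ψ z := hψ.differentiableAt (by norm_num)
  have hψ2 : DifferentiableAt ℝ (fderiv ℝ ψ) z :=
    (hψ.fderiv_right (m := 1) (by norm_num)).differentiableAt (by norm_num)
  have hφ2 : DifferentiableAt ℝ (fderiv ℝ φ) (ψ z) :=
    (hφ.fderiv_right (m := 1) (by norm_num)).differentiableAt (by norm_num)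
  have e1 : ∀ᶠ y in 𝓝 z, fderiv ℝ φ' y = (fderiv ℝ φ (ψ y)).comp (fderiv ℝ ψ y) := by
    have hφe : ∀ᶠ y in 𝓝 z, DifferentiableAt ℝ φ (ψ y) :=
      hψ1.continuousAt.eventually
        ((hφ.eventually (by simp)).mono fun y hy ↦ hy.differentiableAt (by norm_num))
    filter_upwards [hφφ'.eventuallyEq_nhds, hφe, hψ.eventually (by simp)] with y h1 h2 h3
    rw [h1.fderiv_eq, fderiv_comp y h2 (h3.differentiableAt (by norm_num))]
  have e1' : fderiv ℝ φ' =ᶠ[𝓝 z] fun y ↦ (fderiv ℝ φ (ψ y)).comp (fderiv ℝ ψ y) := e1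
  have h := (hφ2.hasFDerivAt.comp z hψ1.hasFDerivAt).clm_comp hψ2.hasFDerivAt
  simp only [Function.comp_def] at h
  simp only [hessForm]
  rw [e1'.fderiv_eq, h.fderiv, e1.self_of_nhds]
  simp [hΓ]

/-- The transformation law of Γ is differentiated once and antisymmetrized in u, v. This removes the
third derivatives of ψ, and the law itself eliminates the second derivatives. -/
lemma pullback_curvForm {Γ Γ' : E → E →L[ℝ] E →L[ℝ] E} {ψ : E → E} {z : E}
    (hψ : ContDiffAt ℝ 3 ψ z) (hΓd : DifferentiableAt ℝ Γ (ψ z)) (hΓd' : DifferentiableAt ℝ Γ' z)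
    (hΓ : ∀ᶠ y in 𝓝 z, ∀ u v, fderiv ℝ ψ y (Γ' y u v) =
      fderiv ℝ (fderiv ℝ ψ) y u v + Γ (ψ y) (fderiv ℝ ψ y u) (fderiv ℝ ψ y v)) (u v w : E) :
    fderiv ℝ ψ z (curvForm Γ' z u v w) =
      curvForm Γ (ψ z) (fderiv ℝ ψ z u) (fderiv ℝ ψ z v) (fderiv ℝ ψ z w) := by
  have hψ1 : DifferentiableAt ℝ ψ z := hψ.differentiableAt (by norm_num)
  have hψ2' : ContDiffAt ℝ 2 (fderiv ℝ ψ) z := hψ.fderiv_right (by norm_num)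
  have hψ2 : DifferentiableAt ℝ (fderiv ℝ ψ) z := hψ2'.differentiableAt (by norm_num)
  have hψ3 : DifferentiableAt ℝ (fderiv ℝ (fderiv ℝ ψ)) z :=
    (hψ2'.fderiv_right (m := 1) (by norm_num)).differentiableAt (by norm_num)
  have h2s : ∀ a b, fderiv ℝ (fderiv ℝ ψ) z a b = fderiv ℝ (fderiv ℝ ψ) z b a := fun a b ↦
    ((hψ.of_le (m := 2) (by norm_num)).isSymmSndFDerivAt (by simp)).eq a b
  have h3s : ∀ a b, fderiv ℝ (fderiv ℝ (fderiv ℝ ψ)) z a b =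
      fderiv ℝ (fderiv ℝ (fderiv ℝ ψ)) z b a := fun a b ↦
    (hψ2'.isSymmSndFDerivAt (by simp) : IsSymmSndFDerivAt ℝ (fderiv ℝ ψ) z).eq a b
  have key : ∀ a b c, fderiv ℝ (fderiv ℝ ψ) z a (Γ' z b c) + fderiv ℝ ψ z (fderiv ℝ Γ' z a b c) =
      fderiv ℝ (fderiv ℝ (fderiv ℝ ψ)) z a b c
      + (fderiv ℝ Γ (ψ z) (fderiv ℝ ψ z a) (fderiv ℝ ψ z b) (fderiv ℝ ψ z c)
        + Γ (ψ z) (fderiv ℝ (fderiv ℝ ψ) z a b) (fderiv ℝ ψ z c)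
        + Γ (ψ z) (fderiv ℝ ψ z b) (fderiv ℝ (fderiv ℝ ψ) z a c)) := by
    intro a b c
    have e : (fun y ↦ fderiv ℝ ψ y (Γ' y b c)) =ᶠ[𝓝 z] fun y ↦ fderiv ℝ (fderiv ℝ ψ) y b c
        + Γ (ψ y) (fderiv ℝ ψ y b) (fderiv ℝ ψ y c) := hΓ.mono fun y hy ↦ hy b c
    have h2 : ∀ d : E, HasFDerivAt (fun y ↦ fderiv ℝ ψ y d) _ z := fun d ↦
      hψ2.hasFDerivAt.clm_apply (hasFDerivAt_const d z)
    have hL := hψ2.hasFDerivAt.clm_apply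
      ((hΓd'.hasFDerivAt.clm_apply (hasFDerivAt_const b z)).clm_apply (hasFDerivAt_const c z))
    have h1 := hasFDerivAt_form_comp_apply hΓd hψ1 (h2 b) (h2 c)
    have h3 := (hψ3.hasFDerivAt.clm_apply (hasFDerivAt_const b z)).clm_apply (hasFDerivAt_const c z)
    have := congrArg (fun L : E →L[ℝ] E ↦ L a) e.fderiv_eq
    rw [hL.fderiv, fderiv_fun_add h3.differentiableAt h1.1, h3.fderiv] at this
    simp [h1.2] at this
    exact (add_comm _ _).trans this
  have hz := hΓ.self_of_nhds
  have e2 : ∀ a b, fderiv ℝ (fderiv ℝ ψ) z a b =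
      fderiv ℝ ψ z (Γ' z a b) - Γ (ψ z) (fderiv ℝ ψ z a) (fderiv ℝ ψ z b) := fun a b ↦ by
    rw [hz]; abel
  have k1 := key u v w
  have k2 := key v u w
  rw [h3s v u, h2s v u] at k2
  have A : fderiv ℝ ψ z (fderiv ℝ Γ' z u v w) - fderiv ℝ ψ z (fderiv ℝ Γ' z v u w) =
      (fderiv ℝ Γ (ψ z) (fderiv ℝ ψ z u) (fderiv ℝ ψ z v) (fderiv ℝ ψ z w)
        + Γ (ψ z) (fderiv ℝ ψ z v) (fderiv ℝ (fderiv ℝ ψ) z u w)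
        - fderiv ℝ (fderiv ℝ ψ) z u (Γ' z v w)) -
      (fderiv ℝ Γ (ψ z) (fderiv ℝ ψ z v) (fderiv ℝ ψ z u) (fderiv ℝ ψ z w)
        + Γ (ψ z) (fderiv ℝ ψ z u) (fderiv ℝ (fderiv ℝ ψ) z v w)
        - fderiv ℝ (fderiv ℝ ψ) z v (Γ' z u w)) := by
    have k1' := eq_sub_of_add_eq' k1
    have k2' := eq_sub_of_add_eq' k2
    rw [k1', k2']
    abel
  rw [e2 u (Γ' z v w), e2 v (Γ' z u w), hz v w, hz u w] at A
  simp only [curvForm, map_add, map_sub]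
  rw [A]
  simp only [map_add]
  abel

/-- The Koszul identities of g and of g' = φ⁻² g are compared. Denominators are cleared throughout,
and X is the g-gradient of φ. -/
lemma conformal_christoffel {g g' : E → E →L[ℝ] E →L[ℝ] ℝ} {Γ Γ' : E → E →L[ℝ] E →L[ℝ] E}
    {φ : E → ℝ} {X : E} {z : E} (hg : DifferentiableAt ℝ g z) (hg'd : DifferentiableAt ℝ g' z)
    (hn : NondegenerateForm (g z))
    (hφ : DifferentiableAt ℝ φ z)
    (hg' : ∀ᶠ y in 𝓝 z, ∀ u v, φ y ^ 2 * g' y u v = g y u v)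
    (hX : ∀ w, g z X w = fderiv ℝ φ z w)
    (hΓ : IsLeviCivitaAt g Γ z) (hΓ' : IsLeviCivitaAt g' Γ' z) (u v : E) :
    φ z • Γ' z u v = φ z • Γ z u v - fderiv ℝ φ z u • v - fderiv ℝ φ z v • u + g z u v • X := by
  have key : ∀ a b c, φ z ^ 2 * fderiv ℝ g' z a b c
      + 2 * φ z * fderiv ℝ φ z a * g' z b c = fderiv ℝ g z a b c := by
    intro a b c
    rw [← fderiv_clm_apply_apply hg, ← fderiv_clm_apply_apply hg'd]
    have e : (fun y ↦ φ y ^ 2 * g' y b c) =ᶠ[𝓝 z] fun y ↦ g y b c := hg'.mono fun y hy ↦ hy b c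
    have hd : DifferentiableAt ℝ (fun y ↦ g' y b c) z := by fun_prop
    have h := (hφ.hasFDerivAt.pow 2).mul hd.hasFDerivAt
    have h' : HasFDerivAt (fun y ↦ φ y ^ 2 * g' y b c) _ z := h
    rw [← e.fderiv_eq, h'.fderiv]
    simp
    ring
  refine hn.eq_of_forall fun w ↦ ?_
  have hz := hg'.self_of_nhds
  have h1 := hΓ' u v w
  have h2 := hΓ u v w
  rw [← key, ← key, ← key] at h2
  simp only [map_add, map_sub, map_smul, add_apply,
    sub_apply, smul_apply, smul_eq_mul, hX]
  have e1 : g z (Γ' z u v) w = φ z ^ 2 * g' z (Γ' z u v) w := (hz _ _).symm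
  rw [e1]
  rw [← hz u v, ← hz v w, ← hz u w]
  linear_combination (φ z ^ 3 / 2) * h1 - (φ z / 2) * h2

/-- Differentiating g(X, w) = dφ(w) and using metric compatibility turns the derivative of g into
the two connection terms. -/
lemma hess_eq_covariant_gradient {g : E → E →L[ℝ] E →L[ℝ] ℝ} {Γ : E → E →L[ℝ] E →L[ℝ] E}
    {φ : E → ℝ} {X : E → E} {z : E} (hg : DifferentiableAt ℝ g z)
    (hs : ∀ᶠ y in 𝓝 z, ∀ u v, g y u v = g y v u) (hφ : DifferentiableAt ℝ (fderiv ℝ φ) z)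
    (hXd : DifferentiableAt ℝ X z)
    (hX : ∀ᶠ y in 𝓝 z, ∀ w, g y (X y) w = fderiv ℝ φ y w)
    (hΓ : IsLeviCivitaAt g Γ z) (u w : E) :
    g z (fderiv ℝ X z u + Γ z u (X z)) w = hessForm Γ φ z u w := by
  have e : (fun y ↦ g y (X y) w) =ᶠ[𝓝 z] fun y ↦ fderiv ℝ φ y w := hX.mono fun y hy ↦ hy w
  have h1 := (hg.hasFDerivAt.clm_apply hXd.hasFDerivAt).clm_apply (hasFDerivAt_const w z)
  have h2 := hφ.hasFDerivAt.clm_apply (hasFDerivAt_const w z)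
  have := congrArg (fun L : E →L[ℝ] ℝ ↦ L u) e.fderiv_eq
  rw [h1.fderiv, h2.fderiv] at this
  simp at this
  have h3 := hΓ.fderiv_eq hg hs u (X z) w
  have h4 := hX.self_of_nhds (Γ z u w)
  simp only [hessForm, map_add, add_apply]
  linarith

/-- The covariant derivative of X is left unevaluated here. Paired with a vector it becomes the
Hessian of φ, by `hess_eq_covariant_gradient`. -/
lemma conformal_curvForm {g : E → E →L[ℝ] E →L[ℝ] ℝ} {Γ Γ' : E → E →L[ℝ] E →L[ℝ] E}
    {φ : E → ℝ} {X : E → E} {z : E} (hg : DifferentiableAt ℝ g z)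
    (hs : ∀ᶠ y in 𝓝 z, ∀ u v, g y u v = g y v u) (hn : NondegenerateForm (g z))
    (hΓd : DifferentiableAt ℝ Γ z) (hΓd' : DifferentiableAt ℝ Γ' z)
    (hφ : ContDiffAt ℝ 2 φ z) (hXd : DifferentiableAt ℝ X z)
    (hX : ∀ w, g z (X z) w = fderiv ℝ φ z w) (hΓ : IsLeviCivitaAt g Γ z)
    (hΓ' : ∀ᶠ y in 𝓝 z, ∀ u v, φ y • Γ' y u v =
      φ y • Γ y u v - fderiv ℝ φ y u • v - fderiv ℝ φ y v • u + g y u v • X y) (u v w : E) :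
    φ z ^ 2 • curvForm Γ' z u v w = φ z ^ 2 • curvForm Γ z u v w
      + φ z • (hessForm Γ φ z v w • u - hessForm Γ φ z u w • v
        + g z v w • (fderiv ℝ X z u + Γ z u (X z)) - g z u w • (fderiv ℝ X z v + Γ z v (X z)))
      + g z (X z) (X z) • (g z u w • v - g z v w • u) := by
  have hφ1 : DifferentiableAt ℝ φ z := hφ.differentiableAt (by norm_num)
  have hφ2 : DifferentiableAt ℝ (fderiv ℝ φ) z :=
    (hφ.fderiv_right (m := 1) (by norm_num)).differentiableAt (by norm_num)
  have h2s : fderiv ℝ (fderiv ℝ φ) z v u = fderiv ℝ (fderiv ℝ φ) z u v :=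
    (hφ.isSymmSndFDerivAt (by simp)).eq v u
  have hz := hΓ'.self_of_nhds
  have key : ∀ a b c, φ z • fderiv ℝ Γ' z a b c + fderiv ℝ φ z a • Γ' z b c =
      φ z • fderiv ℝ Γ z a b c + fderiv ℝ φ z a • Γ z b c
      - fderiv ℝ (fderiv ℝ φ) z a b • c - fderiv ℝ (fderiv ℝ φ) z a c • b
      + (g z b c • fderiv ℝ X z a + fderiv ℝ g z a b c • X z) := by
    intro a b c
    have e : (fun y ↦ φ y • Γ' y b c) =ᶠ[𝓝 z] fun y ↦ φ y • Γ y b c - fderiv ℝ φ y b • c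
        - fderiv ℝ φ y c • b + g y b c • X y := hΓ'.mono fun y hy ↦ hy b c
    have d1 : DifferentiableAt ℝ (fun y ↦ Γ' y b c) z := by fun_prop
    have d2 : DifferentiableAt ℝ (fun y ↦ Γ y b c) z := by fun_prop
    have d3 : DifferentiableAt ℝ (fun y ↦ g y b c) z := by fun_prop
    have d4 : ∀ d, HasFDerivAt (fun y ↦ fderiv ℝ φ y d) _ z := fun d ↦
      hφ2.hasFDerivAt.clm_apply (hasFDerivAt_const d z)
    have hL := hφ1.hasFDerivAt.fun_smul d1.hasFDerivAt
    have hR := (((hφ1.hasFDerivAt.fun_smul d2.hasFDerivAt).fun_sub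
      ((d4 b).fun_smul (hasFDerivAt_const c z))).fun_sub
      ((d4 c).fun_smul (hasFDerivAt_const b z))).fun_add
      (d3.hasFDerivAt.fun_smul hXd.hasFDerivAt)
    have := congrArg (fun L : E →L[ℝ] E ↦ L a) e.fderiv_eq
    rw [hL.fderiv, hR.fderiv] at this
    simpa [fderiv_clm_apply_apply hg, fderiv_clm_apply_apply hΓd,
      fderiv_clm_apply_apply hΓd'] using this
  -- Only φ Γ' has a known expression, so the derivative of Γ' and the composite of Γ' with itself
  -- are both computed after multiplication by φ².
  have E1 : ∀ a b c, φ z ^ 2 • fderiv ℝ Γ' z a b c = φ z • (φ z • fderiv ℝ Γ z a b c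
      + fderiv ℝ φ z a • Γ z b c
      - fderiv ℝ (fderiv ℝ φ) z a b • c - fderiv ℝ (fderiv ℝ φ) z a c • b
      + (g z b c • fderiv ℝ X z a + fderiv ℝ g z a b c • X z)) - fderiv ℝ φ z a • (φ z • Γ z b c
        - fderiv ℝ φ z b • c - fderiv ℝ φ z c • b + g z b c • X z) := by
    intro a b c
    rw [← key, ← hz]
    module
  have E2 : ∀ a b c, φ z ^ 2 • Γ' z a (Γ' z b c) =
      φ z • Γ z a (φ z • Γ z b c - fderiv ℝ φ z b • c - fderiv ℝ φ z c • b + g z b c • X z)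
      - fderiv ℝ φ z a • (φ z • Γ z b c - fderiv ℝ φ z b • c - fderiv ℝ φ z c • b + g z b c • X z)
      - fderiv ℝ φ z (φ z • Γ z b c - fderiv ℝ φ z b • c - fderiv ℝ φ z c • b + g z b c • X z) • a
      + g z a (φ z • Γ z b c - fderiv ℝ φ z b • c - fderiv ℝ φ z c • b + g z b c • X z) • X z := by
    intro a b c
    rw [← hz, ← hz, map_smul]
    module
  have dg := hΓ.fderiv_eq hg hs
  have sΓ := hΓ.symm hn hg hs v u
  have sg := hs.self_of_nhds
  have gX : ∀ a, g z a (X z) = fderiv ℝ φ z a := fun a ↦ by rw [sg, hX]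
  simp only [curvForm, smul_add, smul_sub, E1, E2, hessForm]
  simp only [dg, sΓ, h2s, map_add, map_sub, map_smul, gX, smul_eq_mul, sg v u, smul_add, smul_sub]
  module

end LocalCalculus

/-! ### The coordinate definitions expressed through bilinear forms in one chart -/

section Coordinates

set_option synthInstance.maxHeartbeats 200000

variable {n : ℕ}

lemma stdVec_apply (i j : Fin n) : stdVec i j = if j = i then (1 : ℝ) else 0 := by
  simp [stdVec]

lemma eq_sum_stdVec (v : EuclideanSpace ℝ (Fin n)) : v = ∑ i, v i • stdVec i := by
  ext j
  simp [stdVec_apply]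

lemma eq_of_eq_on_stdVec {V : Type*} [AddCommGroup V] [Module ℝ V]
    {f₁ f₂ : EuclideanSpace ℝ (Fin n) → V} (h₁ : IsLinearMap ℝ f₁) (h₂ : IsLinearMap ℝ f₂)
    (h : ∀ i, f₁ (stdVec i) = f₂ (stdVec i)) (v : EuclideanSpace ℝ (Fin n)) : f₁ v = f₂ v := by
  have e₁ : ∀ v, f₁ v = h₁.mk' f₁ v := fun _ ↦ rfl
  have e₂ : ∀ v, f₂ v = h₂.mk' f₂ v := fun _ ↦ rfl
  rw [e₁, e₂, eq_sum_stdVec v]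
  simp [h]

/-- The bilinear map with the coefficients `a`. -/
noncomputable def coeffForm {F : Type*} [NormedAddCommGroup F] [NormedSpace ℝ F]
    (a : Fin n → Fin n → F) :
    EuclideanSpace ℝ (Fin n) →L[ℝ] EuclideanSpace ℝ (Fin n) →L[ℝ] F :=
  ∑ i, ∑ j, ContinuousLinearMap.smulRightL ℝ _ _ (EuclideanSpace.proj i)
    (ContinuousLinearMap.smulRightL ℝ _ _ (EuclideanSpace.proj j) (a i j))

section

variable {F : Type*} [NormedAddCommGroup F] [NormedSpace ℝ F]

lemma coeffForm_apply (a : Fin n → Fin n → F) (u v : EuclideanSpace ℝ (Fin n)) :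
    coeffForm a u v = ∑ i, ∑ j, (u i * v j) • a i j := by
  simp [coeffForm, smul_smul]

lemma coeffForm_stdVec (a : Fin n → Fin n → F) (i j : Fin n) :
    coeffForm a (stdVec i) (stdVec j) = a i j := by
  simp [coeffForm_apply, stdVec_apply]

lemma contDiffAt_coeffForm {E : Type*} [NormedAddCommGroup E] [NormedSpace ℝ E] {k : ℕ∞ω}
    {a : E → Fin n → Fin n → F} {z : E} (ha : ∀ i j, ContDiffAt ℝ k (fun y ↦ a y i j) z) :
    ContDiffAt ℝ k (fun y ↦ coeffForm (a y)) z := by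
  unfold coeffForm
  refine ContDiffAt.sum fun i _ ↦ ContDiffAt.sum fun j _ ↦ ?_
  exact (ContinuousLinearMap.contDiff _).contDiffAt.comp z
    ((ContinuousLinearMap.contDiff _).contDiffAt.comp z (ha i j))

end

lemma contDiffAt_det {E : Type*} [NormedAddCommGroup E] [NormedSpace ℝ E] {k : ℕ∞ω}
    {a : E → Matrix (Fin n) (Fin n) ℝ} {z : E}
    (ha : ∀ i j, ContDiffAt ℝ k (fun y ↦ a y i j) z) : ContDiffAt ℝ k (fun y ↦ (a y).det) z := by
  simp only [Matrix.det_apply]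
  refine ContDiffAt.sum fun σ _ ↦ ContDiffAt.const_smul _ ?_
  exact contDiffAt_prod fun i _ ↦ ha _ _

/-- Cramer's rule: the entries of the adjugate are determinants of the matrix with one row replaced
by a constant one. -/
lemma contDiffAt_matrix_inv {E : Type*} [NormedAddCommGroup E] [NormedSpace ℝ E] {k : ℕ∞ω}
    {a : E → Matrix (Fin n) (Fin n) ℝ} {z : E}
    (ha : ∀ i j, ContDiffAt ℝ k (fun y ↦ a y i j) z) (hd : (a z).det ≠ 0) (i j : Fin n) :
    ContDiffAt ℝ k (fun y ↦ (a y)⁻¹ i j) z := by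
  simp only [Matrix.inv_def, Matrix.smul_apply, Ring.inverse_eq_inv', smul_eq_mul]
  refine ((contDiffAt_det ha).inv hd).mul ?_
  simp only [Matrix.adjugate_apply]
  refine contDiffAt_det fun p q ↦ ?_
  by_cases hp : p = j
  · subst hp
    simpa using contDiffAt_const
  · simpa [Matrix.updateRow_apply, hp] using ha p q

lemma contDiffAt_pderivCoord {f : EuclideanSpace ℝ (Fin n) → ℝ} {z : EuclideanSpace ℝ (Fin n)}
    (hf : ContDiffAt ℝ ∞ f z) (i : Fin n) : ContDiffAt ℝ ∞ (pderivCoord i f) z :=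
  (hf.fderiv_right (m := ∞) (by simp)).clm_apply contDiffAt_const

lemma pderivCoord_pderivCoord {f : EuclideanSpace ℝ (Fin n) → ℝ} {z : EuclideanSpace ℝ (Fin n)}
    (hf : ContDiffAt ℝ 2 f z) (i j : Fin n) :
    pderivCoord i (pderivCoord j f) z = fderiv ℝ (fderiv ℝ f) z (stdVec i) (stdVec j) := by
  have hf2 : DifferentiableAt ℝ (fderiv ℝ f) z :=
    (hf.fderiv_right (m := 1) (by norm_num)).differentiableAt (by norm_num)
  have h := hf2.hasFDerivAt.clm_apply (hasFDerivAt_const (stdVec j) z)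
  unfold pderivCoord
  rw [h.fderiv]
  simp

variable {M : Type*} [TopologicalSpace M] [ChartedSpace (EuclideanSpace ℝ (Fin n)) M]

/-- The bilinear form of `G` in the preferred chart around `x`. -/
noncomputable def metricForm (G : MetricField n M) (x : M) (z : EuclideanSpace ℝ (Fin n)) :
    EuclideanSpace ℝ (Fin n) →L[ℝ] EuclideanSpace ℝ (Fin n) →L[ℝ] ℝ :=
  coeffForm fun i j ↦ metricCoord G x z i j

/-- The connection form of `G` in the preferred chart around `x`. -/
noncomputable def christForm (G : MetricField n M) (x : M) (z : EuclideanSpace ℝ (Fin n)) :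
    EuclideanSpace ℝ (Fin n) →L[ℝ] EuclideanSpace ℝ (Fin n) →L[ℝ] EuclideanSpace ℝ (Fin n) :=
  coeffForm fun i j ↦ ∑ k, christoffel G x k i j z • stdVec k

/-- The gradient of `φ` in the preferred chart around `x`. -/
noncomputable def gradVec (G : MetricField n M) (x : M) (φ : EuclideanSpace ℝ (Fin n) → ℝ)
    (z : EuclideanSpace ℝ (Fin n)) : EuclideanSpace ℝ (Fin n) :=
  ∑ i, (∑ j, (metricCoord G x z)⁻¹ i j * pderivCoord j φ z) • stdVec i

/-- The components of `G` in the preferred chart around `x` are, near `z`, those of a smooth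
Riemannian metric. -/
structure IsMetricNear (G : MetricField n M) (x : M) (z : EuclideanSpace ℝ (Fin n)) : Prop where
  smooth : ∀ i j, ContDiffAt ℝ ∞ (fun y ↦ metricCoord G x y i j) z
  symm : ∀ᶠ y in 𝓝 z, ∀ i j, metricCoord G x y i j = metricCoord G x y j i
  posDef : (metricCoord G x z).PosDef

variable {G : MetricField n M} {x : M} {z : EuclideanSpace ℝ (Fin n)}

lemma christForm_stdVec_apply (G : MetricField n M) (x : M) (z : EuclideanSpace ℝ (Fin n))
    (i j k : Fin n) : christForm G x z (stdVec i) (stdVec j) k = christoffel G x k i j z := by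
  simp [christForm, coeffForm_stdVec, stdVec_apply]

lemma metricForm_stdVec (G : MetricField n M) (x : M) (z : EuclideanSpace ℝ (Fin n))
    (i j : Fin n) : metricForm G x z (stdVec i) (stdVec j) = metricCoord G x z i j :=
  coeffForm_stdVec _ _ _

lemma IsMetricNear.det_ne_zero (h : IsMetricNear G x z) : (metricCoord G x z).det ≠ 0 :=
  h.posDef.det_pos.ne'

lemma IsMetricNear.contDiffAt_inv (h : IsMetricNear G x z) (i j : Fin n) :
    ContDiffAt ℝ ∞ (fun y ↦ (metricCoord G x y)⁻¹ i j) z :=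
  contDiffAt_matrix_inv h.smooth h.det_ne_zero i j

lemma IsMetricNear.contDiffAt_christoffel (h : IsMetricNear G x z) (k i j : Fin n) :
    ContDiffAt ℝ ∞ (christoffel G x k i j) z := by
  unfold christoffel
  refine contDiffAt_const.mul (ContDiffAt.sum fun m _ ↦ (h.contDiffAt_inv k m).mul ?_)
  exact ((contDiffAt_pderivCoord (h.smooth j m) i).add
    (contDiffAt_pderivCoord (h.smooth i m) j)).sub (contDiffAt_pderivCoord (h.smooth i j) m)

lemma IsMetricNear.contDiffAt_christForm (h : IsMetricNear G x z) :
    ContDiffAt ℝ ∞ (christForm G x) z :=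
  contDiffAt_coeffForm fun i j ↦ ContDiffAt.sum fun k _ ↦
    (h.contDiffAt_christoffel k i j).smul contDiffAt_const

lemma IsMetricNear.contDiffAt_metricForm (h : IsMetricNear G x z) :
    ContDiffAt ℝ ∞ (metricForm G x) z :=
  contDiffAt_coeffForm h.smooth

lemma IsMetricNear.contDiffAt_gradVec (h : IsMetricNear G x z)
    {φ : EuclideanSpace ℝ (Fin n) → ℝ} (hφ : ContDiffAt ℝ ∞ φ z) :
    ContDiffAt ℝ ∞ (gradVec G x φ) z := by
  unfold gradVec
  exact ContDiffAt.sum fun i _ ↦ (ContDiffAt.sum fun j _ ↦ (h.contDiffAt_inv i j).mul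
    (contDiffAt_pderivCoord hφ j)).smul contDiffAt_const

lemma IsMetricNear.eventually_symm (h : IsMetricNear G x z) :
    ∀ᶠ y in 𝓝 z, ∀ u v, metricForm G x y u v = metricForm G x y v u := by
  filter_upwards [h.symm] with y hy u v
  rw [metricForm, coeffForm_apply, coeffForm_apply, Finset.sum_comm]
  refine Finset.sum_congr rfl fun i _ ↦ Finset.sum_congr rfl fun j _ ↦ ?_
  rw [hy, mul_comm (u j)]

lemma metricForm_apply (G : MetricField n M) (x : M) (z u v : EuclideanSpace ℝ (Fin n)) :
    metricForm G x z u v = u.ofLp ⬝ᵥ (metricCoord G x z).mulVec v.ofLp := by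
  simp only [metricForm, coeffForm_apply, dotProduct, Matrix.mulVec, smul_eq_mul, Finset.mul_sum]
  refine Finset.sum_congr rfl fun i _ ↦ Finset.sum_congr rfl fun j _ ↦ ?_
  ring

lemma IsMetricNear.metricForm_pos (h : IsMetricNear G x z) {u : EuclideanSpace ℝ (Fin n)}
    (hu : u ≠ 0) : 0 < metricForm G x z u u := by
  rw [metricForm_apply]
  have := h.posDef.dotProduct_mulVec_pos (x := u.ofLp) (by simpa using hu)
  simpa using this

lemma IsMetricNear.metricForm_nonneg (h : IsMetricNear G x z) (u : EuclideanSpace ℝ (Fin n)) :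
    0 ≤ metricForm G x z u u := by
  rcases eq_or_ne u 0 with rfl | hu
  · simp
  · exact (h.metricForm_pos hu).le

lemma IsMetricNear.nondegenerate (h : IsMetricNear G x z) :
    NondegenerateForm (metricForm G x z) := by
  intro u hu
  by_contra hne
  exact (h.metricForm_pos hne).ne' (hu u)

lemma IsMetricNear.eventually_det_ne_zero (h : IsMetricNear G x z) :
    ∀ᶠ y in 𝓝 z, (metricCoord G x y).det ≠ 0 :=
  (contDiffAt_det h.smooth).continuousAt.eventually_ne h.det_ne_zero

lemma fderiv_metricForm (hd : DifferentiableAt ℝ (metricForm G x) z) (i j m : Fin n) :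
    fderiv ℝ (metricForm G x) z (stdVec m) (stdVec i) (stdVec j) =
      pderivCoord m (fun w ↦ metricCoord G x w i j) z := by
  rw [← fderiv_clm_apply_apply hd]
  simp only [metricForm_stdVec, pderivCoord]

/-- Raising an index and lowering it again. This serves both for the gradient and for the
Christoffel symbols. -/
lemma sum_inv_mul_metricForm (hd : (metricCoord G x z).det ≠ 0)
    (hs : ∀ i j, metricCoord G x z i j = metricCoord G x z j i) (a : Fin n → ℝ) (l : Fin n) :
    metricForm G x z (∑ k, (∑ m, (metricCoord G x z)⁻¹ k m * a m) • stdVec k) (stdVec l) = a l := by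
  simp only [map_sum, map_smul, sum_apply, smul_apply, metricForm_stdVec, smul_eq_mul,
    Finset.sum_mul]
  rw [Finset.sum_comm]
  have h1 : ∀ m, ∑ k, metricCoord G x z l k * (metricCoord G x z)⁻¹ k m =
      (1 : Matrix (Fin n) (Fin n) ℝ) l m := fun m ↦ by
    rw [← Matrix.mul_apply, Matrix.mul_nonsing_inv _ (isUnit_iff_ne_zero.2 hd)]
  calc _ = ∑ m, a m * ∑ k, metricCoord G x z l k * (metricCoord G x z)⁻¹ k m := by
        refine Finset.sum_congr rfl fun m _ ↦ ?_
        rw [Finset.mul_sum]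
        refine Finset.sum_congr rfl fun k _ ↦ ?_
        rw [hs k l]; ring
    _ = a l := by simp [h1, Matrix.one_apply]

lemma metricForm_gradVec (hd : (metricCoord G x z).det ≠ 0)
    (hs : ∀ i j, metricCoord G x z i j = metricCoord G x z j i)
    (φ : EuclideanSpace ℝ (Fin n) → ℝ) (w : EuclideanSpace ℝ (Fin n)) :
    metricForm G x z (gradVec G x φ z) w = fderiv ℝ φ z w :=
  eq_of_eq_on_stdVec ⟨map_add _, map_smul _⟩ ⟨map_add _, map_smul _⟩
    (fun l ↦ sum_inv_mul_metricForm hd hs (fun j ↦ pderivCoord j φ z) l) w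

/-- On coordinate vectors the Koszul identity is the definition of the Christoffel symbols with the
index lowered. Linearity in each of the three slots then extends it to all vectors. -/
lemma isLeviCivitaAt_christForm (hg : DifferentiableAt ℝ (metricForm G x) z)
    (hd : (metricCoord G x z).det ≠ 0)
    (hs : ∀ i j, metricCoord G x z i j = metricCoord G x z j i) :
    IsLeviCivitaAt (metricForm G x) (christForm G x) z := by
  have key : ∀ i j l, 2 * metricForm G x z (christForm G x z (stdVec i) (stdVec j)) (stdVec l) =
      fderiv ℝ (metricForm G x) z (stdVec i) (stdVec j) (stdVec l)
      + fderiv ℝ (metricForm G x) z (stdVec j) (stdVec i) (stdVec l)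
      - fderiv ℝ (metricForm G x) z (stdVec l) (stdVec i) (stdVec j) := by
    intro i j l
    have h := sum_inv_mul_metricForm hd hs (fun m ↦ (1 / 2 : ℝ) *
      (pderivCoord i (fun w ↦ metricCoord G x w j m) z
      + pderivCoord j (fun w ↦ metricCoord G x w i m) z
      - pderivCoord m (fun w ↦ metricCoord G x w i j) z)) l
    have e : christForm G x z (stdVec i) (stdVec j) =
        ∑ k, (∑ m, (metricCoord G x z)⁻¹ k m * ((1 / 2 : ℝ) *
      (pderivCoord i (fun w ↦ metricCoord G x w j m) z
      + pderivCoord j (fun w ↦ metricCoord G x w i m) z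
      - pderivCoord m (fun w ↦ metricCoord G x w i j) z))) • stdVec k := by
      rw [christForm, coeffForm_stdVec]
      refine Finset.sum_congr rfl fun k _ ↦ ?_
      rw [christoffel, Finset.mul_sum]
      congr 1
      refine Finset.sum_congr rfl fun m _ ↦ ?_
      ring
    rw [e, h, fderiv_metricForm hg, fderiv_metricForm hg, fderiv_metricForm hg]
    ring
  intro u v w
  refine eq_of_eq_on_stdVec (f₁ := fun u ↦ 2 * metricForm G x z (christForm G x z u v) w)
    (f₂ := fun u ↦ fderiv ℝ (metricForm G x) z u v w + fderiv ℝ (metricForm G x) z v u w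
      - fderiv ℝ (metricForm G x) z w u v) (by constructor <;> intros <;> simp <;> ring)
    (by constructor <;> intros <;> simp <;> ring) (fun i ↦ ?_) u
  refine eq_of_eq_on_stdVec
    (f₁ := fun v ↦ 2 * metricForm G x z (christForm G x z (stdVec i) v) w)
    (f₂ := fun v ↦ fderiv ℝ (metricForm G x) z (stdVec i) v w
      + fderiv ℝ (metricForm G x) z v (stdVec i) w
      - fderiv ℝ (metricForm G x) z w (stdVec i) v) (by constructor <;> intros <;> simp <;> ring)
    (by constructor <;> intros <;> simp <;> ring) (fun j ↦ ?_) v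
  refine eq_of_eq_on_stdVec
    (f₁ := fun w ↦ 2 * metricForm G x z (christForm G x z (stdVec i) (stdVec j)) w)
    (f₂ := fun w ↦ fderiv ℝ (metricForm G x) z (stdVec i) (stdVec j) w
      + fderiv ℝ (metricForm G x) z (stdVec j) (stdVec i) w
      - fderiv ℝ (metricForm G x) z w (stdVec i) (stdVec j)) (by constructor <;> intros <;> simp <;> ring)
    (by constructor <;> intros <;> simp <;> ring) (fun l ↦ ?_) w
  exact key i j l

lemma IsMetricNear.eventually_isLeviCivitaAt (h : IsMetricNear G x z) :
    ∀ᶠ y in 𝓝 z, IsLeviCivitaAt (metricForm G x) (christForm G x) y := by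
  have hd : ∀ᶠ y in 𝓝 z, DifferentiableAt ℝ (metricForm G x) y :=
    ((h.contDiffAt_metricForm.of_le (m := 1) (by norm_cast)).eventually
      (by simp)).mono fun y hy ↦ hy.differentiableAt (by norm_num)
  filter_upwards [h.symm, h.eventually_det_ne_zero, hd] with y h1 h2 h3
  exact isLeviCivitaAt_christForm h3 h2 h1

lemma pderivCoord_christoffel (hd : DifferentiableAt ℝ (christForm G x) z) (a i j k : Fin n) :
    pderivCoord i (christoffel G x a j k) z =
      fderiv ℝ (christForm G x) z (stdVec i) (stdVec j) (stdVec k) a := by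
  have h1 : DifferentiableAt ℝ (fun y ↦ christForm G x y (stdVec j) (stdVec k)) z := by fun_prop
  rw [← fderiv_clm_apply_apply hd]
  have e : christoffel G x a j k =
      fun y ↦ (EuclideanSpace.proj a : EuclideanSpace ℝ (Fin n) →L[ℝ] ℝ)
        (christForm G x y (stdVec j) (stdVec k)) := by
    funext y
    simp [christForm_stdVec_apply]
  have h2 := (EuclideanSpace.proj a : EuclideanSpace ℝ (Fin n) →L[ℝ] ℝ).hasFDerivAt.comp z
    h1.hasFDerivAt
  rw [pderivCoord, e]
  simp only [Function.comp_def] at h2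
  rw [h2.fderiv]
  simp

lemma IsMetricNear.differentiableAt_christForm (h : IsMetricNear G x z) :
    DifferentiableAt ℝ (christForm G x) z :=
  h.contDiffAt_christForm.differentiableAt (by simp)

lemma IsMetricNear.differentiableAt_metricForm (h : IsMetricNear G x z) :
    DifferentiableAt ℝ (metricForm G x) z :=
  h.contDiffAt_metricForm.differentiableAt (by simp)

lemma christForm_stdVec_left (G : MetricField n M) (x : M) (z v : EuclideanSpace ℝ (Fin n))
    (i a : Fin n) : christForm G x z (stdVec i) v a = ∑ m, christoffel G x a i m z * v m := by
  conv_lhs => rw [eq_sum_stdVec v]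
  simp [christForm_stdVec_apply, mul_comm]

/-- The bridge from the index formula to the form `curvForm`, for which the transformation laws are
available. -/
lemma riemannCoord_eq (h : IsMetricNear G x (coordCenter x)) (a i j k : Fin n) :
    riemannCoord G x a i j k =
      curvForm (christForm G x) (coordCenter x) (stdVec i) (stdVec j) (stdVec k) a := by
  simp only [riemannCoord, curvForm, pderivCoord_christoffel h.differentiableAt_christForm,
    PiLp.add_apply, PiLp.sub_apply, christForm_stdVec_left, Finset.sum_sub_distrib, stdVec_apply,
    mul_ite, mul_one, mul_zero, Finset.sum_ite_eq', Finset.mem_univ, if_true]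
  ring

lemma hessForm_stdVec {φ : EuclideanSpace ℝ (Fin n) → ℝ} (hφ : ContDiffAt ℝ 2 φ z)
    (i j : Fin n) : hessForm (christForm G x) φ z (stdVec i) (stdVec j) =
      pderivCoord i (pderivCoord j φ) z - ∑ k, christoffel G x k i j z * pderivCoord k φ z := by
  rw [hessForm, pderivCoord_pderivCoord hφ]
  congr 1
  rw [christForm, coeffForm_stdVec]
  simp [pderivCoord]

lemma laplaceBeltrami_eq {f : M → ℝ} (hf : ContDiffAt ℝ 2 (funCoord (n := n) f x) (coordCenter x)) :
    laplaceBeltrami G f x = ∑ i, ∑ j, (metricCoord G x (coordCenter x))⁻¹ i j *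
      hessForm (christForm G x) (funCoord f x) (coordCenter x) (stdVec i) (stdVec j) := by
  simp only [laplaceBeltrami, hessForm_stdVec hf]

end Coordinates

/-! ### The given Riemannian metric in charts and under transition maps -/

section RiemannianCoordinates

variable {n : ℕ} {M : Type*} [TopologicalSpace M] [ChartedSpace (EuclideanSpace ℝ (Fin n)) M]

lemma coordCenter_mem_target (x : M) : coordCenter x ∈ (extChartAt (𝓡 n) x).target :=
  mem_extChartAt_target x

lemma eventually_mem_transition {x y : M} {z : EuclideanSpace ℝ (Fin n)}
    (hz : z ∈ (extChartAt (𝓡 n) y).target)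
    (hz' : (extChartAt (𝓡 n) y).symm z ∈ (extChartAt (𝓡 n) x).source) :
    ∀ᶠ w in 𝓝 z, w ∈ (extChartAt (𝓡 n) y).target ∧
      (extChartAt (𝓡 n) y).symm w ∈ (extChartAt (𝓡 n) x).source :=
  Filter.Eventually.and ((isOpen_extChartAt_target y).mem_nhds hz)
    ((continuousAt_extChartAt_symm'' hz).eventually
      ((isOpen_extChartAt_source x).mem_nhds hz'))

section

variable [IsManifold (𝓡 n) ∞ M]

lemma mdifferentiableAt_extChartAt_symm {x : M} {z : EuclideanSpace ℝ (Fin n)}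
    (hz : z ∈ (extChartAt (𝓡 n) x).target) :
    MDifferentiableAt (𝓡 n) (𝓡 n) (extChartAt (𝓡 n) x).symm z :=
  ((contMDiffOn_extChartAt_symm (n := ∞) x).contMDiffAt
    ((isOpen_extChartAt_target x).mem_nhds hz)).mdifferentiableAt (by simp)

lemma mdifferentiableAt_extChartAt_of_mem {x y : M} (hy : y ∈ (extChartAt (𝓡 n) x).source) :
    MDifferentiableAt (𝓡 n) (𝓡 n) (extChartAt (𝓡 n) x) y :=
  mdifferentiableAt_extChartAt (by simpa using hy)

lemma mfderiv_extChartAt_symm_injective {x : M} {z : EuclideanSpace ℝ (Fin n)}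
    (hz : z ∈ (extChartAt (𝓡 n) x).target) :
    Function.Injective (mfderiv (𝓡 n) (𝓡 n) (extChartAt (𝓡 n) x).symm z) := by
  have h1 := mfderiv_comp z
    (mdifferentiableAt_extChartAt_of_mem ((extChartAt (𝓡 n) x).map_target hz))
    (mdifferentiableAt_extChartAt_symm hz)
  have e : (extChartAt (𝓡 n) x) ∘ (extChartAt (𝓡 n) x).symm =ᶠ[𝓝 z] id := by
    filter_upwards [(isOpen_extChartAt_target x).mem_nhds hz] with y hy
    exact (extChartAt (𝓡 n) x).right_inv hy
  rw [e.mfderiv_eq, mfderiv_id] at h1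
  intro u v huv
  have h2 := congrArg (fun L ↦ L u) h1
  have h3 := congrArg (fun L ↦ L v) h1
  simp only [ContinuousLinearMap.comp_apply] at h2 h3
  have h4 : mfderiv (𝓡 n) (𝓡 n) (extChartAt (𝓡 n) x) ((extChartAt (𝓡 n) x).symm z)
      (mfderiv (𝓡 n) (𝓡 n) (extChartAt (𝓡 n) x).symm z u) =
    mfderiv (𝓡 n) (𝓡 n) (extChartAt (𝓡 n) x) ((extChartAt (𝓡 n) x).symm z)
      (mfderiv (𝓡 n) (𝓡 n) (extChartAt (𝓡 n) x).symm z v) := by rw [huv]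
  exact (h2.trans h4).trans h3.symm

/-- The transition map from the preferred chart around `y` to the one around `x`. -/
noncomputable def transitionMap (n : ℕ) {M : Type*} [TopologicalSpace M]
    [ChartedSpace (EuclideanSpace ℝ (Fin n)) M] (x y : M) :
    EuclideanSpace ℝ (Fin n) → EuclideanSpace ℝ (Fin n) :=
  extChartAt (𝓡 n) x ∘ (extChartAt (𝓡 n) y).symm

lemma contDiffAt_transitionMap {x y : M} {z : EuclideanSpace ℝ (Fin n)}
    (hz : z ∈ (extChartAt (𝓡 n) y).target)
    (hz' : (extChartAt (𝓡 n) y).symm z ∈ (extChartAt (𝓡 n) x).source) :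
    ContDiffAt ℝ ∞ (transitionMap n x y) z := by
  have := contDiffWithinAt_ext_coord_change (I := 𝓡 n) (n := ∞) x y (y := z)
    (by simp only [PartialEquiv.trans_source, PartialEquiv.symm_source]; exact ⟨hz, hz'⟩)
  simpa [contDiffWithinAt_univ, transitionMap] using this

lemma mfderiv_extChartAt_symm_transitionMap {x y : M} {z : EuclideanSpace ℝ (Fin n)}
    (hz : z ∈ (extChartAt (𝓡 n) y).target)
    (hz' : (extChartAt (𝓡 n) y).symm z ∈ (extChartAt (𝓡 n) x).source)
    (u : EuclideanSpace ℝ (Fin n)) :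
    (mfderiv (𝓡 n) (𝓡 n) (extChartAt (𝓡 n) x).symm (transitionMap n x y z)
        (fderiv ℝ (transitionMap n x y) z u) : EuclideanSpace ℝ (Fin n)) =
      mfderiv (𝓡 n) (𝓡 n) (extChartAt (𝓡 n) y).symm z u := by
  have h1 := mfderiv_comp z (g := (extChartAt (𝓡 n) x).symm) (f := transitionMap n x y)
    (I := 𝓡 n) (I' := 𝓡 n) (I'' := 𝓡 n)
    (mdifferentiableAt_extChartAt_symm ((extChartAt (𝓡 n) x).map_source hz'))
    (((contDiffAt_transitionMap hz hz').differentiableAt (by simp)).mdifferentiableAt)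
  have e : (extChartAt (𝓡 n) x).symm ∘ transitionMap n x y =ᶠ[𝓝 z] (extChartAt (𝓡 n) y).symm := by
    filter_upwards [eventually_mem_transition hz hz'] with w hw
    exact (extChartAt (𝓡 n) x).left_inv hw.2
  rw [← mfderiv_eq_fderiv, ← e.mfderiv_eq, h1]
  rfl

lemma surjective_fderiv_transitionMap {x y : M} {z : EuclideanSpace ℝ (Fin n)}
    (hz : z ∈ (extChartAt (𝓡 n) y).target)
    (hz' : (extChartAt (𝓡 n) y).symm z ∈ (extChartAt (𝓡 n) x).source) :
    Function.Surjective (fderiv ℝ (transitionMap n x y) z) := by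
  have hinj : Function.Injective (fderiv ℝ (transitionMap n x y) z) := by
    intro u v huv
    apply mfderiv_extChartAt_symm_injective hz
    rw [← mfderiv_extChartAt_symm_transitionMap hz hz', huv,
      mfderiv_extChartAt_symm_transitionMap hz hz']
  exact (LinearMap.injective_iff_surjective
    (f := (fderiv ℝ (transitionMap n x y) z).toLinearMap)).1 hinj

end

variable [RiemannianBundle (fun x : M ↦ TangentSpace (𝓡 n) x)]

lemma riemannianField_symm (x : M) (u v : TangentSpace (𝓡 n) x) :
    riemannianField n M x u v = riemannianField n M x v u :=
  real_inner_comm (F := TangentSpace (𝓡 n) x) v u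

lemma metricForm_riemannianField (x : M) (z u v : EuclideanSpace ℝ (Fin n)) :
    metricForm (riemannianField n M) x z u v = inner ℝ
      (mfderiv (𝓡 n) (𝓡 n) (extChartAt (𝓡 n) x).symm z u)
      (mfderiv (𝓡 n) (𝓡 n) (extChartAt (𝓡 n) x).symm z v) := by
  refine eq_of_eq_on_stdVec
    (f₁ := fun u ↦ metricForm (riemannianField n M) x z u v)
    (f₂ := fun u : EuclideanSpace ℝ (Fin n) ↦ inner ℝ
      (mfderiv (𝓡 n) (𝓡 n) (extChartAt (𝓡 n) x).symm z u)
      (mfderiv (𝓡 n) (𝓡 n) (extChartAt (𝓡 n) x).symm z v))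
    ⟨by simp, by simp⟩ ⟨fun a b ↦ ?_, fun c a ↦ ?_⟩ (fun i ↦ ?_) u
  · exact (congrArg (fun t ↦ inner ℝ t _) (map_add _ a b)).trans (inner_add_left _ _ _)
  · exact (congrArg (fun t ↦ inner ℝ t _) (map_smul _ c a)).trans (real_inner_smul_left _ _ _)
  refine eq_of_eq_on_stdVec
    (f₁ := fun v ↦ metricForm (riemannianField n M) x z (stdVec i) v)
    (f₂ := fun v : EuclideanSpace ℝ (Fin n) ↦ inner ℝ
      (mfderiv (𝓡 n) (𝓡 n) (extChartAt (𝓡 n) x).symm z (stdVec i))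
      (mfderiv (𝓡 n) (𝓡 n) (extChartAt (𝓡 n) x).symm z v))
    ⟨by simp, by simp⟩ ⟨fun a b ↦ ?_, fun c a ↦ ?_⟩ (fun j ↦ ?_) v
  · exact (congrArg (fun t ↦ inner ℝ _ t) (map_add _ a b)).trans (inner_add_right _ _ _)
  · exact (congrArg (fun t ↦ inner ℝ _ t) (map_smul _ c a)).trans (real_inner_smul_right _ _ _)
  rw [metricForm_stdVec]
  rfl

variable [IsManifold (𝓡 n) ∞ M]

lemma metricForm_transition {x y : M} {z : EuclideanSpace ℝ (Fin n)}
    (hz : z ∈ (extChartAt (𝓡 n) y).target)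
    (hz' : (extChartAt (𝓡 n) y).symm z ∈ (extChartAt (𝓡 n) x).source)
    (u v : EuclideanSpace ℝ (Fin n)) :
    metricForm (riemannianField n M) y z u v =
      metricForm (riemannianField n M) x (transitionMap n x y z)
        (fderiv ℝ (transitionMap n x y) z u) (fderiv ℝ (transitionMap n x y) z v) := by
  rw [metricForm_riemannianField, metricForm_riemannianField]
  have e : (extChartAt (𝓡 n) x).symm (transitionMap n x y z) = (extChartAt (𝓡 n) y).symm z :=
    (extChartAt (𝓡 n) x).left_inv hz'
  have hu := mfderiv_extChartAt_symm_transitionMap hz hz' u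
  have hv := mfderiv_extChartAt_symm_transitionMap hz hz' v
  -- The two base points are equal only propositionally, and rewriting one would change the types of
  -- the vectors. They are therefore compared in the common model space.
  have key : ∀ (p q : M) (a b a' b' : EuclideanSpace ℝ (Fin n)), p = q → a = a' → b = b' →
      riemannianField n M p a b = riemannianField n M q a' b' := by
    rintro p q a b a' b' rfl rfl rfl; rfl
  exact (key _ _ _ _ _ _ e hu hv).symm

variable [IsContMDiffRiemannianBundle (𝓡 n) ∞ (EuclideanSpace ℝ (Fin n))
  (fun x : M ↦ TangentSpace (𝓡 n) x)]

/-- The coordinate vector fields are smooth sections, being the tangent map of the inverse chart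
applied to constant fields. The inner product of two smooth sections is smooth. -/
lemma contDiffAt_metricCoord_riemannianField {x : M} {z : EuclideanSpace ℝ (Fin n)}
    (hz : z ∈ (extChartAt (𝓡 n) x).target) (i j : Fin n) :
    ContDiffAt ℝ ∞ (fun y ↦ metricCoord (riemannianField n M) x y i j) z := by
  have hU := (isOpen_extChartAt_target (I := 𝓡 n) x)
  have key : ∀ k : Fin n, ContMDiffAt (𝓡 n) ((𝓡 n).prod 𝓘(ℝ, EuclideanSpace ℝ (Fin n))) ∞
      (fun y ↦ (⟨(extChartAt (𝓡 n) x).symm y,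
        mfderiv (𝓡 n) (𝓡 n) (extChartAt (𝓡 n) x).symm y (stdVec k)⟩ : TangentBundle (𝓡 n) M))
      z := by
    intro k
    have h1 := (contMDiffOn_extChartAt_symm (I := 𝓡 n) (n := ∞) x).contMDiffOn_tangentMapWithin
      (m := ∞) (by simp) hU.uniqueMDiffOn
    have h2 : ContMDiffAt (𝓡 n) (𝓡 n).tangent ∞
        (fun y : EuclideanSpace ℝ (Fin n) ↦
          (⟨y, stdVec k⟩ : TangentBundle (𝓡 n) (EuclideanSpace ℝ (Fin n)))) z :=
      contMDiffAt_vectorSpace_iff_contDiffAt.2 contDiffAt_const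
    have h3 := (h1.contMDiffAt (x := ⟨z, stdVec k⟩)
      ((hU.preimage (FiberBundle.continuous_proj _ _)).mem_nhds hz)).comp z h2
    refine h3.congr_of_eventuallyEq ?_
    filter_upwards [hU.mem_nhds hz] with y hy
    simp only [Function.comp_def, tangentMapWithin]
    rw [mfderivWithin_of_isOpen hU hy]
  have := (key i).inner_bundle (key j)
  exact contMDiffAt_iff_contDiffAt.1 this

lemma isMetricNear_riemannianField {x : M} {z : EuclideanSpace ℝ (Fin n)}
    (hz : z ∈ (extChartAt (𝓡 n) x).target) : IsMetricNear (riemannianField n M) x z where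
  smooth := contDiffAt_metricCoord_riemannianField hz
  symm := Filter.Eventually.of_forall fun y i j ↦ riemannianField_symm _ _ _
  posDef := by
    refine Matrix.PosDef.of_dotProduct_mulVec_pos ?_ fun u hu ↦ ?_
    · ext i j
      exact riemannianField_symm _ _ _
    · have := metricForm_apply (riemannianField n M) x z (WithLp.toLp 2 u) (WithLp.toLp 2 u)
      simp only [star_trivial]
      rw [← this, metricForm_riemannianField]
      refine real_inner_self_pos.2 fun h0 ↦ hu ?_
      have := mfderiv_extChartAt_symm_injective hz (h0.trans (map_zero _).symm)
      exact (WithLp.toLp_eq_zero 2).1 this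

end RiemannianCoordinates

/-! ### Curvature and scalar curvature of φ⁻² G -/

section Conformal

variable {n : ℕ} {M : Type*} [TopologicalSpace M] [ChartedSpace (EuclideanSpace ℝ (Fin n)) M]

/-- The tensor field `φ⁻² G`. -/
noncomputable def conformalField (G : MetricField n M) (φ : M → ℝ) : MetricField n M :=
  fun x v w ↦ (φ x ^ 2)⁻¹ * G x v w

variable {G : MetricField n M} {φ : M → ℝ} {x : M} {z : EuclideanSpace ℝ (Fin n)}

lemma metricCoord_conformalField (G : MetricField n M) (φ : M → ℝ) (x : M)
    (z : EuclideanSpace ℝ (Fin n)) :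
    metricCoord (conformalField G φ) x z = (funCoord φ x z ^ 2)⁻¹ • metricCoord G x z := rfl

lemma metricForm_conformalField (G : MetricField n M) (φ : M → ℝ) (x : M)
    (z u v : EuclideanSpace ℝ (Fin n)) :
    metricForm (conformalField G φ) x z u v = (funCoord φ x z ^ 2)⁻¹ * metricForm G x z u v := by
  simp only [metricForm, coeffForm_apply, metricCoord_conformalField, Matrix.smul_apply,
    smul_eq_mul, Finset.mul_sum]
  refine Finset.sum_congr rfl fun i _ ↦ Finset.sum_congr rfl fun j _ ↦ ?_
  ring

lemma IsMetricNear.conformal (h : IsMetricNear G x z)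
    (hφ : ContDiffAt ℝ ∞ (funCoord φ x) z) (hφz : funCoord φ x z ≠ 0) :
    IsMetricNear (conformalField G φ) x z where
  smooth i j := by
    simp only [metricCoord_conformalField, Matrix.smul_apply, smul_eq_mul]
    exact ((hφ.pow 2).inv (pow_ne_zero 2 hφz)).mul (h.smooth i j)
  symm := h.symm.mono fun y hy i j ↦ by
    simp only [metricCoord_conformalField, Matrix.smul_apply, hy i j]
  posDef := by
    rw [metricCoord_conformalField]
    exact h.posDef.smul (by positivity)

lemma curvForm_conformalField (h : ∀ᶠ y in 𝓝 z, IsMetricNear G x y)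
    (hφ : ContDiffAt ℝ ∞ (funCoord φ x) z) (hφz : funCoord φ x z ≠ 0)
    (u v w : EuclideanSpace ℝ (Fin n)) :
    funCoord φ x z ^ 2 • curvForm (christForm (conformalField G φ) x) z u v w =
      funCoord φ x z ^ 2 • curvForm (christForm G x) z u v w
      + funCoord φ x z • (hessForm (christForm G x) (funCoord φ x) z v w • u
        - hessForm (christForm G x) (funCoord φ x) z u w • v
        + metricForm G x z v w • (fderiv ℝ (gradVec G x (funCoord φ x)) z u
          + christForm G x z u (gradVec G x (funCoord φ x) z))
        - metricForm G x z u w • (fderiv ℝ (gradVec G x (funCoord φ x)) z v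
          + christForm G x z v (gradVec G x (funCoord φ x) z)))
      + metricForm G x z (gradVec G x (funCoord φ x) z) (gradVec G x (funCoord φ x) z) •
        (metricForm G x z u w • v - metricForm G x z v w • u) := by
  have hz := h.self_of_nhds
  have hφe : ∀ᶠ y in 𝓝 z, DifferentiableAt ℝ (funCoord φ x) y :=
    ((hφ.of_le (m := 1) (by norm_cast)).eventually
      (by simp)).mono fun y hy ↦ hy.differentiableAt (by norm_num)
  have hφne := hφ.continuousAt.eventually_ne hφz
  have hc := hz.conformal hφ hφz
  have hcd : ∀ᶠ y in 𝓝 z, DifferentiableAt ℝ (metricForm (conformalField G φ) x) y :=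
    ((hc.contDiffAt_metricForm.of_le (m := 1) (by norm_cast)).eventually
      (by simp)).mono fun y hy ↦ hy.differentiableAt (by norm_num)
  refine conformal_curvForm hz.differentiableAt_metricForm hz.eventually_symm hz.nondegenerate
    hz.differentiableAt_christForm hc.differentiableAt_christForm (hφ.of_le (by norm_cast))
    ((hz.contDiffAt_gradVec hφ).differentiableAt (by simp))
    (metricForm_gradVec hz.det_ne_zero hz.symm.self_of_nhds _)
    hz.eventually_isLeviCivitaAt.self_of_nhds ?_ u v w
  filter_upwards [h, hφe, hφne.eventually_nhds, hcd, hz.eventually_isLeviCivitaAt,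
    hc.eventually_isLeviCivitaAt] with y h1 h2 h3 h4 h5 h6 a b
  refine conformal_christoffel h1.differentiableAt_metricForm h4 h1.nondegenerate h2 ?_
    (metricForm_gradVec h1.det_ne_zero h1.symm.self_of_nhds _) h5 h6 a b
  filter_upwards [h3] with y' hy' a b
  rw [metricForm_conformalField, mul_inv_cancel_left₀ (pow_ne_zero 2 hy')]

lemma metricForm_covariant_gradVec (h : ∀ᶠ y in 𝓝 z, IsMetricNear G x y)
    (hφ : ContDiffAt ℝ ∞ (funCoord φ x) z) (u w : EuclideanSpace ℝ (Fin n)) :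
    metricForm G x z (fderiv ℝ (gradVec G x (funCoord φ x)) z u
      + christForm G x z u (gradVec G x (funCoord φ x) z)) w =
      hessForm (christForm G x) (funCoord φ x) z u w := by
  have hz := h.self_of_nhds
  refine hess_eq_covariant_gradient hz.differentiableAt_metricForm hz.eventually_symm
    ((hφ.fderiv_right (m := ∞) (by simp)).differentiableAt (by simp))
    ((hz.contDiffAt_gradVec hφ).differentiableAt (by simp)) ?_
    hz.eventually_isLeviCivitaAt.self_of_nhds u w
  filter_upwards [h] with y hy
  exact metricForm_gradVec hy.det_ne_zero hy.symm.self_of_nhds _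

lemma sum_inv_mul_pderivCoord_eq (h : IsMetricNear G x (coordCenter x)) (f : M → ℝ) :
    ∑ i, ∑ j, (metricCoord G x (coordCenter x))⁻¹ i j
      * pderivCoord i (funCoord f x) (coordCenter x)
      * pderivCoord j (funCoord f x) (coordCenter x) = metricForm G x (coordCenter x)
      (gradVec G x (funCoord f x) (coordCenter x))
      (gradVec G x (funCoord f x) (coordCenter x)) := by
  rw [metricForm_gradVec h.det_ne_zero h.symm.self_of_nhds]
  simp only [gradVec, map_sum, map_smul, smul_eq_mul, Finset.sum_mul]
  refine Finset.sum_congr rfl fun i _ ↦ Finset.sum_congr rfl fun j _ ↦ ?_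
  simp only [pderivCoord]
  ring

lemma gradNorm_sq_eq (h : IsMetricNear G x (coordCenter x)) (f : M → ℝ) :
    gradNorm G f x ^ 2 = metricForm G x (coordCenter x)
      (gradVec G x (funCoord f x) (coordCenter x)) (gradVec G x (funCoord f x) (coordCenter x)) := by
  have e := sum_inv_mul_pderivCoord_eq h f
  rw [gradNorm, e, Real.sq_sqrt (h.metricForm_nonneg _)]

/-- Recovers a component of a vector from its pairings with the coordinate vectors. This is how the
trace of the covariant derivative of the gradient becomes a Laplacian. -/
lemma apply_eq_sum_inv_mul_metricForm (h : IsMetricNear G x z) (y : EuclideanSpace ℝ (Fin n))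
    (i : Fin n) : y i = ∑ k, (metricCoord G x z)⁻¹ i k * metricForm G x z y (stdVec k) := by
  have e : y = ∑ i, (∑ k, (metricCoord G x z)⁻¹ i k * metricForm G x z y (stdVec k)) • stdVec i := by
    refine h.nondegenerate.eq_of_forall fun w ↦ ?_
    refine eq_of_eq_on_stdVec (f₁ := fun w ↦ metricForm G x z y w) (f₂ := fun w ↦ metricForm G x z
      (∑ i, (∑ k, (metricCoord G x z)⁻¹ i k * metricForm G x z y (stdVec k)) • stdVec i) w)
      ⟨map_add _, map_smul _⟩ ⟨map_add _, map_smul _⟩ (fun l ↦ ?_) w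
    exact (sum_inv_mul_metricForm h.det_ne_zero h.symm.self_of_nhds
      (fun k ↦ metricForm G x z y (stdVec k)) l).symm
  conv_lhs => rw [e]
  simp [stdVec_apply]

lemma metricForm_stdVec_right (G : MetricField n M) (x : M) (z y : EuclideanSpace ℝ (Fin n))
    (k : Fin n) : metricForm G x z y (stdVec k) = ∑ i, metricCoord G x z i k * y i := by
  conv_lhs => rw [eq_sum_stdVec y]
  simp [metricForm_stdVec, mul_comm]

/-- The conformal curvature formula is traced twice. After multiplication by φ² the inverse metric
of φ⁻² G supplies exactly the factor needed, so no division by φ remains. -/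
lemma scalarCurv_conformalField
    (h : ∀ᶠ y in 𝓝 (coordCenter x), IsMetricNear G x y)
    (hφ : ContDiffAt ℝ ∞ (funCoord (n := n) φ x) (coordCenter x)) (hφx : φ x ≠ 0) :
    scalarCurv (conformalField G φ) x = φ x ^ 2 * scalarCurv G x
      + 2 * (n - 1) * φ x * laplaceBeltrami G φ x - n * (n - 1) * gradNorm G φ x ^ 2 := by
  have hz := h.self_of_nhds
  have hv : funCoord (n := n) φ x (coordCenter x) = φ x := by
    rw [funCoord, coordCenter, extChartAt_to_inv]
  have hφz : funCoord (n := n) φ x (coordCenter x) ≠ 0 := by rwa [hv]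
  have hc := hz.conformal hφ hφz
  have key := fun i j k ↦ congrArg (fun y : EuclideanSpace ℝ (Fin n) ↦ y i)
    (curvForm_conformalField h hφ hφz (stdVec i) (stdVec j) (stdVec k))
  have hY := metricForm_covariant_gradVec h hφ
  rw [laplaceBeltrami_eq (hφ.of_le (by norm_cast)), gradNorm_sq_eq hz]
  set z : EuclideanSpace ℝ (Fin n) := coordCenter x
  set N := metricForm G x z (gradVec G x (funCoord φ x) z) (gradVec G x (funCoord φ x) z)
  set H := hessForm (christForm G x) (funCoord φ x) z
  set Y : EuclideanSpace ℝ (Fin n) → EuclideanSpace ℝ (Fin n) := fun u ↦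
    fderiv ℝ (gradVec G x (funCoord φ x)) z u
      + christForm G x z u (gradVec G x (funCoord φ x) z) with hYdef
  set A := (metricCoord G x z)⁻¹ with hA
  have hAinv : (metricCoord (conformalField G φ) x z)⁻¹ = φ x ^ 2 • A := by
    rw [metricCoord_conformalField, hv, hA]
    have : Invertible ((φ x ^ 2)⁻¹) := invertibleOfNonzero (by positivity)
    rw [Matrix.inv_smul _ _ (isUnit_iff_ne_zero.2 hz.det_ne_zero)]
    simp
  have tr : ∑ j, ∑ k, A j k * metricCoord G x z j k = n := by
    have : ∀ j, ∑ k, A j k * metricCoord G x z j k = 1 := fun j ↦ by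
      have h1 : (A * metricCoord G x z) j j = 1 := by
        rw [hA, Matrix.nonsing_inv_mul _ (isUnit_iff_ne_zero.2 hz.det_ne_zero), Matrix.one_apply_eq]
      rw [Matrix.mul_apply] at h1
      rw [← h1]
      exact Finset.sum_congr rfl fun k _ ↦ by rw [hz.symm.self_of_nhds j k]
    simp [this]
  have trY : ∑ i, Y (stdVec i) i = ∑ i, ∑ k, A i k * H (stdVec i) (stdVec k) := by
    refine Finset.sum_congr rfl fun i _ ↦ ?_
    rw [apply_eq_sum_inv_mul_metricForm hz (Y (stdVec i)) i]
    exact Finset.sum_congr rfl fun k _ ↦ by rw [hY]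
  -- Contracting the upper index with the first lower one: the Hessian occurs n times, minus one
  -- from the second term and one from the lowered gradient term, hence n - 2. The gradient term
  -- occurs n - 1 times.
  have ric : ∀ j k, φ x ^ 2 * ricciCoord (conformalField G φ) x j k =
      φ x ^ 2 * ricciCoord G x j k + φ x * ((n - 2) * H (stdVec j) (stdVec k)
        + metricCoord G x z j k * ∑ i, Y (stdVec i) i) - N * ((n - 1) * metricCoord G x z j k) := by
    intro j k
    simp only [ricciCoord, Matrix.of_apply, riemannCoord_eq hc, riemannCoord_eq hz]
    have h1 : ∀ i, φ x ^ 2 * curvForm (christForm (conformalField G φ) x) z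
        (stdVec i) (stdVec j) (stdVec k) i =
        φ x ^ 2 * curvForm (christForm G x) z (stdVec i) (stdVec j) (stdVec k) i
        + φ x * (H (stdVec j) (stdVec k) - H (stdVec i) (stdVec k) * stdVec j i
          + metricCoord G x z j k * Y (stdVec i) i - metricCoord G x z i k * Y (stdVec j) i)
        + N * (metricCoord G x z i k * stdVec j i - metricCoord G x z j k) := by
      intro i
      have := key i j k
      rw [hv] at this
      simp only [PiLp.add_apply, PiLp.sub_apply, PiLp.smul_apply, smul_eq_mul,
        metricForm_stdVec] at this
      have e : ∀ i : Fin n, (stdVec i : EuclideanSpace ℝ (Fin n)) i = 1 := fun i ↦ by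
        simp [stdVec_apply]
      rw [e] at this
      simp only [hYdef, PiLp.add_apply]
      linarith
    have h2 : ∑ i, metricCoord G x z i k * Y (stdVec j) i = H (stdVec j) (stdVec k) := by
      rw [← hY, metricForm_stdVec_right]
    rw [Finset.mul_sum, Finset.sum_congr rfl fun i _ ↦ h1 i]
    simp only [Finset.sum_add_distrib, Finset.sum_sub_distrib, ← Finset.mul_sum, h2, stdVec_apply]
    simp
    ring
  have hsum : scalarCurv (conformalField G φ) x =
      ∑ j, ∑ k, A j k * (φ x ^ 2 * ricciCoord (conformalField G φ) x j k) := by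
    simp only [scalarCurv]
    refine Finset.sum_congr rfl fun j _ ↦ Finset.sum_congr rfl fun k _ ↦ ?_
    change (metricCoord (conformalField G φ) x z)⁻¹ j k * _ = _
    rw [hAinv, Matrix.smul_apply, smul_eq_mul]
    ring
  rw [hsum]
  have e : ∀ j k, A j k * (φ x ^ 2 * ricciCoord (conformalField G φ) x j k) =
      φ x ^ 2 * (A j k * ricciCoord G x j k)
      + φ x * (n - 2) * (A j k * H (stdVec j) (stdVec k))
      + (φ x * (∑ i, Y (stdVec i) i) - N * (n - 1)) * (A j k * metricCoord G x z j k) := by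
    intro j k
    rw [ric]
    ring
  simp only [e, Finset.sum_add_distrib, ← Finset.mul_sum, tr, trY]
  simp only [scalarCurv]
  ring

end Conformal

/-! ### The norm of the curvature tensor through orthonormal frames, and norm comparison -/

section CurvatureBounds

variable {n : ℕ}

lemma IsLinearMap.eq_sum_stdVec {V : Type*} [AddCommGroup V] [Module ℝ V]
    {f : EuclideanSpace ℝ (Fin n) → V} (hf : IsLinearMap ℝ f) (u : EuclideanSpace ℝ (Fin n)) :
    f u = ∑ i, u i • f (stdVec i) := by
  have e : ∀ v, f v = hf.mk' f v := fun _ ↦ rfl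
  rw [e, _root_.eq_sum_stdVec u]
  simp [stdVec_apply]

lemma curvForm_apply_eq_sum
    (Γ : EuclideanSpace ℝ (Fin n) →
      EuclideanSpace ℝ (Fin n) →L[ℝ] EuclideanSpace ℝ (Fin n) →L[ℝ] EuclideanSpace ℝ (Fin n))
    (z u v w : EuclideanSpace ℝ (Fin n)) (a : Fin n) :
    curvForm Γ z u v w a = ∑ i, ∑ j, ∑ k,
      u i * v j * w k * curvForm Γ z (stdVec i) (stdVec j) (stdVec k) a := by
  rw [(isLinearMap_curvForm_left Γ z v w).eq_sum_stdVec u]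
  simp only [WithLp.ofLp_sum, WithLp.ofLp_smul, Finset.sum_apply, Pi.smul_apply, smul_eq_mul]
  refine Finset.sum_congr rfl fun i _ ↦ ?_
  rw [(isLinearMap_curvForm_mid Γ z (stdVec i) w).eq_sum_stdVec v]
  simp only [WithLp.ofLp_sum, WithLp.ofLp_smul, Finset.sum_apply, Pi.smul_apply, smul_eq_mul,
    Finset.mul_sum]
  refine Finset.sum_congr rfl fun j _ ↦ ?_
  rw [(isLinearMap_curvForm_right Γ z (stdVec i) (stdVec j)).eq_sum_stdVec w]
  simp only [WithLp.ofLp_sum, WithLp.ofLp_smul, Finset.sum_apply, Pi.smul_apply, smul_eq_mul,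
    Finset.mul_sum]
  refine Finset.sum_congr rfl fun k _ ↦ ?_
  ring

/-- The three lower indices are bundled into one index I. Writing the product of inverse metrics as
a sum over frame triples P turns the full contraction into a sum of squared lengths. -/
lemma sum_contraction_eq {ι κ : Type*} [Fintype ι] [Fintype κ] (g : ι → ι → ℝ)
    (β : κ → κ → ℝ) (R : ι → κ → ℝ) :
    ∑ a, ∑ I, ∑ a', ∑ I', g a a' * (∑ P, β P I * β P I') * R a I * R a' I' =
      ∑ P, ∑ a, ∑ a', g a a' * (∑ I, β P I * R a I) * (∑ I', β P I' * R a' I') := by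
  rw [Finset.sum_comm (s := (Finset.univ : Finset κ)) (t := (Finset.univ : Finset ι))
    (f := fun P a ↦ ∑ a', g a a' * (∑ I, β P I * R a I) * (∑ I', β P I' * R a' I'))]
  refine Finset.sum_congr rfl fun a _ ↦ ?_
  rw [Finset.sum_comm, Finset.sum_comm (s := (Finset.univ : Finset κ))
    (t := (Finset.univ : Finset ι))
    (f := fun P a' ↦ g a a' * (∑ I, β P I * R a I) * (∑ I', β P I' * R a' I'))]
  refine Finset.sum_congr rfl fun a' _ ↦ ?_
  have e1 : ∀ P, g a a' * (∑ I, β P I * R a I) * (∑ I', β P I' * R a' I') =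
      ∑ I, ∑ I', g a a' * (β P I * β P I') * R a I * R a' I' := by
    intro P
    rw [mul_assoc, Finset.sum_mul_sum, Finset.mul_sum]
    refine Finset.sum_congr rfl fun I _ ↦ ?_
    rw [Finset.mul_sum]
    refine Finset.sum_congr rfl fun I' _ ↦ ?_
    ring
  rw [Finset.sum_congr rfl fun P _ ↦ e1 P]
  conv_rhs => rw [Finset.sum_comm]
  refine Finset.sum_congr rfl fun I _ ↦ ?_
  conv_rhs => rw [Finset.sum_comm]
  refine Finset.sum_congr rfl fun I' _ ↦ ?_
  rw [Finset.mul_sum, Finset.sum_mul, Finset.sum_mul]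

variable {M : Type*} [TopologicalSpace M] [ChartedSpace (EuclideanSpace ℝ (Fin n)) M]
  {G : MetricField n M} {x : M} {z : EuclideanSpace ℝ (Fin n)}

lemma metricForm_eq_sum (G : MetricField n M) (x : M) (z u v : EuclideanSpace ℝ (Fin n)) :
    metricForm G x z u v = ∑ a, ∑ a', metricCoord G x z a a' * u a * v a' := by
  simp only [metricForm, coeffForm_apply, smul_eq_mul]
  refine Finset.sum_congr rfl fun i _ ↦ Finset.sum_congr rfl fun j _ ↦ ?_
  ring

lemma riemannNormSq_eq_sum (h : IsMetricNear G x (coordCenter x))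
    {B : Matrix (Fin n) (Fin n) ℝ} (hB : (metricCoord G x (coordCenter x))⁻¹ = B.transpose * B) :
    riemannNormSq G x = ∑ P : Fin n × Fin n × Fin n, metricForm G x (coordCenter x)
      (curvForm (christForm G x) (coordCenter x) (WithLp.toLp 2 (B P.1)) (WithLp.toLp 2 (B P.2.1))
        (WithLp.toLp 2 (B P.2.2)))
      (curvForm (christForm G x) (coordCenter x) (WithLp.toLp 2 (B P.1)) (WithLp.toLp 2 (B P.2.1))
        (WithLp.toLp 2 (B P.2.2))) := by
  have hA : ∀ i j, (metricCoord G x (coordCenter x))⁻¹ i j = ∑ p, B p i * B p j := fun i j ↦ by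
    rw [hB, Matrix.mul_apply]; rfl
  have h1 := sum_contraction_eq (fun a a' ↦ metricCoord G x (coordCenter x) a a')
    (fun (P I : Fin n × Fin n × Fin n) ↦ B P.1 I.1 * B P.2.1 I.2.1 * B P.2.2 I.2.2)
    (fun a I ↦ riemannCoord G x a I.1 I.2.1 I.2.2)
  have h2 : riemannNormSq G x = ∑ a, ∑ I : Fin n × Fin n × Fin n, ∑ a',
      ∑ I' : Fin n × Fin n × Fin n, metricCoord G x (coordCenter x) a a' *
      (∑ P : Fin n × Fin n × Fin n, B P.1 I.1 * B P.2.1 I.2.1 * B P.2.2 I.2.2 *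
        (B P.1 I'.1 * B P.2.1 I'.2.1 * B P.2.2 I'.2.2)) *
      riemannCoord G x a I.1 I.2.1 I.2.2 * riemannCoord G x a' I'.1 I'.2.1 I'.2.2 := by
    have e : ∀ i i' j j' k k', (∑ P : Fin n × Fin n × Fin n,
        B P.1 i * B P.2.1 j * B P.2.2 k * (B P.1 i' * B P.2.1 j' * B P.2.2 k')) =
        (metricCoord G x (coordCenter x))⁻¹ i i' * (metricCoord G x (coordCenter x))⁻¹ j j' *
          (metricCoord G x (coordCenter x))⁻¹ k k' := by
      intro i i' j j' k k'
      rw [hA, hA, hA, Finset.sum_mul_sum, Finset.sum_mul]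
      simp only [Fintype.sum_prod_type]
      refine Finset.sum_congr rfl fun p _ ↦ ?_
      rw [Finset.sum_mul_sum]
      refine Finset.sum_congr rfl fun q _ ↦ Finset.sum_congr rfl fun s _ ↦ ?_
      ring
    simp only [e]
    simp only [riemannNormSq, Fintype.sum_prod_type, mul_assoc]
  rw [h2, h1]
  refine Finset.sum_congr rfl fun P _ ↦ ?_
  rw [metricForm_eq_sum]
  refine Finset.sum_congr rfl fun a _ ↦ Finset.sum_congr rfl fun a' _ ↦ ?_
  simp only [curvForm_apply_eq_sum _ _ (WithLp.toLp 2 (B P.1)), riemannCoord_eq h,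
    Fintype.sum_prod_type]

-- A factorization g⁻¹ = BᵀB makes the rows of B an orthonormal frame, because B g Bᵀ = 1. Each of
-- the n³ triples of frame vectors then contributes at most K.
open scoped MatrixOrder Matrix.Norms.L2Operator in
lemma riemannNormSq_le (h : IsMetricNear G x (coordCenter x)) {K : ℝ}
    (hK : ∀ u v w, metricForm G x (coordCenter x)
        (curvForm (christForm G x) (coordCenter x) u v w)
        (curvForm (christForm G x) (coordCenter x) u v w) ≤
      K * metricForm G x (coordCenter x) u u * metricForm G x (coordCenter x) v v
        * metricForm G x (coordCenter x) w w) :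
    riemannNormSq G x ≤ n ^ 3 * K := by
  obtain ⟨B, hB⟩ :=
    CStarAlgebra.nonneg_iff_eq_star_mul_self.mp h.posDef.inv.posSemidef.nonneg
  rw [Matrix.star_eq_conjTranspose, Matrix.conjTranspose_eq_transpose_of_trivial] at hB
  rw [riemannNormSq_eq_sum h hB]
  have h1 : B * (metricCoord G x (coordCenter x) * B.transpose) = 1 := by
    rw [mul_eq_one_comm, Matrix.mul_assoc, ← hB,
      Matrix.mul_nonsing_inv _ (isUnit_iff_ne_zero.2 h.det_ne_zero)]
  have hone : ∀ p, metricForm G x (coordCenter x) (WithLp.toLp 2 (B p)) (WithLp.toLp 2 (B p)) =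
      1 := by
    intro p
    have h2 : (B * (metricCoord G x (coordCenter x) * B.transpose)) p p = 1 := by
      rw [h1, Matrix.one_apply_eq]
    rw [metricForm_apply, ← h2, Matrix.mul_apply]
    simp only [dotProduct, Matrix.mulVec, Matrix.mul_apply, Matrix.transpose_apply]
  refine (Finset.sum_le_card_nsmul _ _ K fun P _ ↦ ?_).trans_eq ?_
  · refine (hK _ _ _).trans_eq ?_
    simp [hone]
  · rw [nsmul_eq_mul, Finset.card_univ]
    simp only [Fintype.card_prod, Fintype.card_fin]
    push_cast
    ring

/-- The norm of a vector for a bilinear form. -/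
noncomputable def formNorm (b : EuclideanSpace ℝ (Fin n) →L[ℝ] EuclideanSpace ℝ (Fin n) →L[ℝ] ℝ)
    (u : EuclideanSpace ℝ (Fin n)) : ℝ := √(b u u)

lemma formNorm_nonneg (b : EuclideanSpace ℝ (Fin n) →L[ℝ] EuclideanSpace ℝ (Fin n) →L[ℝ] ℝ)
    (u : EuclideanSpace ℝ (Fin n)) : 0 ≤ formNorm b u := Real.sqrt_nonneg _

lemma IsMetricNear.formNorm_sq (h : IsMetricNear G x z) (u : EuclideanSpace ℝ (Fin n)) :
    formNorm (metricForm G x z) u ^ 2 = metricForm G x z u u :=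
  Real.sq_sqrt (h.metricForm_nonneg u)

/-- Cauchy–Schwarz, from positivity of the form on g(v,v) u - g(u,v) v. -/
lemma IsMetricNear.abs_metricForm_le (h : IsMetricNear G x z) (u v : EuclideanSpace ℝ (Fin n)) :
    |metricForm G x z u v| ≤ formNorm (metricForm G x z) u * formNorm (metricForm G x z) v := by
  rw [formNorm, formNorm, ← Real.sqrt_mul (h.metricForm_nonneg u)]
  refine Real.abs_le_sqrt ?_
  rcases eq_or_ne v 0 with rfl | hv
  · simp
  have hpos := h.metricForm_pos hv
  have h1 := h.metricForm_nonneg (metricForm G x z v v • u - metricForm G x z u v • v)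
  simp only [map_sub, map_smul, sub_apply, smul_apply, smul_eq_mul,
    h.eventually_symm.self_of_nhds v u] at h1
  have h2 : 0 ≤ metricForm G x z v v *
      (metricForm G x z u u * metricForm G x z v v - metricForm G x z u v ^ 2) := by
    refine h1.trans_eq ?_
    ring
  nlinarith [nonneg_of_mul_nonneg_right h2 hpos]

lemma norm_le_sum_abs (y : EuclideanSpace ℝ (Fin n)) : ‖y‖ ≤ ∑ i, |y i| := by
  conv_lhs => rw [eq_sum_stdVec y]
  refine (norm_sum_le _ _).trans (Finset.sum_le_sum fun i _ ↦ ?_)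
  rw [norm_smul, stdVec]
  simp

/-- The explicit constant is continuous in the base point, which makes the comparison locally
uniform. -/
lemma IsMetricNear.norm_le (h : IsMetricNear G x z) (y : EuclideanSpace ℝ (Fin n)) :
    ‖y‖ ≤ (∑ i, ∑ k, |(metricCoord G x z)⁻¹ i k| * √(metricCoord G x z k k)) *
      formNorm (metricForm G x z) y := by
  refine (norm_le_sum_abs y).trans ?_
  rw [Finset.sum_mul]
  refine Finset.sum_le_sum fun i _ ↦ ?_
  rw [apply_eq_sum_inv_mul_metricForm h y i, Finset.sum_mul]
  refine (Finset.abs_sum_le_sum_abs _ _).trans (Finset.sum_le_sum fun k _ ↦ ?_)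
  rw [abs_mul, mul_assoc]
  refine mul_le_mul_of_nonneg_left ?_ (abs_nonneg _)
  refine (h.abs_metricForm_le _ _).trans_eq ?_
  rw [formNorm, formNorm, metricForm_stdVec, mul_comm]

lemma IsMetricNear.exists_norm_le (h : ∀ᶠ y in 𝓝 z, IsMetricNear G x y) :
    ∃ C, 0 ≤ C ∧ ∀ᶠ y in 𝓝 z, ∀ u, ‖u‖ ≤ C * formNorm (metricForm G x y) u := by
  have hz := h.self_of_nhds
  have hc : ContinuousAt (fun y ↦ ∑ i, ∑ k, |(metricCoord G x y)⁻¹ i k| *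
      √(metricCoord G x y k k)) z := by
    refine tendsto_finsetSum _ fun i _ ↦ tendsto_finsetSum _ fun k _ ↦ ?_
    exact ((hz.contDiffAt_inv i k).continuousAt.abs).mul (hz.smooth k k).continuousAt.sqrt
  refine ⟨(∑ i, ∑ k, |(metricCoord G x z)⁻¹ i k| * √(metricCoord G x z k k)) + 1,
    by positivity, ?_⟩
  filter_upwards [h, hc.eventually_lt continuousAt_const (lt_add_one _)] with y hy hy' u
  exact (hy.norm_le u).trans (mul_le_mul_of_nonneg_right hy'.le (formNorm_nonneg _ _))

lemma exists_eventually_norm_le {E V : Type*} [TopologicalSpace E] [SeminormedAddCommGroup V]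
    {f : E → V} {z : E} (hf : ContinuousAt f z) : ∃ C, 0 ≤ C ∧ ∀ᶠ y in 𝓝 z, ‖f y‖ ≤ C :=
  ⟨‖f z‖ + 1, by positivity, (hf.norm.eventually_lt continuousAt_const (lt_add_one _)).mono
    fun _ hy ↦ hy.le⟩

end CurvatureBounds

/-! ### Operator norm bounds for curvature and Hessian -/

section NormBounds

set_option synthInstance.maxHeartbeats 200000

variable {E : Type*} [NormedAddCommGroup E] [NormedSpace ℝ E]

lemma norm_curvForm_le (Γ : E → E →L[ℝ] E →L[ℝ] E) (z : E) {C : ℝ}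
    (hC : ∀ u, ‖fderiv ℝ Γ z u‖ ≤ C * ‖u‖) (u v w : E) :
    ‖curvForm Γ z u v w‖ ≤ (2 * C + 2 * ‖Γ z‖ ^ 2) * (‖u‖ * ‖v‖ * ‖w‖) := by
  have h1 : ∀ a b c, ‖fderiv ℝ Γ z a b c‖ ≤ C * (‖a‖ * ‖b‖ * ‖c‖) := fun a b c ↦
    calc ‖fderiv ℝ Γ z a b c‖ ≤ ‖fderiv ℝ Γ z a‖ * ‖b‖ * ‖c‖ := (fderiv ℝ Γ z a).le_opNorm₂ b c
      _ ≤ C * ‖a‖ * ‖b‖ * ‖c‖ := by gcongr; exact hC a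
      _ = _ := by ring
  have h2 : ∀ a b c, ‖Γ z a (Γ z b c)‖ ≤ ‖Γ z‖ ^ 2 * (‖a‖ * ‖b‖ * ‖c‖) := fun a b c ↦
    calc ‖Γ z a (Γ z b c)‖ ≤ ‖Γ z‖ * ‖a‖ * ‖Γ z b c‖ := (Γ z).le_opNorm₂ _ _
      _ ≤ ‖Γ z‖ * ‖a‖ * (‖Γ z‖ * ‖b‖ * ‖c‖) := by gcongr; exact (Γ z).le_opNorm₂ _ _
      _ = _ := by ring
  have h3 : ‖curvForm Γ z u v w‖ ≤ ‖fderiv ℝ Γ z u v w‖ + ‖fderiv ℝ Γ z v u w‖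
      + ‖Γ z u (Γ z v w)‖ + ‖Γ z v (Γ z u w)‖ :=
    (norm_sub_le _ _).trans (add_le_add_left
      ((norm_add_le _ _).trans (add_le_add_left (norm_sub_le _ _) _)) _)
  have e : ‖v‖ * ‖u‖ * ‖w‖ = ‖u‖ * ‖v‖ * ‖w‖ := by ring
  have k1 := h1 u v w
  have k2 := h1 v u w
  have k3 := h2 u v w
  have k4 := h2 v u w
  rw [e] at k2 k4
  linarith

lemma abs_hessForm_le (Γ : E → E →L[ℝ] E →L[ℝ] E) (φ : E → ℝ) (z u v : E) :
    |hessForm Γ φ z u v| ≤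
      (‖fderiv ℝ (fderiv ℝ φ) z‖ + ‖fderiv ℝ φ z‖ * ‖Γ z‖) * (‖u‖ * ‖v‖) := by
  have h1 : ‖fderiv ℝ (fderiv ℝ φ) z u v‖ ≤ ‖fderiv ℝ (fderiv ℝ φ) z‖ * ‖u‖ * ‖v‖ :=
    ContinuousLinearMap.le_opNorm₂ _ _ _
  have h2 : ‖fderiv ℝ φ z (Γ z u v)‖ ≤ ‖fderiv ℝ φ z‖ * (‖Γ z‖ * ‖u‖ * ‖v‖) :=
    ((fderiv ℝ φ z).le_opNorm _).trans
      (mul_le_mul_of_nonneg_left ((Γ z).le_opNorm₂ _ _) (norm_nonneg _))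
  have h3 := norm_sub_le (fderiv ℝ (fderiv ℝ φ) z u v) (fderiv ℝ φ z (Γ z u v))
  rw [Real.norm_eq_abs] at h3
  refine h3.trans ((add_le_add h1 h2).trans_eq ?_)
  ring

end NormBounds

/-! ### Curvature bounds on compact sets, and bounded curvature of the conformal metric -/

section ChartInvariance

variable {n : ℕ} {M : Type*} [TopologicalSpace M] [ChartedSpace (EuclideanSpace ℝ (Fin n)) M]

section

variable [IsManifold (𝓡 n) ∞ M]

lemma contDiffAt_funCoord {φ : M → ℝ} {x : M} {z : EuclideanSpace ℝ (Fin n)}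
    (hz : z ∈ (extChartAt (𝓡 n) x).target)
    (hφ : ContMDiffAt (𝓡 n) 𝓘(ℝ, ℝ) ∞ φ ((extChartAt (𝓡 n) x).symm z)) :
    ContDiffAt ℝ ∞ (funCoord φ x) z := by
  have h := (contMDiffOn_extChartAt_symm (I := 𝓡 n) (n := ∞) x).contMDiffAt
    ((isOpen_extChartAt_target x).mem_nhds hz)
  exact contMDiffAt_iff_contDiffAt.1 (hφ.comp z h)

end

section

variable [RiemannianBundle (fun x : M ↦ TangentSpace (𝓡 n) x)]

/-- The curvature of the Riemannian metric and the Hessian of `φ` are bounded by `K` at `y`, relative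
to the Riemannian metric. -/
def CurvHessBoundAt (φ : M → ℝ) (K : ℝ) (y : M) : Prop :=
  (∀ u v w t : EuclideanSpace ℝ (Fin n),
    |metricForm (riemannianField n M) y (coordCenter y)
      (curvForm (christForm (riemannianField n M) y) (coordCenter y) u v w) t| ≤
    K * (formNorm (metricForm (riemannianField n M) y (coordCenter y)) u *
      formNorm (metricForm (riemannianField n M) y (coordCenter y)) v *
      formNorm (metricForm (riemannianField n M) y (coordCenter y)) w *
      formNorm (metricForm (riemannianField n M) y (coordCenter y)) t)) ∧
  ∀ u v : EuclideanSpace ℝ (Fin n),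
    |hessForm (christForm (riemannianField n M) y) (funCoord φ y) (coordCenter y) u v| ≤
      K * (formNorm (metricForm (riemannianField n M) y (coordCenter y)) u *
        formNorm (metricForm (riemannianField n M) y (coordCenter y)) v)

lemma CurvHessBoundAt.mono {φ : M → ℝ} {K K' : ℝ} {y : M} (h : CurvHessBoundAt (n := n) φ K y)
    (hK : K ≤ K') : CurvHessBoundAt (n := n) φ K' y := by
  have hn0 := formNorm_nonneg (metricForm (riemannianField n M) y (coordCenter y))
  refine ⟨fun u v w t ↦ (h.1 u v w t).trans (mul_le_mul_of_nonneg_right hK ?_),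
    fun u v ↦ (h.2 u v).trans (mul_le_mul_of_nonneg_right hK (mul_nonneg (hn0 u) (hn0 v)))⟩
  exact mul_nonneg (mul_nonneg (mul_nonneg (hn0 u) (hn0 v)) (hn0 w)) (hn0 t)

end

variable [IsManifold (𝓡 n) ∞ M] [RiemannianBundle (fun x : M ↦ TangentSpace (𝓡 n) x)]
  [IsContMDiffRiemannianBundle (𝓡 n) ∞ (EuclideanSpace ℝ (Fin n))
    (fun x : M ↦ TangentSpace (𝓡 n) x)]

lemma eventually_isMetricNear_riemannianField {x : M} {z : EuclideanSpace ℝ (Fin n)}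
    (hz : z ∈ (extChartAt (𝓡 n) x).target) :
    ∀ᶠ y in 𝓝 z, IsMetricNear (riemannianField n M) x y :=
  Filter.mem_of_superset ((isOpen_extChartAt_target x).mem_nhds hz)
    fun _ hy ↦ isMetricNear_riemannianField hy

lemma christForm_transition {x y : M} {z : EuclideanSpace ℝ (Fin n)}
    (hz : z ∈ (extChartAt (𝓡 n) y).target)
    (hz' : (extChartAt (𝓡 n) y).symm z ∈ (extChartAt (𝓡 n) x).source)
    (u v : EuclideanSpace ℝ (Fin n)) :
    fderiv ℝ (transitionMap n x y) z (christForm (riemannianField n M) y z u v) =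
      fderiv ℝ (fderiv ℝ (transitionMap n x y)) z u v +
        christForm (riemannianField n M) x (transitionMap n x y z)
          (fderiv ℝ (transitionMap n x y) z u) (fderiv ℝ (transitionMap n x y) z v) := by
  have h1 := isMetricNear_riemannianField (M := M) ((extChartAt (𝓡 n) x).map_source hz')
  have h2 := isMetricNear_riemannianField hz
  refine pullback_christoffel h1.differentiableAt_metricForm h2.differentiableAt_metricForm
    ((contDiffAt_transitionMap hz hz').of_le (by norm_cast)) ?_
    (surjective_fderiv_transitionMap hz hz') h1.eventually_symm.self_of_nhds h1.nondegenerate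
    h1.eventually_isLeviCivitaAt.self_of_nhds h2.eventually_isLeviCivitaAt.self_of_nhds u v
  filter_upwards [eventually_mem_transition hz hz'] with w hw
  exact metricForm_transition hw.1 hw.2

lemma curvForm_transition {x y : M} {z : EuclideanSpace ℝ (Fin n)}
    (hz : z ∈ (extChartAt (𝓡 n) y).target)
    (hz' : (extChartAt (𝓡 n) y).symm z ∈ (extChartAt (𝓡 n) x).source)
    (u v w : EuclideanSpace ℝ (Fin n)) :
    fderiv ℝ (transitionMap n x y) z (curvForm (christForm (riemannianField n M) y) z u v w) =
      curvForm (christForm (riemannianField n M) x) (transitionMap n x y z)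
        (fderiv ℝ (transitionMap n x y) z u) (fderiv ℝ (transitionMap n x y) z v)
        (fderiv ℝ (transitionMap n x y) z w) := by
  have h1 := isMetricNear_riemannianField (M := M) ((extChartAt (𝓡 n) x).map_source hz')
  have h2 := isMetricNear_riemannianField hz
  refine pullback_curvForm ((contDiffAt_transitionMap hz hz').of_le (by norm_cast))
    h1.differentiableAt_christForm h2.differentiableAt_christForm ?_ u v w
  filter_upwards [eventually_mem_transition hz hz'] with w hw
  exact christForm_transition hw.1 hw.2

lemma hessForm_transition {x y : M} {z : EuclideanSpace ℝ (Fin n)} {φ : M → ℝ}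
    (hz : z ∈ (extChartAt (𝓡 n) y).target)
    (hz' : (extChartAt (𝓡 n) y).symm z ∈ (extChartAt (𝓡 n) x).source)
    (hφ : ContMDiff (𝓡 n) 𝓘(ℝ, ℝ) ∞ φ) (u v : EuclideanSpace ℝ (Fin n)) :
    hessForm (christForm (riemannianField n M) y) (funCoord φ y) z u v =
      hessForm (christForm (riemannianField n M) x) (funCoord φ x) (transitionMap n x y z)
        (fderiv ℝ (transitionMap n x y) z u) (fderiv ℝ (transitionMap n x y) z v) := by
  refine pullback_hessForm ((contDiffAt_transitionMap hz hz').of_le (by norm_cast))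
    ((contDiffAt_funCoord ((extChartAt (𝓡 n) x).map_source hz') hφ.contMDiffAt).of_le
      (by norm_cast)) ?_ (christForm_transition hz hz') u v
  filter_upwards [eventually_mem_transition hz hz'] with w hw
  simp only [Function.comp_apply, funCoord, transitionMap]
  rw [(extChartAt (𝓡 n) x).left_inv hw.2]

-- The quantities at y are read in the preferred chart of y, which need not vary continuously with
-- y. They are transported to the single chart around x, where all data are continuous. Norms
-- relative to the metric do not change under this transport.
set_option synthInstance.maxHeartbeats 200000 in
set_option maxHeartbeats 1000000 in
lemma exists_eventually_curvHessBoundAt {φ : M → ℝ} (hφ : ContMDiff (𝓡 n) 𝓘(ℝ, ℝ) ∞ φ) (x : M) :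
    ∃ K, 0 ≤ K ∧ ∀ᶠ y in 𝓝 x, CurvHessBoundAt (n := n) φ K y := by
  have hx := coordCenter_mem_target (n := n) x
  have hm := isMetricNear_riemannianField hx
  have hΓ := hm.contDiffAt_christForm
  have hp : ContDiffAt ℝ ∞ (funCoord (n := n) φ x) (coordCenter x) :=
    contDiffAt_funCoord hx hφ.contMDiffAt
  have hp1 := hp.fderiv_right (m := ∞) (by simp)
  obtain ⟨c, hc0, hc⟩ :=
    IsMetricNear.exists_norm_le (eventually_isMetricNear_riemannianField (M := M) hx)
  obtain ⟨C₁, h10, h1⟩ := exists_eventually_norm_le hm.contDiffAt_metricForm.continuousAt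
  obtain ⟨C₂, h20, h2⟩ := exists_eventually_norm_le hΓ.continuousAt
  obtain ⟨C₃, h30, h3⟩ := exists_eventually_norm_le
    (hΓ.fderiv_right (m := ∞) (by simp)).continuousAt
  obtain ⟨C₄, h40, h4⟩ := exists_eventually_norm_le hp1.continuousAt
  obtain ⟨C₅, h50, h5⟩ := exists_eventually_norm_le
    (hp1.fderiv_right (m := ∞) (by simp)).continuousAt
  refine ⟨max (C₁ * (2 * C₃ + 2 * C₂ ^ 2) * c ^ 4) ((C₅ + C₄ * C₂) * c ^ 2),
    le_max_of_le_left (by positivity), ?_⟩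
  have hcont : Tendsto (extChartAt (𝓡 n) x) (𝓝 x) (𝓝 (coordCenter x)) := continuousAt_extChartAt x
  filter_upwards [hcont.eventually (hc.and (h1.and (h2.and (h3.and (h4.and h5))))),
    extChartAt_source_mem_nhds (I := 𝓡 n) x] with y ⟨hc, h1, h2, h3, h4, h5⟩ hy
  have hyt := coordCenter_mem_target (n := n) y
  have hys : (extChartAt (𝓡 n) y).symm (coordCenter y) ∈ (extChartAt (𝓡 n) x).source := by
    rwa [coordCenter, extChartAt_to_inv]
  have hψ : transitionMap n x y (coordCenter y) = extChartAt (𝓡 n) x y := by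
    rw [transitionMap, Function.comp_apply, coordCenter, extChartAt_to_inv]
  have hg := metricForm_transition (M := M) hyt hys
  -- The transition map is an isometry for the coordinate metrics, and this bounds its differential
  -- without further estimates.
  have hfn : ∀ u, formNorm (metricForm (riemannianField n M) x (extChartAt (𝓡 n) x y))
      (fderiv ℝ (transitionMap n x y) (coordCenter y) u) =
      formNorm (metricForm (riemannianField n M) y (coordCenter y)) u := fun u ↦ by
    rw [formNorm, formNorm, hg, hψ]
  have hD : ∀ u, ‖fderiv ℝ (transitionMap n x y) (coordCenter y) u‖ ≤
      c * formNorm (metricForm (riemannianField n M) y (coordCenter y)) u := fun u ↦ by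
    rw [← hfn]; exact hc _
  have hn0 := formNorm_nonneg (metricForm (riemannianField n M) y (coordCenter y))
  constructor
  · intro u v w t
    rw [hg, curvForm_transition hyt hys, hψ]
    calc _ ≤ ‖metricForm (riemannianField n M) x (extChartAt (𝓡 n) x y)‖ *
          ‖curvForm (christForm (riemannianField n M) x) (extChartAt (𝓡 n) x y)
            (fderiv ℝ (transitionMap n x y) (coordCenter y) u)
            (fderiv ℝ (transitionMap n x y) (coordCenter y) v)
            (fderiv ℝ (transitionMap n x y) (coordCenter y) w)‖ *
          ‖fderiv ℝ (transitionMap n x y) (coordCenter y) t‖ :=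
          ContinuousLinearMap.le_opNorm₂ _ _ _
      _ ≤ C₁ * ((2 * C₃ + 2 * C₂ ^ 2) *
          ((c * formNorm (metricForm (riemannianField n M) y (coordCenter y)) u) *
          (c * formNorm (metricForm (riemannianField n M) y (coordCenter y)) v) *
          (c * formNorm (metricForm (riemannianField n M) y (coordCenter y)) w))) *
          (c * formNorm (metricForm (riemannianField n M) y (coordCenter y)) t) := by
          have := hn0 u
          have := hn0 v
          have := hn0 w
          have := hn0 t
          gcongr
          · refine (norm_curvForm_le _ _ (C := C₃)
              (fun a ↦ ContinuousLinearMap.le_of_opNorm_le _ h3 a) _ _ _).trans ?_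
            gcongr <;> exact hD _
          · exact hD t
      _ = C₁ * (2 * C₃ + 2 * C₂ ^ 2) * c ^ 4 *
          (formNorm (metricForm (riemannianField n M) y (coordCenter y)) u *
          formNorm (metricForm (riemannianField n M) y (coordCenter y)) v *
          formNorm (metricForm (riemannianField n M) y (coordCenter y)) w *
          formNorm (metricForm (riemannianField n M) y (coordCenter y)) t) := by ring
      _ ≤ _ := by
          refine mul_le_mul_of_nonneg_right (le_max_left _ _) ?_
          have := hn0 u
          have := hn0 v
          have := hn0 w
          have := hn0 t
          positivity
  · intro u v
    rw [hessForm_transition hyt hys hφ, hψ]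
    calc _ ≤ _ := abs_hessForm_le _ _ _ _ _
      _ ≤ (C₅ + C₄ * C₂) *
          ((c * formNorm (metricForm (riemannianField n M) y (coordCenter y)) u) *
          (c * formNorm (metricForm (riemannianField n M) y (coordCenter y)) v)) := by
          have := hn0 u
          have := hn0 v
          exact mul_le_mul (add_le_add h5 (mul_le_mul h4 h2
            (ContinuousLinearMap.opNorm_nonneg _) h40))
            (mul_le_mul (hD u) (hD v) (norm_nonneg _) (by positivity)) (by positivity)
            (by positivity)
      _ = (C₅ + C₄ * C₂) * c ^ 2 *
          (formNorm (metricForm (riemannianField n M) y (coordCenter y)) u *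
          formNorm (metricForm (riemannianField n M) y (coordCenter y)) v) := by ring
      _ ≤ _ := mul_le_mul_of_nonneg_right (le_max_right _ _) (mul_nonneg (hn0 u) (hn0 v))

lemma IsCompact.exists_curvHessBoundAt {φ : M → ℝ} (hφ : ContMDiff (𝓡 n) 𝓘(ℝ, ℝ) ∞ φ) {s : Set M}
    (hs : IsCompact s) : ∃ K, 0 ≤ K ∧ ∀ y ∈ s, CurvHessBoundAt (n := n) φ K y := by
  refine hs.induction_on (p := fun s ↦ ∃ K, 0 ≤ K ∧ ∀ y ∈ s, CurvHessBoundAt (n := n) φ K y)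
    ⟨0, le_rfl, by simp⟩ ?_ ?_ ?_
  · rintro s t hst ⟨K, hK, h⟩
    exact ⟨K, hK, fun y hy ↦ h y (hst hy)⟩
  · rintro s t ⟨K, hK, h⟩ ⟨K', hK', h'⟩
    refine ⟨max K K', le_max_of_le_left hK, fun y hy ↦ ?_⟩
    rcases hy with hy | hy
    · exact (h y hy).mono (le_max_left _ _)
    · exact (h' y hy).mono (le_max_right _ _)
  · intro x _
    obtain ⟨K, hK, h⟩ := exists_eventually_curvHessBoundAt hφ x
    exact ⟨_, mem_nhdsWithin_of_mem_nhds h, K, hK, fun y hy ↦ hy⟩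

-- In the formula for φ² R' the curvature of g and four Hessian terms contribute 5K, and the
-- gradient term contributes 2K₀². This is the scaling required: the h-norm of the output carries
-- φ⁻² and those of the three inputs φ⁻⁶ (all squared), so a bound on φ² R' gives one on R' free of
-- φ.
set_option maxHeartbeats 1000000 in
lemma riemannNormSq_conformalField_le {φ : M → ℝ} (hφ : ContMDiff (𝓡 n) 𝓘(ℝ, ℝ) ∞ φ) {K K₀ : ℝ}
    (hK : 0 ≤ K) {x : M} (hx : CurvHessBoundAt (n := n) φ K x)
    (hgrad : gradNorm (riemannianField n M) φ x ≤ K₀) (h0 : 0 < φ x) (h1 : φ x ≤ 1) :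
    riemannNormSq (conformalField (riemannianField n M) φ) x ≤
      n ^ 3 * (5 * K + 2 * K₀ ^ 2) ^ 2 := by
  have hxt := coordCenter_mem_target (n := n) x
  have hm := eventually_isMetricNear_riemannianField (M := M) hxt
  have hz := hm.self_of_nhds
  have hv : funCoord (n := n) φ x (coordCenter x) = φ x := by
    rw [funCoord, coordCenter, extChartAt_to_inv]
  have hp := contDiffAt_funCoord (n := n) hxt hφ.contMDiffAt
  have hpz : funCoord (n := n) φ x (coordCenter x) ≠ 0 := by rw [hv]; exact h0.ne'
  have hc := hz.conformal hp hpz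
  have hY := metricForm_covariant_gradVec hm hp
  have hcurv := curvForm_conformalField hm hp hpz
  have hN : metricForm (riemannianField n M) x (coordCenter x)
      (gradVec (riemannianField n M) x (funCoord φ x) (coordCenter x))
      (gradVec (riemannianField n M) x (funCoord φ x) (coordCenter x)) ≤ K₀ ^ 2 := by
    rw [← gradNorm_sq_eq hz]
    exact pow_le_pow_left₀ (Real.sqrt_nonneg _) hgrad 2
  have hN0 := hz.metricForm_nonneg
    (gradVec (riemannianField n M) x (funCoord φ x) (coordCenter x))
  refine riemannNormSq_le hc fun u v w ↦ ?_
  simp only [metricForm_conformalField, hv] at hcurv ⊢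
  set z : EuclideanSpace ℝ (Fin n) := coordCenter x
  set g := metricForm (riemannianField n M) x z
  set R' := curvForm (christForm (conformalField (riemannianField n M) φ) x) z u v w
  set N := g (gradVec (riemannianField n M) x (funCoord φ x) z)
    (gradVec (riemannianField n M) x (funCoord φ x) z)
  have hCS := hz.abs_metricForm_le
  have hn0 := formNorm_nonneg g
  have main : ∀ t, φ x ^ 2 * |g R' t| ≤ (5 * K + 2 * K₀ ^ 2) *
      (formNorm g u * formNorm g v * formNorm g w * formNorm g t) := by
    intro t
    have e := congrArg (fun y ↦ g y t) (hcurv u v w)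
    simp only [map_add, map_sub, map_smul, add_apply, sub_apply, smul_apply, smul_eq_mul] at e
    have hYu := hY u t
    have hYv := hY v t
    simp only [map_add, add_apply] at hYu hYv
    rw [hYu, hYv] at e
    have hu := hn0 u
    have hv' := hn0 v
    have hw := hn0 w
    have ht := hn0 t
    have hsq : φ x ^ 2 ≤ 1 := pow_le_one₀ h0.le h1
    have b1 := hx.1 u v w t
    have hprod : ∀ {a b A B : ℝ}, |a| ≤ A → |b| ≤ B → |a * b| ≤ A * B := fun ha hb ↦ by
      rw [abs_mul]; exact mul_le_mul ha hb (abs_nonneg _) ((abs_nonneg _).trans ha)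
    have b2 := hprod (hx.2 v w) (hCS u t)
    have b3 := hprod (hx.2 u w) (hCS v t)
    have b4 := hprod (hCS v w) (hx.2 u t)
    have b5 := hprod (hCS u w) (hx.2 v t)
    have b6 := hprod (hCS u w) (hCS v t)
    have b7 := hprod (hCS v w) (hCS u t)
    set P := formNorm g u * formNorm g v * formNorm g w * formNorm g t with hP
    have hP0 : 0 ≤ P := by positivity
    have hKP : 0 ≤ K * P := mul_nonneg hK hP0
    have key : φ x ^ 2 * |g R' t| = |φ x ^ 2 * g R' t| := by
      rw [abs_mul, abs_of_nonneg (by positivity : 0 ≤ φ x ^ 2)]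
    rw [key, e]
    have c2 : |hessForm (christForm (riemannianField n M) x) (funCoord φ x) z v w * g u t| ≤ K * P :=
      b2.trans_eq (by rw [hP]; ring)
    have c3 : |hessForm (christForm (riemannianField n M) x) (funCoord φ x) z u w * g v t| ≤ K * P :=
      b3.trans_eq (by rw [hP]; ring)
    have c4 : |g v w * hessForm (christForm (riemannianField n M) x) (funCoord φ x) z u t| ≤ K * P :=
      b4.trans_eq (by rw [hP]; ring)
    have c5 : |g u w * hessForm (christForm (riemannianField n M) x) (funCoord φ x) z v t| ≤ K * P :=
      b5.trans_eq (by rw [hP]; ring)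
    have c6 : |g u w * g v t| ≤ P := b6.trans_eq (by rw [hP]; ring)
    have c7 : |g v w * g u t| ≤ P := b7.trans_eq (by rw [hP]; ring)
    have d1 : |φ x ^ 2 * g (curvForm (christForm (riemannianField n M) x) z u v w) t| ≤ K * P := by
      rw [abs_mul, abs_of_nonneg (by positivity : 0 ≤ φ x ^ 2)]
      exact (mul_le_of_le_one_left (abs_nonneg _) hsq).trans b1
    have d2 : |φ x * (hessForm (christForm (riemannianField n M) x) (funCoord φ x) z v w * g u t
        - hessForm (christForm (riemannianField n M) x) (funCoord φ x) z u w * g v t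
        + g v w * hessForm (christForm (riemannianField n M) x) (funCoord φ x) z u t
        - g u w * hessForm (christForm (riemannianField n M) x) (funCoord φ x) z v t)| ≤
        4 * (K * P) := by
      rw [abs_mul, abs_of_pos h0]
      refine (mul_le_of_le_one_left (abs_nonneg _) h1).trans ?_
      rw [abs_le] at c2 c3 c4 c5 ⊢
      constructor <;> linarith [c2.1, c2.2, c3.1, c3.2, c4.1, c4.2, c5.1, c5.2]
    have d3 : |N * (g u w * g v t - g v w * g u t)| ≤ K₀ ^ 2 * (2 * P) := by
      refine hprod (by rwa [abs_of_nonneg hN0]) ?_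
      rw [abs_le] at c6 c7 ⊢
      constructor <;> linarith [c6.1, c6.2, c7.1, c7.2]
    refine (abs_add_le _ _).trans ?_
    have := abs_add_le (φ x ^ 2 * g (curvForm (christForm (riemannianField n M) x) z u v w) t)
      (φ x * (hessForm (christForm (riemannianField n M) x) (funCoord φ x) z v w * g u t
        - hessForm (christForm (riemannianField n M) x) (funCoord φ x) z u w * g v t
        + g v w * hessForm (christForm (riemannianField n M) x) (funCoord φ x) z u t
        - g u w * hessForm (christForm (riemannianField n M) x) (funCoord φ x) z v t))
    linarith
  -- Testing against R' itself and cancelling one factor of its norm bounds that norm.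
  have hR := main R'
  have hsqR : g R' R' = formNorm g R' ^ 2 := (hz.formNorm_sq R').symm
  have hRle : φ x ^ 2 * formNorm g R' ≤ (5 * K + 2 * K₀ ^ 2) *
      (formNorm g u * formNorm g v * formNorm g w) := by
    rw [abs_of_nonneg (hz.metricForm_nonneg _), hsqR] at hR
    rcases (hn0 R').eq_or_lt with h | h
    · rw [← h, mul_zero]
      have := hn0 u
      have := hn0 v
      have := hn0 w
      positivity
    · refine le_of_mul_le_mul_right ?_ h
      refine le_trans (le_of_eq ?_) (hR.trans (le_of_eq ?_)) <;> ring
  have hsq := pow_le_pow_left₀ (mul_nonneg (by positivity) (hn0 R')) hRle 2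
  rw [hsqR, ← hz.formNorm_sq u, ← hz.formNorm_sq v, ← hz.formNorm_sq w]
  have h0' := h0.ne'
  calc _ = ((φ x ^ 2)⁻¹) ^ 3 * (φ x ^ 2 * formNorm g R') ^ 2 := by field_simp
    _ ≤ ((φ x ^ 2)⁻¹) ^ 3 * ((5 * K + 2 * K₀ ^ 2) *
      (formNorm g u * formNorm g v * formNorm g w)) ^ 2 := by gcongr
    _ = _ := by ring

lemma hasBoundedCurvatureOn_conformalField {φ : M → ℝ} (hφ : ContMDiff (𝓡 n) 𝓘(ℝ, ℝ) ∞ φ)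
    {U s : Set M} (hs : IsCompact s) (hUs : U ⊆ s) {K₀ : ℝ}
    (hgrad : ∀ x ∈ U, gradNorm (riemannianField n M) φ x ≤ K₀) (h0 : ∀ x ∈ U, 0 < φ x)
    (h1 : ∀ x ∈ U, φ x ≤ 1) :
    HasBoundedCurvatureOn U (conformalField (riemannianField n M) φ) := by
  obtain ⟨K, hK, h⟩ := hs.exists_curvHessBoundAt hφ
  refine ⟨√(n ^ 3 * (5 * K + 2 * K₀ ^ 2) ^ 2), fun x hx ↦ Real.sqrt_le_sqrt ?_⟩
  exact riemannNormSq_conformalField_le hφ hK (h x (hUs hx)) (hgrad x hx) (h0 x hx) (h1 x hx)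

end ChartInvariance

/-! ### Compactness of closed balls -/

section HopfRinow

/-- **Hopf–Rinow**: the closed balls of a complete locally compact length space are compact. -/
theorem isCompact_closedBall_of_length_space {X : Type*} [MetricSpace X] [CompleteSpace X]
    [WeaklyLocallyCompactSpace X]
    (hmid : ∀ (x y : X) (a b : ℝ), 0 ≤ a → 0 < b → dist x y < a + b →
      ∃ z, dist x z ≤ a ∧ dist z y < b) (p : X) (R : ℝ) : IsCompact (Metric.closedBall p R) := by
  -- A compact ball has a compact neighbourhood containing a thickening of it. By the length
  -- property a slightly larger ball lies in that thickening.
  have hopen : ∀ r, 0 ≤ r → IsCompact (Metric.closedBall p r) →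
      ∃ δ > 0, IsCompact (Metric.closedBall p (r + δ)) := by
    intro r hr hc
    obtain ⟨K, hK, hrK⟩ := exists_compact_superset hc
    obtain ⟨δ, hδ, hδK⟩ := hc.exists_thickening_subset_open isOpen_interior hrK
    refine ⟨δ / 2, by positivity, hK.of_isClosed_subset Metric.isClosed_closedBall
      fun y hy ↦ interior_subset (hδK ?_)⟩
    obtain ⟨z, hz, hzy⟩ := hmid p y r δ hr hδ (by
      rw [Metric.mem_closedBall, dist_comm] at hy; linarith)
    rw [Metric.mem_thickening_iff]
    exact ⟨z, by rwa [Metric.mem_closedBall, dist_comm], by rwa [dist_comm]⟩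
  -- Every point of the ball of radius r lies within ε/2 of the ball of radius r - ε/4. A finite
  -- ε/2-net of the smaller ball is thus an ε-net of the larger one.
  have hclosed : ∀ r, (∀ r' < r, IsCompact (Metric.closedBall p r')) →
      IsCompact (Metric.closedBall p r) := by
    intro r hr
    refine isCompact_iff_totallyBounded_isComplete.2
      ⟨?_, Metric.isClosed_closedBall.isComplete⟩
    refine Metric.totallyBounded_iff.2 fun ε hε ↦ ?_
    rcases lt_or_ge r (ε / 2) with h | h
    · refine ⟨{p}, Set.finite_singleton p, fun y hy ↦ ?_⟩
      simp only [Set.mem_singleton_iff, Set.iUnion_iUnion_eq_left, Metric.mem_ball]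
      rw [Metric.mem_closedBall] at hy
      linarith
    · have hc := hr (r - ε / 4) (by linarith)
      obtain ⟨t, ht, hcov⟩ := Metric.totallyBounded_iff.1 hc.totallyBounded (ε / 2) (by positivity)
      refine ⟨t, ht, fun y hy ↦ ?_⟩
      obtain ⟨z, hz, hzy⟩ := hmid p y (r - ε / 4) (ε / 2) (by linarith) (by positivity) (by
        rw [Metric.mem_closedBall, dist_comm] at hy; linarith)
      have hz' := hcov (show z ∈ Metric.closedBall p (r - ε / 4) by
        rwa [Metric.mem_closedBall, dist_comm])
      simp only [Set.mem_iUnion, Metric.mem_ball, exists_prop] at hz' ⊢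
      obtain ⟨q, hq, hzq⟩ := hz'
      refine ⟨q, hq, ?_⟩
      have := dist_triangle y z q
      rw [dist_comm] at hzy
      linarith
  -- The infimum of the bad radii is itself good by `hclosed`. Then `hopen` leaves no bad radius
  -- just above it.
  by_contra hR
  set T : Set ℝ := {r | ¬ IsCompact (Metric.closedBall p r)} with hT
  have hbdd : ∀ r ∈ T, 0 ≤ r := fun r hr ↦ by
    by_contra h
    exact hr (by rw [Metric.closedBall_eq_empty.2 (not_le.1 h)]; exact isCompact_empty)
  have hT0 : T.Nonempty := ⟨R, hR⟩
  have hbb : BddBelow T := ⟨0, hbdd⟩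
  have hs : IsCompact (Metric.closedBall p (sInf T)) := hclosed _ fun r hr ↦ by
    by_contra h
    exact absurd (csInf_le hbb h) (not_le.2 hr)
  obtain ⟨δ, hδ, hc⟩ := hopen _ (le_csInf hT0 hbdd) hs
  obtain ⟨r, hr, hrδ⟩ := exists_lt_of_csInf_lt hT0 (lt_add_of_pos_right (sInf T) hδ)
  exact hr (hc.of_isClosed_subset Metric.isClosed_closedBall (Metric.closedBall_subset_closedBall
    hrδ.le))

end HopfRinow

/-! ### Growth of functions along curves, and the length space property -/

section Curves

variable {n : ℕ}

section

variable {M : Type*} [TopologicalSpace M] [ChartedSpace (EuclideanSpace ℝ (Fin n)) M]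

/-- The differential of a real-valued function, with values in `ℝ`. -/
noncomputable def differentialAt (f : M → ℝ) (x : M) (v : TangentSpace (𝓡 n) x) : ℝ :=
  mfderiv (𝓡 n) 𝓘(ℝ, ℝ) f x v

lemma enorm_sub_le_lintegral_of_abs_differentialAt_le {f : M → ℝ} {U : Set M} (hU : IsOpen U)
    (hf : ContMDiffOn (𝓡 n) 𝓘(ℝ, ℝ) 1 f U) {G : MetricField n M} {K : ℝ} (hK : 0 ≤ K)
    (hfK : ∀ x ∈ U, ∀ v : TangentSpace (𝓡 n) x,
      |differentialAt f x v| ≤ K * √(G x v v))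
    {c : ℝ → M} {a b : ℝ} (hab : a ≤ b) (hc : ContMDiffOn 𝓘(ℝ, ℝ) (𝓡 n) 1 c (Icc a b))
    (hcU : MapsTo c (Icc a b) U) :
    ‖f (c b) - f (c a)‖ₑ ≤ ENNReal.ofReal K * ∫⁻ t in Icc a b, ENNReal.ofReal (√(G (c t)
      (mfderiv 𝓘(ℝ, ℝ) (𝓡 n) c t (1 : ℝ)) (mfderiv 𝓘(ℝ, ℝ) (𝓡 n) c t (1 : ℝ)))) := by
  have hd : ContDiffOn ℝ 1 (f ∘ c) (Icc a b) := contMDiffOn_iff_contDiffOn.1 (hf.comp hc hcU)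
  refine (enorm_sub_le_lintegral_derivWithin_Icc_of_contDiffOn_Icc hd hab).trans ?_
  -- The endpoints form a null set. Only at interior points does the derivative within the interval
  -- agree with the one in the definition of length.
  rw [← lintegral_const_mul' _ _ ENNReal.ofReal_ne_top, ← restrict_Ioo_eq_restrict_Icc]
  refine setLIntegral_mono' measurableSet_Ioo fun t ht ↦ ?_
  have hnhds : Icc a b ∈ 𝓝 t := Icc_mem_nhds ht.1 ht.2
  have htc : t ∈ Icc a b := ⟨ht.1.le, ht.2.le⟩
  have hct : MDifferentiableAt 𝓘(ℝ, ℝ) (𝓡 n) c t :=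
    (hc.contMDiffAt hnhds).mdifferentiableAt (by simp)
  have hft : MDifferentiableAt (𝓡 n) 𝓘(ℝ, ℝ) f (c t) :=
    (hf.contMDiffAt (hU.mem_nhds (hcU htc))).mdifferentiableAt (by simp)
  have e : derivWithin (f ∘ c) (Icc a b) t =
      differentialAt f (c t) (mfderiv 𝓘(ℝ, ℝ) (𝓡 n) c t (1 : ℝ)) := by
    rw [derivWithin_of_mem_nhds hnhds, ← fderiv_apply_one_eq_deriv, ← mfderiv_eq_fderiv,
      mfderiv_comp t hft hct]
    rfl
  rw [e, ← ENNReal.ofReal_mul hK, Real.enorm_eq_ofReal_abs]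
  exact ENNReal.ofReal_le_ofReal (hfK _ (hcU htc) _)

variable [RiemannianBundle (fun x : M ↦ TangentSpace (𝓡 n) x)]

lemma enorm_eq_ofReal_sqrt_riemannianField (x : M) (v : TangentSpace (𝓡 n) x) :
    ‖v‖ₑ = ENNReal.ofReal √(riemannianField n M x v v) := by
  rw [← ofReal_norm, norm_eq_sqrt_real_inner]
  rfl

lemma pathELength_eq_lintegral_riemannianField (c : ℝ → M) (a b : ℝ) :
    pathELength (𝓡 n) c a b = ∫⁻ t in Icc a b, ENNReal.ofReal (√(riemannianField n M (c t)
      (mfderiv 𝓘(ℝ, ℝ) (𝓡 n) c t (1 : ℝ)) (mfderiv 𝓘(ℝ, ℝ) (𝓡 n) c t (1 : ℝ)))) := by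
  rw [pathELength_eq_lintegral_mfderiv_Icc]
  simp only [enorm_eq_ofReal_sqrt_riemannianField]
  rfl

lemma sqrt_conformalField {φ : M → ℝ} {x : M} (hx : 0 < φ x) (v : TangentSpace (𝓡 n) x) :
    √(conformalField (riemannianField n M) φ x v v) =
      (φ x)⁻¹ * √(riemannianField n M x v v) := by
  rw [conformalField, Real.sqrt_mul (by positivity), Real.sqrt_inv, Real.sqrt_sq hx.le]

variable [IsManifold (𝓡 n) ∞ M]
  [IsContMDiffRiemannianBundle (𝓡 n) ∞ (EuclideanSpace ℝ (Fin n))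
    (fun x : M ↦ TangentSpace (𝓡 n) x)]

/-- Cauchy–Schwarz for the gradient. The work is to pass from tangent vectors to coordinates through
the differential of the inverse chart, bijective by injectivity and dimension. -/
lemma abs_differentialAt_le_gradNorm_mul {φ : M → ℝ} {x : M}
    (hφ : MDifferentiableAt (𝓡 n) 𝓘(ℝ, ℝ) φ x) (v : TangentSpace (𝓡 n) x) :
    |differentialAt φ x v| ≤
      gradNorm (riemannianField n M) φ x * √(riemannianField n M x v v) := by
  have hx := coordCenter_mem_target (n := n) x
  have hm := isMetricNear_riemannianField (M := M) hx
  have hinv : (extChartAt (𝓡 n) x).symm (coordCenter x) = x := by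
    rw [coordCenter, extChartAt_to_inv]
  -- The type of v depends on its base point, so the point is generalized before it is replaced by
  -- its image under the chart and back.
  suffices H : ∀ y, y = (extChartAt (𝓡 n) x).symm (coordCenter x) →
      MDifferentiableAt (𝓡 n) 𝓘(ℝ, ℝ) φ y → ∀ v : TangentSpace (𝓡 n) y,
      |differentialAt φ y v| ≤
      gradNorm (riemannianField n M) φ x * √(riemannianField n M y v v) from H x hinv.symm hφ v
  rintro y rfl hy v
  let L : EuclideanSpace ℝ (Fin n) →L[ℝ] EuclideanSpace ℝ (Fin n) :=
    mfderiv (𝓡 n) (𝓡 n) (extChartAt (𝓡 n) x).symm (coordCenter x)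
  have hLi : Function.Injective L.toLinearMap := mfderiv_extChartAt_symm_injective hx
  obtain ⟨u, hu⟩ : ∃ u : EuclideanSpace ℝ (Fin n), L.toLinearMap u = v :=
    LinearMap.injective_iff_surjective.1 hLi v
  have hu' : mfderiv (𝓡 n) (𝓡 n) (extChartAt (𝓡 n) x).symm (coordCenter x) u = v := hu
  have e1 : differentialAt φ ((extChartAt (𝓡 n) x).symm (coordCenter x)) v =
      fderiv ℝ (funCoord φ x) (coordCenter x) u := by
    rw [← hu', ← mfderiv_eq_fderiv]
    have := mfderiv_comp (coordCenter x) hy (mdifferentiableAt_extChartAt_symm hx)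
    exact (congrArg (fun L ↦ (L u : ℝ)) this).symm
  have e2 : formNorm (metricForm (riemannianField n M) x (coordCenter x)) u =
      √(riemannianField n M ((extChartAt (𝓡 n) x).symm (coordCenter x)) v v) := by
    unfold formNorm
    rw [metricForm_riemannianField, hu']
    rfl
  have e3 : gradNorm (riemannianField n M) φ x = formNorm
      (metricForm (riemannianField n M) x (coordCenter x))
      (gradVec (riemannianField n M) x (funCoord φ x) (coordCenter x)) := by
    have h0 : 0 ≤ gradNorm (riemannianField n M) φ x := Real.sqrt_nonneg _
    unfold formNorm
    rw [← gradNorm_sq_eq hm, Real.sqrt_sq h0]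
  rw [e1, ← e2, e3, ← metricForm_gradVec hm.det_ne_zero hm.symm.self_of_nhds]
  exact hm.abs_metricForm_le _ _

/-- The factor φ⁻¹ in d log φ = φ⁻¹ dφ is exactly the factor between the lengths of v for the two
metrics. -/
lemma abs_differentialAt_log_le {φ : M → ℝ} {x : M} {K : ℝ}
    (hφ : MDifferentiableAt (𝓡 n) 𝓘(ℝ, ℝ) φ x) (hx : 0 < φ x)
    (hK : gradNorm (riemannianField n M) φ x ≤ K) (v : TangentSpace (𝓡 n) x) :
    |differentialAt (fun y ↦ Real.log (φ y)) x v| ≤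
      K * √(conformalField (riemannianField n M) φ x v v) := by
  have hlog : HasDerivAt Real.log (φ x)⁻¹ (φ x) := Real.hasDerivAt_log hx.ne'
  have h1 := mfderiv_comp x (g := Real.log) (I' := 𝓘(ℝ, ℝ)) (I'' := 𝓘(ℝ, ℝ))
    hlog.differentiableAt.mdifferentiableAt hφ
  have h2 : differentialAt (fun y ↦ Real.log (φ y)) x v = (φ x)⁻¹ * differentialAt φ x v := by
    have h3 := congrArg (fun L ↦ (L v : ℝ)) h1
    refine h3.trans ?_
    change (mfderiv 𝓘(ℝ, ℝ) 𝓘(ℝ, ℝ) Real.log (φ x)) (mfderiv (𝓡 n) 𝓘(ℝ, ℝ) φ x v) = _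
    rw [mfderiv_eq_fderiv]
    have := hlog.hasFDerivAt.fderiv
    rw [this]
    exact mul_comm (differentialAt φ x v) (φ x)⁻¹
  rw [h2, sqrt_conformalField hx, abs_mul, abs_of_pos (inv_pos.2 hx), ← mul_assoc, mul_comm K,
    mul_assoc]
  refine mul_le_mul_of_nonneg_left ((abs_differentialAt_le_gradNorm_mul hφ v).trans ?_)
    (inv_pos.2 hx).le
  exact mul_le_mul_of_nonneg_right hK (Real.sqrt_nonneg _)

end

variable {M : Type*} [MetricSpace M] [ChartedSpace (EuclideanSpace ℝ (Fin n)) M]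
  [RiemannianBundle (fun x : M ↦ TangentSpace (𝓡 n) x)] [IsRiemannianManifold (𝓡 n) M]

lemma edist_le_pathELength {c : ℝ → M} {a b : ℝ} (hab : a ≤ b)
    (hc : ContMDiffOn 𝓘(ℝ, ℝ) (𝓡 n) 1 c (Icc a b)) :
    edist (c a) (c b) ≤ pathELength (𝓡 n) c a b := by
  rw [IsRiemannianManifold.out (I := 𝓡 n) (c a) (c b)]
  exact riemannianEDist_le_pathELength hc rfl rfl hab

lemma exists_curve_of_edist_lt (n : ℕ) {M : Type*} [MetricSpace M]
    [ChartedSpace (EuclideanSpace ℝ (Fin n)) M]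
    [RiemannianBundle (fun x : M ↦ TangentSpace (𝓡 n) x)] [IsRiemannianManifold (𝓡 n) M]
    {x y : M} {r : ℝ≥0∞} (h : edist x y < r) :
    ∃ c : ℝ → M, c 0 = x ∧ c 1 = y ∧ ContMDiffOn 𝓘(ℝ, ℝ) (𝓡 n) 1 c (Icc 0 1) ∧
      pathELength (𝓡 n) c 0 1 < r := by
  rw [IsRiemannianManifold.out (I := 𝓡 n) x y] at h
  exact exists_lt_of_riemannianEDist_lt h

/-- The point is found on an almost minimal curve, at distance a from x, by the intermediate value
theorem. This is the hypothesis of the Hopf–Rinow argument. -/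
lemma exists_dist_le_and_dist_lt (n : ℕ) {M : Type*} [MetricSpace M]
    [ChartedSpace (EuclideanSpace ℝ (Fin n)) M]
    [RiemannianBundle (fun x : M ↦ TangentSpace (𝓡 n) x)] [IsRiemannianManifold (𝓡 n) M]
    (x y : M) (a b : ℝ) (ha : 0 ≤ a) (hb : 0 < b) (hxy : dist x y < a + b) :
    ∃ z, dist x z ≤ a ∧ dist z y < b := by
  rcases le_or_gt (dist x y) a with h | h
  · exact ⟨y, h, by simpa using hb⟩
  have hxy' : edist x y < ENNReal.ofReal (a + b) := by
    rw [edist_dist]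
    exact (ENNReal.ofReal_lt_ofReal_iff (by linarith)).2 hxy
  obtain ⟨c, rfl, rfl, hc, hlen⟩ := exists_curve_of_edist_lt n hxy'
  have hcont : ContinuousOn (fun t ↦ dist (c 0) (c t)) (Icc 0 1) :=
    (continuous_const.dist continuous_id).comp_continuousOn hc.continuousOn
  obtain ⟨t, ht, hta⟩ := intermediate_value_Icc zero_le_one hcont
    (show a ∈ Icc _ _ by simpa using ⟨ha, h.le⟩)
  refine ⟨c t, hta.le, ?_⟩
  have h1 : edist (c 0) (c t) ≤ pathELength (𝓡 n) c 0 t :=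
    edist_le_pathELength ht.1 (hc.mono (Icc_subset_Icc_right ht.2))
  have h2 : edist (c t) (c 1) ≤ pathELength (𝓡 n) c t 1 :=
    edist_le_pathELength ht.2 (hc.mono (Icc_subset_Icc_left ht.1))
  have h3 : edist (c 0) (c t) + edist (c t) (c 1) < ENNReal.ofReal (a + b) :=
    (add_le_add h1 h2).trans_lt ((pathELength_add ht.1 ht.2).trans_lt hlen)
  rw [edist_dist, edist_dist, ← ENNReal.ofReal_add dist_nonneg dist_nonneg,
    ENNReal.ofReal_lt_ofReal_iff (by linarith)] at h3
  simp only at hta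
  linarith

lemma isCompact_closedBall_of_isRiemannianManifold (n : ℕ) {M : Type*} [MetricSpace M]
    [ChartedSpace (EuclideanSpace ℝ (Fin n)) M]
    [RiemannianBundle (fun x : M ↦ TangentSpace (𝓡 n) x)] [IsRiemannianManifold (𝓡 n) M]
    [CompleteSpace M] (p : M) (R : ℝ) : IsCompact (Metric.closedBall p R) := by
  have : LocallyCompactSpace M := Manifold.locallyCompact_of_finiteDimensional (𝓡 n)
  exact isCompact_closedBall_of_length_space (exists_dist_le_and_dist_lt n) p R

end Curves

/-! ### Distance and completeness of the conformal metric -/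

section ConformalDistance

variable {n : ℕ} {M : Type*} [MetricSpace M] [ChartedSpace (EuclideanSpace ℝ (Fin n)) M]

lemma exists_curve_of_mem_ballIn {G : MetricField n M} {U : Set M} {x y : M} {s : ℝ}
    (h : y ∈ ballIn U G x s) : ∃ c : ℝ → M, ContMDiffOn 𝓘(ℝ, ℝ) (𝓡 n) 1 c (Icc 0 1) ∧
      MapsTo c (Icc 0 1) U ∧ c 0 = x ∧ c 1 = y ∧ curveLength G c < ENNReal.ofReal s := by
  have h2 := h.2
  simp only [distIn, iInf_lt_iff, exists_prop] at h2
  exact h2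

lemma distIn_le_curveLength {G : MetricField n M} {U : Set M} {c : ℝ → M}
    (hc : ContMDiffOn 𝓘(ℝ, ℝ) (𝓡 n) 1 c (Icc 0 1)) (hcU : MapsTo c (Icc 0 1) U) :
    distIn U G (c 0) (c 1) ≤ curveLength G c := by
  unfold distIn
  exact iInf_le_of_le c <| iInf_le_of_le hc <| iInf_le_of_le hcU <| iInf_le_of_le rfl <|
    iInf_le_of_le rfl le_rfl

variable [RiemannianBundle (fun x : M ↦ TangentSpace (𝓡 n) x)]

lemma curveLength_conformalField_le {φ : M → ℝ} {c : ℝ → M} {b : ℝ} (hb : 0 < b)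
    (hφ : ∀ t ∈ Icc (0 : ℝ) 1, b ≤ φ (c t)) :
    curveLength (conformalField (riemannianField n M) φ) c ≤
      ENNReal.ofReal b⁻¹ * pathELength (𝓡 n) c 0 1 := by
  rw [pathELength_eq_lintegral_riemannianField, ← lintegral_const_mul' _ _ ENNReal.ofReal_ne_top]
  refine setLIntegral_mono' measurableSet_Icc fun t ht ↦ ?_
  rw [← ENNReal.ofReal_mul (inv_pos.2 hb).le,
    sqrt_conformalField (hb.trans_le (hφ t ht))]
  exact ENNReal.ofReal_le_ofReal
    (mul_le_mul_of_nonneg_right (inv_anti₀ hb (hφ t ht)) (Real.sqrt_nonneg _))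

lemma pathELength_le_curveLength_conformalField {φ : M → ℝ} {c : ℝ → M} {B : ℝ} (hB : 0 ≤ B)
    (h0 : ∀ t ∈ Icc (0 : ℝ) 1, 0 < φ (c t)) (hφ : ∀ t ∈ Icc (0 : ℝ) 1, φ (c t) ≤ B) :
    pathELength (𝓡 n) c 0 1 ≤
      ENNReal.ofReal B * curveLength (conformalField (riemannianField n M) φ) c := by
  rw [pathELength_eq_lintegral_riemannianField, curveLength,
    ← lintegral_const_mul' _ _ ENNReal.ofReal_ne_top]
  refine setLIntegral_mono' measurableSet_Icc fun t ht ↦ ?_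
  rw [← ENNReal.ofReal_mul hB, sqrt_conformalField (h0 t ht), ← mul_assoc]
  refine ENNReal.ofReal_le_ofReal (le_mul_of_one_le_left (Real.sqrt_nonneg _) ?_)
  rw [← div_eq_mul_inv, one_le_div (h0 t ht)]
  exact hφ t ht

lemma edist_le_distIn_conformalField [IsRiemannianManifold (𝓡 n) M] {φ : M → ℝ}
    (h1 : ∀ x, φ x ≤ 1) (x y : M) :
    edist x y ≤ distIn {x | 0 < φ x} (conformalField (riemannianField n M) φ) x y := by
  refine le_iInf fun c ↦ le_iInf fun hc ↦ le_iInf fun hcU ↦ le_iInf fun hx ↦ le_iInf fun hy ↦ ?_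
  subst hx hy
  refine ((edist_le_pathELength zero_le_one hc).trans
      (pathELength_le_curveLength_conformalField zero_le_one (fun t ht ↦ hcU ht)
        fun t _ ↦ h1 _)).trans ?_
  simp

variable [IsManifold (𝓡 n) ∞ M]
  [IsContMDiffRiemannianBundle (𝓡 n) ∞ (EuclideanSpace ℝ (Fin n))
    (fun x : M ↦ TangentSpace (𝓡 n) x)]

lemma enorm_log_sub_log_le_curveLength {φ : M → ℝ} {K : ℝ} (hK0 : 0 ≤ K)
    (hφ : ContMDiff (𝓡 n) 𝓘(ℝ, ℝ) ∞ φ) (hK : ∀ x, gradNorm (riemannianField n M) φ x ≤ K)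
    {c : ℝ → M} (hc : ContMDiffOn 𝓘(ℝ, ℝ) (𝓡 n) 1 c (Icc 0 1))
    (hcU : MapsTo c (Icc 0 1) {x | 0 < φ x}) {t : ℝ} (ht : t ∈ Icc (0 : ℝ) 1) :
    ‖Real.log (φ (c t)) - Real.log (φ (c 0))‖ₑ ≤
      ENNReal.ofReal K * curveLength (conformalField (riemannianField n M) φ) c := by
  have hsub : Icc (0 : ℝ) t ⊆ Icc 0 1 := Icc_subset_Icc_right ht.2
  have hU : IsOpen {x | 0 < φ x} := isOpen_lt continuous_const hφ.continuous
  have hlog : ContMDiffOn (𝓡 n) 𝓘(ℝ, ℝ) 1 (fun y ↦ Real.log (φ y)) {x | 0 < φ x} := by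
    intro y hy
    have h1 : ContMDiffAt 𝓘(ℝ, ℝ) 𝓘(ℝ, ℝ) 1 Real.log (φ y) :=
      (Real.contDiffAt_log.2 (ne_of_gt hy)).contMDiffAt
    exact (h1.comp y ((hφ y).of_le (by simp))).contMDiffWithinAt
  refine (enorm_sub_le_lintegral_of_abs_differentialAt_le hU hlog hK0 (fun x hx v ↦
    abs_differentialAt_log_le ((hφ x).mdifferentiableAt (by simp)) hx (hK x) v) ht.1
    (hc.mono hsub) (hcU.mono_left hsub)).trans ?_
  exact mul_le_mul_right (lintegral_mono_set hsub) _

variable [IsRiemannianManifold (𝓡 n) M]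

lemma abs_sub_le_mul_dist_of_gradNorm_le {φ : M → ℝ} {K : ℝ} (hK0 : 0 ≤ K)
    (hφ : ContMDiff (𝓡 n) 𝓘(ℝ, ℝ) ∞ φ) (hK : ∀ x, gradNorm (riemannianField n M) φ x ≤ K)
    (x y : M) : |φ y - φ x| ≤ K * dist x y := by
  -- The distance is an infimum of lengths that need not be attained, hence the loss ε.
  have key : ∀ ε > 0, |φ y - φ x| ≤ K * (dist x y + ε) := by
    intro ε hε
    have hd : edist x y < ENNReal.ofReal (dist x y + ε) := by
      rw [edist_dist]
      exact (ENNReal.ofReal_lt_ofReal_iff (by positivity)).2 (by linarith)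
    obtain ⟨c, rfl, rfl, hc, hlen⟩ := exists_curve_of_edist_lt n hd
    have h1 := enorm_sub_le_lintegral_of_abs_differentialAt_le isOpen_univ
      (hφ.of_le (by simp)).contMDiffOn hK0 (G := riemannianField n M) (fun x _ v ↦
      (abs_differentialAt_le_gradNorm_mul ((hφ x).mdifferentiableAt (by simp)) v).trans
        (mul_le_mul_of_nonneg_right (hK x) (Real.sqrt_nonneg _))) zero_le_one hc
      (mapsTo_univ _ _)
    rw [← pathELength_eq_lintegral_riemannianField] at h1
    have h2 := h1.trans (mul_le_mul_right hlen.le _)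
    rwa [← ENNReal.ofReal_mul hK0, Real.enorm_eq_ofReal_abs,
      ENNReal.ofReal_le_ofReal_iff (by positivity)] at h2
  refine le_of_forall_pos_le_add fun ε hε ↦ (key (ε / (K + 1)) (by positivity)).trans ?_
  rw [mul_add]
  gcongr
  rw [mul_div_assoc', div_le_iff₀ (by positivity)]
  nlinarith

/-- Within a ball of the conformal metric of radius `s`, `log φ` oscillates by at most `K * s`, and
the ball lies in a ball of comparable radius of the original metric. -/
lemma abs_log_le_and_dist_lt_of_mem_ballIn {φ : M → ℝ} {K : ℝ} (hK0 : 0 ≤ K)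
    (hφ : ContMDiff (𝓡 n) 𝓘(ℝ, ℝ) ∞ φ) (hK : ∀ x, gradNorm (riemannianField n M) φ x ≤ K)
    {x y : M} {s : ℝ} (hs : 0 ≤ s)
    (h : y ∈ ballIn {x | 0 < φ x} (conformalField (riemannianField n M) φ) x s) :
    |Real.log (φ y) - Real.log (φ x)| ≤ K * s ∧ dist x y < φ x * Real.exp (K * s) * s := by
  obtain ⟨c, hc, hcU, rfl, rfl, hlen⟩ := exists_curve_of_mem_ballIn h
  -- The bound is needed along the whole curve, since φ must be controlled everywhere on it to
  -- compare the two lengths.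
  have hlog : ∀ t ∈ Icc (0 : ℝ) 1, |Real.log (φ (c t)) - Real.log (φ (c 0))| ≤ K * s := by
    intro t ht
    have h2 := (enorm_log_sub_log_le_curveLength hK0 hφ hK hc hcU ht).trans
      (mul_le_mul_right hlen.le _)
    rwa [← ENNReal.ofReal_mul hK0, Real.enorm_eq_ofReal_abs,
      ENNReal.ofReal_le_ofReal_iff (by positivity)] at h2
  have h0 : (0 : ℝ) ∈ Icc (0 : ℝ) 1 := ⟨le_rfl, zero_le_one⟩
  have hφ0 : 0 < φ (c 0) := hcU h0
  refine ⟨hlog 1 ⟨zero_le_one, le_rfl⟩, ?_⟩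
  have hB : 0 < φ (c 0) * Real.exp (K * s) := by positivity
  have hle : ∀ t ∈ Icc (0 : ℝ) 1, φ (c t) ≤ φ (c 0) * Real.exp (K * s) := by
    intro t ht
    have h1 := (abs_le.1 (hlog t ht)).2
    have h2 : 0 < φ (c t) := hcU ht
    rw [← Real.log_le_log_iff h2 hB, Real.log_mul hφ0.ne' (Real.exp_pos _).ne', Real.log_exp]
    linarith
  have h3 : edist (c 0) (c 1) < ENNReal.ofReal (φ (c 0) * Real.exp (K * s) * s) := by
    refine ((edist_le_pathELength zero_le_one hc).trans
      (pathELength_le_curveLength_conformalField hB.le (fun t ht ↦ hcU ht) hle)).trans_lt ?_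
    rw [ENNReal.ofReal_mul hB.le]
    exact ENNReal.mul_lt_mul_right (ENNReal.ofReal_pos.2 hB).ne' ENNReal.ofReal_ne_top hlen
  rw [edist_dist] at h3
  exact (ENNReal.ofReal_lt_ofReal_iff_of_nonneg dist_nonneg).1 h3

/-- The radius is so small that φ, being K-Lipschitz for g, stays above φ(x)/2 on a nearly minimal
curve. There h-lengths are at most (φ(x)/2)⁻¹ times g-lengths. K + 1 replaces K to allow K = 0. -/
lemma distIn_conformalField_le {φ : M → ℝ} {K : ℝ} (hK0 : 0 ≤ K)
    (hφ : ContMDiff (𝓡 n) 𝓘(ℝ, ℝ) ∞ φ) (hK : ∀ x, gradNorm (riemannianField n M) φ x ≤ K)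
    {x y : M} (hx : 0 < φ x) {r : ℝ≥0∞} (hr : r ≤ ENNReal.ofReal (φ x / (2 * (K + 1))))
    (hxy : edist y x < r) :
    distIn {x | 0 < φ x} (conformalField (riemannianField n M) φ) y x ≤
      ENNReal.ofReal (φ x / 2)⁻¹ * r := by
  obtain ⟨c, rfl, rfl, hc, hlen⟩ := exists_curve_of_edist_lt n hxy
  have hlow : ∀ t ∈ Icc (0 : ℝ) 1, φ (c 1) / 2 ≤ φ (c t) := by
    intro t ht
    have h1 : edist (c t) (c 1) < ENNReal.ofReal (φ (c 1) / (2 * (K + 1))) :=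
      ((edist_le_pathELength ht.2 (hc.mono (Icc_subset_Icc_left ht.1))).trans
        (pathELength_mono ht.1 le_rfl)).trans_lt (hlen.trans_le hr)
    rw [edist_dist, ENNReal.ofReal_lt_ofReal_iff_of_nonneg dist_nonneg,
      lt_div_iff₀ (by positivity)] at h1
    have h2 := (abs_le.1 (abs_sub_le_mul_dist_of_gradNorm_le hK0 hφ hK (c t) (c 1))).2
    nlinarith [dist_nonneg (x := c t) (y := c 1)]
  exact (distIn_le_curveLength hc fun t ht ↦ (half_pos hx).trans_le (hlow t ht)).trans
    ((curveLength_conformalField_le (half_pos hx) hlow).trans (mul_le_mul_right hlen.le _))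

/-- As φ ≤ 1, the distance of h dominates that of g, which gives a g-limit. The Lipschitz bound on
log φ keeps this limit off the zero set, and near it the two distances are comparable. -/
theorem isCompleteMetricOn_conformalField [CompleteSpace M] {φ : M → ℝ} {K : ℝ} (hK0 : 0 ≤ K)
    (hφ : ContMDiff (𝓡 n) 𝓘(ℝ, ℝ) ∞ φ) (hK : ∀ x, gradNorm (riemannianField n M) φ x ≤ K)
    (h1 : ∀ x, φ x ≤ 1) :
    IsCompleteMetricOn {x | 0 < φ x} (conformalField (riemannianField n M) φ) := by
  intro s hsU hs
  have hcauchy : CauchySeq s := EMetric.cauchySeq_iff.2 fun ε hε ↦ by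
    obtain ⟨N, hN⟩ := hs ε hε
    exact ⟨N, fun i hi j hj ↦ (edist_le_distIn_conformalField h1 _ _).trans_lt (hN i hi j hj)⟩
  obtain ⟨x, hx⟩ := cauchySeq_tendsto_of_complete hcauchy
  obtain ⟨N, hN⟩ := hs 1 one_pos
  -- The tail lies within h-distance 1 of s N, so φ is at least φ(s N) e^(-K) along it, and this
  -- passes to the limit.
  have hφx : 0 < φ x := by
    have hb : 0 < φ (s N) * Real.exp (-(K * 1)) := mul_pos (hsU N) (Real.exp_pos _)
    refine hb.trans_le (ge_of_tendsto ((hφ.continuous.tendsto x).comp hx) ?_)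
    filter_upwards [eventually_ge_atTop N] with i hi
    have hmem : s i ∈ ballIn {x | 0 < φ x} (conformalField (riemannianField n M) φ) (s N) 1 :=
      ⟨hsU i, by simpa using hN N le_rfl i hi⟩
    have h2 := (abs_le.1 (abs_log_le_and_dist_lt_of_mem_ballIn hK0 hφ hK zero_le_one hmem).1).1
    have h3 : 0 < φ (s i) := hsU i
    have h4 : 0 < φ (s N) := hsU N
    rw [Function.comp_apply, ← Real.log_le_log_iff hb h3, Real.log_mul h4.ne' (Real.exp_pos _).ne',
      Real.log_exp]
    linarith
  refine ⟨x, hφx, ENNReal.tendsto_atTop_zero.2 fun ε hε ↦ ?_⟩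
  have hpos : (0 : ℝ≥0∞) < min (ENNReal.ofReal (φ x / (2 * (K + 1))))
      (ENNReal.ofReal (φ x / 2) * ε) :=
    lt_min (ENNReal.ofReal_pos.2 (by positivity))
      (ENNReal.mul_pos (ENNReal.ofReal_pos.2 (by positivity)).ne' hε.ne')
  obtain ⟨N', hN'⟩ := EMetric.tendsto_atTop.1 hx _ hpos
  refine ⟨N', fun i hi ↦ (distIn_conformalField_le hK0 hφ hK hφx (min_le_left _ _)
    (hN' i hi)).trans ?_⟩
  refine (mul_le_mul_right (min_le_right _ _) _).trans ?_
  rw [← mul_assoc, ← ENNReal.ofReal_mul (by positivity), inv_mul_cancel₀ (by positivity)]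
  simp

end ConformalDistance

/-! ### Volume and area of the conformal metric -/

section ConformalVolume

variable {n : ℕ} {M : Type*} [TopologicalSpace M] [ChartedSpace (EuclideanSpace ℝ (Fin n)) M]

/-- The Gram matrix has size m and is scaled by φ⁻², so the square root of its determinant is scaled
by φ⁻ᵐ. -/
lemma volumeElement_conformalField {m : ℕ} {G : MetricField n M} {φ : M → ℝ}
    {ψ : EuclideanSpace ℝ (Fin m) → M} {z : EuclideanSpace ℝ (Fin m)} (h : 0 < φ (ψ z)) :
    volumeElement m (conformalField G φ) ψ z = (φ (ψ z))⁻¹ ^ m * volumeElement m G ψ z := by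
  have e : ((φ (ψ z) ^ 2)⁻¹) ^ m = ((φ (ψ z))⁻¹ ^ m) ^ 2 := by
    rw [← inv_pow, ← pow_mul, ← pow_mul, mul_comm]
  rw [volumeElement, volumeElement]
  have hdet := Matrix.det_smul (Matrix.of fun a b : Fin m ↦
    G (ψ z) (mfderiv (𝓡 m) (𝓡 n) ψ z (stdVec a)) (mfderiv (𝓡 m) (𝓡 n) ψ z (stdVec b)))
    ((φ (ψ z) ^ 2)⁻¹)
  rw [Fintype.card_fin, e] at hdet
  rw [← Real.sqrt_sq (show 0 ≤ (φ (ψ z))⁻¹ ^ m by positivity), ← Real.sqrt_mul (by positivity),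
    ← hdet]
  rfl

/-- Both volumes are suprema over the same parametrized families, so comparing densities suffices,
with no change of variables. -/
lemma riemannianVol_le_of_volumeElement_le {m : ℕ} {G G' : MetricField n M} {S : Set M} {C : ℝ}
    (hC : 0 ≤ C) (H : ∀ (ψ : EuclideanSpace ℝ (Fin m) → M) (z : EuclideanSpace ℝ (Fin m)),
      ψ z ∈ S → volumeElement m G ψ z ≤ C * volumeElement m G' ψ z) :
    riemannianVol m G S ≤ ENNReal.ofReal C * riemannianVol m G' S := by
  rw [riemannianVol]
  refine iSup_le fun N ↦ iSup_le fun W ↦ iSup_le fun ψ ↦ iSup_le fun h ↦ iSup_le fun hd ↦ ?_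
  have hle : ∑ i, ∫⁻ z in W i, ENNReal.ofReal (volumeElement m G' (ψ i) z) ≤
      riemannianVol m G' S := by
    unfold riemannianVol
    exact le_iSup_of_le N <| le_iSup_of_le W <| le_iSup_of_le ψ <| le_iSup_of_le h <|
      le_iSup_of_le hd le_rfl
  refine le_trans ?_ (mul_le_mul_right hle _)
  rw [Finset.mul_sum]
  refine Finset.sum_le_sum fun i _ ↦ ?_
  rw [← lintegral_const_mul' _ _ ENNReal.ofReal_ne_top]
  refine setLIntegral_mono' (h i).1.measurableSet fun z hz ↦ ?_
  rw [← ENNReal.ofReal_mul hC]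
  exact ENNReal.ofReal_le_ofReal (H _ _ ((h i).2.2.2 hz))

lemma riemannianVol_conformalField_le (m : ℕ) {G : MetricField n M} {φ : M → ℝ} {S : Set M} {b : ℝ}
    (hb : 0 < b) (hφ : ∀ x ∈ S, b ≤ φ x) :
    riemannianVol m (conformalField G φ) S ≤ ENNReal.ofReal (b⁻¹ ^ m) * riemannianVol m G S := by
  refine riemannianVol_le_of_volumeElement_le (by positivity) fun ψ z hz ↦ ?_
  have h0 : 0 < φ (ψ z) := hb.trans_le (hφ _ hz)
  rw [volumeElement_conformalField h0]
  exact mul_le_mul_of_nonneg_right (pow_le_pow_left₀ (inv_pos.2 h0).le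
    (inv_anti₀ hb (hφ _ hz)) m) (Real.sqrt_nonneg _)

lemma riemannianVol_le_conformalField (m : ℕ) {G : MetricField n M} {φ : M → ℝ} {S : Set M} {b : ℝ}
    (hb : 0 ≤ b) (h0 : ∀ x ∈ S, 0 < φ x) (hφ : ∀ x ∈ S, φ x ≤ b) :
    riemannianVol m G S ≤ ENNReal.ofReal (b ^ m) * riemannianVol m (conformalField G φ) S := by
  refine riemannianVol_le_of_volumeElement_le (by positivity) fun ψ z hz ↦ ?_
  rw [volumeElement_conformalField (h0 _ hz), ← mul_assoc, ← mul_pow]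
  refine le_mul_of_one_le_left (Real.sqrt_nonneg _) (one_le_pow₀ ?_)
  rw [← div_eq_mul_inv, one_le_div (h0 _ hz)]
  exact hφ _ hz

end ConformalVolume

/-! ### The isoperimetric inequality for the conformal metric -/

section ConformalIsoperimetric

/-- From 1 - δ ≤ e^(-t) one gets (1 - δ) e^t ≤ 1, and 1 - 2δ ≤ (1 - δ)². -/
lemma one_sub_two_mul_exp_le {δ t : ℝ} (hδ : 0 < δ) (hδ' : δ ≤ 1) (ht : t ≤ δ) :
    (1 - 2 * δ) * Real.exp t ≤ 1 - δ := by
  rcases le_or_gt (1 - 2 * δ) 0 with h | h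
  · exact (mul_nonpos_of_nonpos_of_nonneg h (Real.exp_pos _).le).trans (by linarith)
  have h1 : 1 - δ ≤ Real.exp (-t) := by linarith [Real.add_one_le_exp (-t)]
  have h2 : Real.exp (-t) * Real.exp t = 1 := by rw [← Real.exp_add]; simp
  have h3 : (1 - δ) * Real.exp t ≤ 1 :=
    (mul_le_mul_of_nonneg_right h1 (Real.exp_pos _).le).trans h2.le
  calc (1 - 2 * δ) * Real.exp t ≤ ((1 - δ) * (1 - δ)) * Real.exp t :=
        mul_le_mul_of_nonneg_right (by nlinarith) (Real.exp_pos _).le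
    _ = (1 - δ) * ((1 - δ) * Real.exp t) := by ring
    _ ≤ (1 - δ) * 1 := mul_le_mul_of_nonneg_left h3 (by linarith)
    _ = 1 - δ := mul_one _

/-- The almost Euclidean isoperimetric inequality under a change of volume and area by constant
factors. -/
lemma isoperimetric_of_le {n : ℕ} {δ P E : ℝ} (hP : 0 < P) (hE : 0 < E)
    (hEδ : (1 - 2 * δ) * E ^ (2 * (n * (n - 1))) ≤ max 0 (1 - δ))
    {I V A V' A' : ℝ≥0∞}
    (hV : V' ≤ ENNReal.ofReal ((P / E)⁻¹ ^ n) * V)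
    (hA : A ≤ ENNReal.ofReal ((P * E) ^ (n - 1)) * A')
    (h : ENNReal.ofReal (1 - δ) * I * V ^ (n - 1) ≤ A ^ n) :
    ENNReal.ofReal (1 - 2 * δ) * I * V' ^ (n - 1) ≤ A' ^ n := by
  have hPE : 0 < P * E := mul_pos hP hE
  -- Vol^(n-1) and Area^n scale by the same power n(n-1), so P cancels and only the distortion
  -- E^(2n(n-1)) remains. The maximum with 0 matches the truncation of 1 - δ by `ENNReal.ofReal`.
  have hnum : (1 - 2 * δ) * ((P / E)⁻¹ ^ n) ^ (n - 1) ≤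
      ((P * E) ^ (n * (n - 1)))⁻¹ * max 0 (1 - δ) := by
    have e : ((P / E)⁻¹ ^ n) ^ (n - 1) =
        ((P * E) ^ (n * (n - 1)))⁻¹ * E ^ (2 * (n * (n - 1))) := by
      rw [← pow_mul, ← inv_pow, pow_mul E 2, ← mul_pow]
      congr 1
      field_simp
    rw [e, mul_left_comm]
    exact mul_le_mul_of_nonneg_left hEδ (by positivity)
  calc ENNReal.ofReal (1 - 2 * δ) * I * V' ^ (n - 1)
      ≤ ENNReal.ofReal (1 - 2 * δ) * I * (ENNReal.ofReal ((P / E)⁻¹ ^ n) * V) ^ (n - 1) := by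
        gcongr
    _ = ENNReal.ofReal ((1 - 2 * δ) * ((P / E)⁻¹ ^ n) ^ (n - 1)) * (I * V ^ (n - 1)) := by
        rw [mul_pow, ← ENNReal.ofReal_pow (by positivity), ENNReal.ofReal_mul' (by positivity)]
        ring
    _ ≤ ENNReal.ofReal (((P * E) ^ (n * (n - 1)))⁻¹ * max 0 (1 - δ)) * (I * V ^ (n - 1)) := by
        gcongr
    _ = ENNReal.ofReal (((P * E) ^ (n * (n - 1)))⁻¹) *
          (ENNReal.ofReal (1 - δ) * I * V ^ (n - 1)) := by
        rw [ENNReal.ofReal_mul (by positivity), ENNReal.ofReal_max, ENNReal.ofReal_zero,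
          max_eq_right zero_le]
        ring
    _ ≤ ENNReal.ofReal (((P * E) ^ (n * (n - 1)))⁻¹) *
          (ENNReal.ofReal ((P * E) ^ (n - 1)) * A') ^ n := by
        gcongr
        exact h.trans (pow_le_pow_left₀ zero_le hA n)
    _ = A' ^ n := by
        rw [mul_pow (ENNReal.ofReal _), ← ENNReal.ofReal_pow (by positivity), ← mul_assoc,
          ← ENNReal.ofReal_mul (by positivity), ← pow_mul, mul_comm (n - 1) n,
          inv_mul_cancel₀ (by positivity), ENNReal.ofReal_one, one_mul]

variable {n : ℕ} {M : Type*} [MetricSpace M] [ChartedSpace (EuclideanSpace ℝ (Fin n)) M]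
  [RiemannianBundle (fun x : M ↦ TangentSpace (𝓡 n) x)] [IsManifold (𝓡 n) ∞ M]
  [IsContMDiffRiemannianBundle (𝓡 n) ∞ (EuclideanSpace ℝ (Fin n))
    (fun x : M ↦ TangentSpace (𝓡 n) x)]
  [IsRiemannianManifold (𝓡 n) M]

/-- A domain in the h-ball lies in a g-ball where the hypothesis applies. On it and on its boundary
φ is between φ(y) e^(-ε) and φ(y) e^ε, so the constant φ(y) drops out by scale invariance. -/
theorem almostEuclideanIsoperimetric_conformalField {φ : M → ℝ} {K r δ : ℝ} (hK0 : 0 ≤ K)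
    (hr : 0 < r) (hδ : 0 < δ)
    (hφ : ContMDiff (𝓡 n) 𝓘(ℝ, ℝ) ∞ φ) (hK : ∀ x, gradNorm (riemannianField n M) φ x ≤ K)
    (h1 : ∀ x, φ x ≤ 1) (hKr : K * r ≤ 1) (hKδ : (n : ℝ) ^ 2 * (K * r) ≤ δ)
    (hiso : ∀ (x : M) (s : ℝ), 0 < s → s ≤ r → Metric.ball x s ⊆ {x | 0 < φ x} →
      AlmostEuclideanIsoperimetric (riemannianField n M) δ (Metric.ball x s))
    {y : M} (hy : 0 < φ y) :
    AlmostEuclideanIsoperimetric (conformalField (riemannianField n M) φ) (2 * δ)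
      (ballIn {x | 0 < φ x} (conformalField (riemannianField n M) φ) y (r / 8)) := by
  intro Ω hΩ hΩB
  set ε : ℝ := K * (r / 8) with hε
  have hε0 : 0 ≤ ε := by positivity
  have hε8 : ε ≤ 1 / 8 := by linarith
  have hE0 : 0 < Real.exp ε := Real.exp_pos ε
  have hE : Real.exp ε ≤ 2 := by
    have h2 : 1 - ε ≤ Real.exp (-ε) := by linarith [Real.add_one_le_exp (-ε)]
    have h3 : Real.exp (-ε) * Real.exp ε = 1 := by rw [← Real.exp_add]; simp
    nlinarith
  have hmem : ∀ x ∈ Ω, φ y / Real.exp ε ≤ φ x ∧ φ x ≤ φ y * Real.exp ε ∧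
      dist y x < φ y * Real.exp ε * (r / 8) := by
    intro x hx
    obtain ⟨h2, h3⟩ := abs_log_le_and_dist_lt_of_mem_ballIn hK0 hφ hK (by positivity) (hΩB hx)
    have hx0 : 0 < φ x := (hΩB hx).1
    rw [abs_le] at h2
    refine ⟨?_, ?_, h3⟩
    · rw [← Real.log_le_log_iff (by positivity) hx0, Real.log_div hy.ne' hE0.ne', Real.log_exp]
      linarith
    · rw [← Real.log_le_log_iff hx0 (by positivity), Real.log_mul hy.ne' hE0.ne', Real.log_exp]
      linarith
  -- The boundary of Ω need not lie in the open h-ball, but the weak inequalities for φ pass to the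
  -- closure.
  have hclos : ∀ x ∈ closure Ω, φ y / Real.exp ε ≤ φ x ∧ φ x ≤ φ y * Real.exp ε := by
    have hcl : IsClosed {x | φ y / Real.exp ε ≤ φ x ∧ φ x ≤ φ y * Real.exp ε} :=
      (isClosed_le continuous_const hφ.continuous).inter
        (isClosed_le hφ.continuous continuous_const)
    have hsub : Ω ⊆ {x | φ y / Real.exp ε ≤ φ x ∧ φ x ≤ φ y * Real.exp ε} :=
      fun x hx ↦ ⟨(hmem x hx).1, (hmem x hx).2.1⟩
    exact fun x hx ↦ closure_minimal hsub hcl hx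
  have hs0 : 0 < φ y * Real.exp ε * (r / 8) := by positivity
  have hsr : φ y * Real.exp ε * (r / 8) ≤ r := by
    have : φ y * Real.exp ε ≤ 1 * 2 := mul_le_mul (h1 y) hE hE0.le zero_le_one
    nlinarith
  -- The g-radius is proportional to φ(y). On this ball φ therefore drops by at most φ(y) e^ε ε ≤
  -- φ(y)/4 and stays positive.
  have hball : Metric.ball y (φ y * Real.exp ε * (r / 8)) ⊆ {x | 0 < φ x} := by
    intro x hx
    rw [Metric.mem_ball, dist_comm] at hx
    have h2 := (abs_le.1 (abs_sub_le_mul_dist_of_gradNorm_le hK0 hφ hK y x)).1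
    have h3 : K * dist y x ≤ φ y * (Real.exp ε * ε) := by
      refine (mul_le_mul_of_nonneg_left hx.le hK0).trans (le_of_eq ?_)
      rw [hε]; ring
    have h4 : Real.exp ε * ε ≤ 2 * (1 / 8) := mul_le_mul hE hε8 hε0 zero_le_two
    have h5 : φ y * (Real.exp ε * ε) ≤ φ y * (2 * (1 / 8)) := mul_le_mul_of_nonneg_left h4 hy.le
    change 0 < φ x
    linarith
  have hg := hiso y _ hs0 hsr hball Ω hΩ fun x hx ↦ by
    rw [Metric.mem_ball, dist_comm]; exact (hmem x hx).2.2
  have hlow : 0 < φ y / Real.exp ε := by positivity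
  refine isoperimetric_of_le hy hE0 ?_
    (riemannianVol_conformalField_le n hlow fun x hx ↦ (hmem x hx).1)
    (riemannianVol_le_conformalField (n - 1) (by positivity)
      (fun x hx ↦ hlow.trans_le (hclos x (frontier_subset_closure hx)).1)
      fun x hx ↦ (hclos x (frontier_subset_closure hx)).2) hg
  -- For δ ≤ 1 the exponent is 2n(n-1) · Kr/8 ≤ n² Kr ≤ δ. For δ > 1 the constant 1 - 2δ is negative
  -- and nothing is claimed.
  rcases le_or_gt δ 1 with h | h
  · refine le_max_of_le_right ?_
    rw [← Real.exp_nat_mul]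
    refine one_sub_two_mul_exp_le hδ h (le_trans ?_ hKδ)
    have h2 : ((2 * (n * (n - 1)) : ℕ) : ℝ) ≤ 2 * (n : ℝ) ^ 2 := by
      have : 2 * (n * (n - 1)) ≤ 2 * n ^ 2 := by
        rw [pow_two]; gcongr; omega
      exact_mod_cast this
    refine (mul_le_mul_of_nonneg_right h2 hε0).trans ?_
    rw [hε]
    have : 0 ≤ (n : ℝ) ^ 2 * (K * r) := by positivity
    linarith
  · exact le_max_of_le_left
      (mul_nonpos_of_nonpos_of_nonneg (by linarith) (by positivity))

end ConformalIsoperimetric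

/-! ### The one-dimensional cutoff and its derivatives -/

section Cutoff

/-- The step is constant outside [0, 1], so both derivatives are continuous with compact support. -/
lemma exists_abs_deriv_smoothTransition_le : ∃ A : ℝ, 0 ≤ A ∧ ∀ x,
    |deriv Real.smoothTransition x| ≤ A ∧ |deriv (deriv Real.smoothTransition) x| ≤ A := by
  have hsm : ContDiff ℝ 2 Real.smoothTransition := Real.smoothTransition.contDiff (n := 2)
  have h1 : ContDiff ℝ 1 (deriv Real.smoothTransition) := hsm.deriv'
  have h2 : Continuous (deriv (deriv Real.smoothTransition)) := h1.continuous_deriv le_rfl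
  have hs : HasCompactSupport (deriv Real.smoothTransition) := by
    refine HasCompactSupport.intro (isCompact_Icc (a := (0 : ℝ)) (b := 1)) fun x hx ↦ ?_
    rw [mem_Icc, not_and_or, not_le, not_le] at hx
    rcases hx with hx | hx
    · have : Real.smoothTransition =ᶠ[𝓝 x] fun _ ↦ (0 : ℝ) := by
        filter_upwards [gt_mem_nhds hx] with y hy
        exact Real.smoothTransition.zero_of_nonpos hy.le
      rw [this.deriv_eq, deriv_const]
    · have : Real.smoothTransition =ᶠ[𝓝 x] fun _ ↦ (1 : ℝ) := by
        filter_upwards [lt_mem_nhds hx] with y hy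
        exact Real.smoothTransition.one_of_one_le hy.le
      rw [this.deriv_eq, deriv_const]
  obtain ⟨A, hA⟩ := h1.continuous.bounded_above_of_compact_support hs
  obtain ⟨B, hB⟩ := h2.bounded_above_of_compact_support hs.deriv
  exact ⟨max A B, ((norm_nonneg _).trans (hA 0)).trans (le_max_left _ _), fun x ↦
    ⟨(hA x).trans (le_max_left _ _), (hB x).trans (le_max_right _ _)⟩⟩

/-- The smooth cutoff function equal to `1` on `(-∞, ρ - w]` and to `0` on `[ρ, ∞)`. -/
noncomputable def cutoff (ρ w t : ℝ) : ℝ := Real.smoothTransition ((ρ - t) / w)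

lemma contDiff_cutoff (ρ w : ℝ) : ContDiff ℝ ∞ (cutoff ρ w) :=
  (Real.smoothTransition.contDiff (n := ⊤)).comp ((contDiff_const.sub contDiff_id).div_const w)

lemma deriv_cutoff (ρ w t : ℝ) :
    deriv (cutoff ρ w) t = -w⁻¹ * deriv Real.smoothTransition ((ρ - t) / w) := by
  have h1 : HasDerivAt (fun s : ℝ ↦ (ρ - s) / w) (-1 / w) t :=
    ((hasDerivAt_id t).const_sub ρ).div_const w
  have h2 : HasDerivAt Real.smoothTransition (deriv Real.smoothTransition ((ρ - t) / w))
      ((ρ - t) / w) :=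
    ((Real.smoothTransition.contDiff (n := 1)).differentiable (by simp) _).hasDerivAt
  rw [show cutoff ρ w = Real.smoothTransition ∘ fun s : ℝ ↦ (ρ - s) / w from rfl,
    (h2.comp t h1).deriv]
  ring

lemma deriv_deriv_cutoff (ρ w t : ℝ) : deriv (deriv (cutoff ρ w)) t =
    w⁻¹ ^ 2 * deriv (deriv Real.smoothTransition) ((ρ - t) / w) := by
  have h1 : HasDerivAt (fun s : ℝ ↦ (ρ - s) / w) (-1 / w) t :=
    ((hasDerivAt_id t).const_sub ρ).div_const w
  have hd : ContDiff ℝ 1 (deriv Real.smoothTransition) :=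
    (Real.smoothTransition.contDiff (n := 2)).deriv'
  have h2 : HasDerivAt (deriv Real.smoothTransition)
      (deriv (deriv Real.smoothTransition) ((ρ - t) / w)) ((ρ - t) / w) :=
    (hd.differentiable (by simp) _).hasDerivAt
  rw [show deriv (cutoff ρ w) = fun s ↦ -w⁻¹ * (deriv Real.smoothTransition ∘
    fun s : ℝ ↦ (ρ - s) / w) s from funext (deriv_cutoff ρ w), ((h2.comp t h1).const_mul _).deriv]
  ring

end Cutoff

/-! ### Gradient and Laplacian of a composite function -/

section ChainRule

variable {n : ℕ}

lemma pderivCoord_comp {η : ℝ → ℝ} {F : EuclideanSpace ℝ (Fin n) → ℝ}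
    {z : EuclideanSpace ℝ (Fin n)} (hη : DifferentiableAt ℝ η (F z)) (hF : DifferentiableAt ℝ F z)
    (i : Fin n) :
    pderivCoord i (fun y ↦ η (F y)) z = deriv η (F z) * pderivCoord i F z := by
  rw [pderivCoord, pderivCoord, show (fun y ↦ η (F y)) = η ∘ F from rfl,
    (hη.hasDerivAt.comp_hasFDerivAt z hF.hasFDerivAt).fderiv]
  rfl

lemma pderivCoord_pderivCoord_comp {η : ℝ → ℝ} {F : EuclideanSpace ℝ (Fin n) → ℝ}
    {z : EuclideanSpace ℝ (Fin n)} (hη : ContDiff ℝ 2 η) (hF : ContDiffAt ℝ 2 F z)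
    (i j : Fin n) :
    pderivCoord i (pderivCoord j (fun y ↦ η (F y))) z =
      deriv (deriv η) (F z) * pderivCoord i F z * pderivCoord j F z
        + deriv η (F z) * pderivCoord i (pderivCoord j F) z := by
  have hev : pderivCoord j (fun y ↦ η (F y)) =ᶠ[𝓝 z]
      fun y ↦ deriv η (F y) * pderivCoord j F y := by
    filter_upwards [hF.eventually (by simp)] with y hy
    exact pderivCoord_comp (hη.differentiable (by simp) _) (hy.differentiableAt (by simp)) j
  have hη' : ContDiff ℝ 1 (deriv η) := hη.deriv'
  have hFd : DifferentiableAt ℝ F z := hF.differentiableAt (by simp)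
  have h1 : DifferentiableAt ℝ (fun y ↦ deriv η (F y)) z :=
    (hη'.differentiable (by simp) _).comp z hFd
  have h2 : DifferentiableAt ℝ (pderivCoord j F) z :=
    ((hF.fderiv_right (m := 1) (by norm_num)).clm_apply contDiffAt_const).differentiableAt (by simp)
  have h3 := pderivCoord_comp (η := deriv η) (hη'.differentiable (by simp) _) hFd i
  rw [pderivCoord] at h3
  rw [pderivCoord, hev.fderiv_eq, fderiv_fun_mul h1 h2]
  simp only [add_apply, smul_apply, smul_eq_mul, h3]
  change deriv η (F z) * pderivCoord i (pderivCoord j F) z + _ = _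
  ring

variable {M : Type*} [TopologicalSpace M] [ChartedSpace (EuclideanSpace ℝ (Fin n)) M]
  {G : MetricField n M} {x : M}

lemma gradNorm_comp {η : ℝ → ℝ} {f : M → ℝ} (hη : Differentiable ℝ η)
    (hf : DifferentiableAt ℝ (funCoord (n := n) f x) (coordCenter x)) :
    gradNorm G (fun y ↦ η (f y)) x = |deriv η (f x)| * gradNorm G f x := by
  have hx : funCoord (n := n) f x (coordCenter x) = f x := by
    rw [funCoord, coordCenter, extChartAt_to_inv]
  have key : ∀ i, pderivCoord i (funCoord (fun y ↦ η (f y)) x) (coordCenter x) =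
      deriv η (f x) * pderivCoord i (funCoord (n := n) f x) (coordCenter x) := fun i ↦ by
    rw [← hx]; exact pderivCoord_comp (hη _) hf i
  rw [gradNorm, gradNorm, ← Real.sqrt_sq_eq_abs, ← Real.sqrt_mul (sq_nonneg _)]
  simp only [key, Finset.mul_sum]
  congr 1
  exact Finset.sum_congr rfl fun i _ ↦ Finset.sum_congr rfl fun j _ ↦ by ring

lemma laplaceBeltrami_comp (h : IsMetricNear G x (coordCenter x)) {η : ℝ → ℝ} {f : M → ℝ}
    (hη : ContDiff ℝ 2 η) (hf : ContDiffAt ℝ 2 (funCoord (n := n) f x) (coordCenter x)) :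
    laplaceBeltrami G (fun y ↦ η (f y)) x =
      deriv (deriv η) (f x) * gradNorm G f x ^ 2 + deriv η (f x) * laplaceBeltrami G f x := by
  have hx : funCoord (n := n) f x (coordCenter x) = f x := by
    rw [funCoord, coordCenter, extChartAt_to_inv]
  have key1 : ∀ i, pderivCoord i (funCoord (fun y ↦ η (f y)) x) (coordCenter x) =
      deriv η (f x) * pderivCoord i (funCoord (n := n) f x) (coordCenter x) := fun i ↦ by
    rw [← hx]
    exact pderivCoord_comp (hη.differentiable (by simp) _) (hf.differentiableAt (by simp)) i
  have key2 := pderivCoord_pderivCoord_comp hη hf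
  rw [hx] at key2
  have hQ : gradNorm G f x ^ 2 = ∑ i, ∑ j, (metricCoord G x (coordCenter x))⁻¹ i j
      * pderivCoord i (funCoord f x) (coordCenter x)
      * pderivCoord j (funCoord f x) (coordCenter x) := by
    rw [gradNorm_sq_eq h, sum_inv_mul_pderivCoord_eq h]
  rw [hQ, laplaceBeltrami, laplaceBeltrami, Finset.mul_sum, Finset.mul_sum,
    ← Finset.sum_add_distrib]
  refine Finset.sum_congr rfl fun i _ ↦ ?_
  rw [Finset.mul_sum, Finset.mul_sum, ← Finset.sum_add_distrib]
  refine Finset.sum_congr rfl fun j _ ↦ ?_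
  have e : pderivCoord i (pderivCoord j (funCoord (fun y ↦ η (f y)) x)) (coordCenter x) = _ :=
    key2 i j
  have e2 : ∑ k, christoffel G x k i j (coordCenter x) *
      pderivCoord k (funCoord (fun y ↦ η (f y)) x) (coordCenter x) = deriv η (f x) *
      ∑ k, christoffel G x k i j (coordCenter x) *
        pderivCoord k (funCoord f x) (coordCenter x) := by
    rw [Finset.mul_sum]
    exact Finset.sum_congr rfl fun k _ ↦ by rw [key1]; ring
  rw [e, e2]
  ring

/-- Vanishing near the point, and not only at it, makes the second derivatives vanish as well. -/
lemma eventually_pderivCoord_eq_zero {f : M → ℝ} {a : ℝ} (hf : f =ᶠ[𝓝 x] fun _ ↦ a) (i : Fin n) :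
    pderivCoord i (funCoord f x) =ᶠ[𝓝 (coordCenter x)] fun _ ↦ 0 := by
  have ht : Tendsto (extChartAt (𝓡 n) x).symm (𝓝 (coordCenter x)) (𝓝 x) := by
    have := continuousAt_extChartAt_symm (I := 𝓡 n) x
    rwa [ContinuousAt, extChartAt_to_inv] at this
  have h1 : funCoord (n := n) f x =ᶠ[𝓝 (coordCenter x)] fun _ ↦ a := ht.eventually hf
  filter_upwards [h1.eventuallyEq_nhds] with z hz
  rw [pderivCoord, hz.fderiv_eq, fderiv_fun_const]
  rfl

lemma gradNorm_eq_zero_of_eventuallyEq {f : M → ℝ} {a : ℝ} (hf : f =ᶠ[𝓝 x] fun _ ↦ a) :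
    gradNorm G f x = 0 := by
  simp [gradNorm, fun i ↦ (eventually_pderivCoord_eq_zero (n := n) hf i).self_of_nhds]

lemma laplaceBeltrami_eq_zero_of_eventuallyEq {f : M → ℝ} {a : ℝ} (hf : f =ᶠ[𝓝 x] fun _ ↦ a) :
    laplaceBeltrami G f x = 0 := by
  have h2 : ∀ i j, pderivCoord i (pderivCoord j (funCoord f x)) (coordCenter x) = 0 := fun i j ↦ by
    rw [pderivCoord, (eventually_pderivCoord_eq_zero (n := n) hf j).fderiv_eq, fderiv_fun_const]
    rfl
  simp [laplaceBeltrami, h2, fun i ↦ (eventually_pderivCoord_eq_zero (n := n) hf i).self_of_nhds]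

end ChainRule

/-! ### The cutoff of the distance-like function -/

section CutoffOfDistanceLike

lemma cutoff_pos_iff {ρ w t : ℝ} (hw : 0 < w) : 0 < cutoff ρ w t ↔ t < ρ := by
  rw [cutoff, ← not_iff_not, not_lt, not_lt, (Real.smoothTransition.nonneg _).ge_iff_eq',
    Real.smoothTransition.zero_iff_nonpos, div_le_iff₀ hw]
  simp

lemma cutoff_eq_one {ρ w t : ℝ} (hw : 0 < w) (ht : t ≤ ρ - w) : cutoff ρ w t = 1 :=
  Real.smoothTransition.one_of_one_le (by rw [le_div_iff₀ hw]; linarith)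

lemma sublevel_eq_setOf_cutoff_pos {M : Type*} {γ : M → ℝ} (h0 : ∀ x, 0 ≤ γ x) {ρ w : ℝ}
    (hw : 0 < w) :
    sublevel γ ρ = {x | 0 < cutoff ρ w (γ x)} := by
  ext x
  simp [sublevel, cutoff_pos_iff hw, h0 x]

variable {n : ℕ} {M : Type*} [MetricSpace M] [ChartedSpace (EuclideanSpace ℝ (Fin n)) M]

variable {p : M} {γ : M → ℝ} {ρ w s : ℝ}

/-- On the inner ball γ need not even be continuous. There the composite is constant, which replaces
every estimate on γ. -/
lemma cutoff_eventuallyEq_one (hw : 0 < w) (hball : Metric.ball p s ⊆ sublevel γ (ρ - w))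
    {x : M} (hx : dist x p < s) : (fun y ↦ cutoff ρ w (γ y)) =ᶠ[𝓝 x] fun _ ↦ 1 := by
  filter_upwards [Metric.isOpen_ball.mem_nhds (Metric.mem_ball.2 hx)] with y hy
  exact cutoff_eq_one hw (hball hy).2.le

variable {g : MetricField n M} {l lam Lam C₀ : ℝ}

lemma IsDistanceLike.contMDiff_cutoff (h : IsDistanceLike g p l lam Lam C₀ γ) (hw : 0 < w)
    (hball : Metric.ball p (C₀ / √l) ⊆ sublevel γ (ρ - w)) :
    ContMDiff (𝓡 n) 𝓘(ℝ, ℝ) ∞ (fun y ↦ cutoff ρ w (γ y)) := by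
  intro x
  rcases lt_or_ge (dist x p) (C₀ / √l) with hx | hx
  · exact contMDiffAt_const.congr_of_eventuallyEq (cutoff_eventuallyEq_one hw hball hx)
  · exact (contDiff_cutoff ρ w).contDiffAt.contMDiffAt.comp x (h.smooth x hx)

/-- Off the inner ball lam · d ≤ γ < ρ. This is where the lower bound on γ is used: it places the
domain in a compact set. -/
lemma IsDistanceLike.sublevel_subset_closedBall (h : IsDistanceLike g p l lam Lam C₀ γ)
    (hlam : 0 < lam) :
    sublevel γ ρ ⊆ Metric.closedBall p (max (C₀ / √l) (ρ / lam)) := by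
  intro x hx
  rw [Metric.mem_closedBall]
  rcases lt_or_ge (dist x p) (C₀ / √l) with hd | hd
  · exact hd.le.trans (le_max_left _ _)
  · refine le_trans ?_ (le_max_right _ _)
    rw [le_div_iff₀ hlam, mul_comm]
    exact (h.lower x hd).trans hx.2.le

lemma contDiffAt_funCoord_coordCenter [IsManifold (𝓡 n) ∞ M] {f : M → ℝ} {x : M}
    (hf : ContMDiffAt (𝓡 n) 𝓘(ℝ, ℝ) ∞ f x) :
    ContDiffAt ℝ ∞ (funCoord (n := n) f x) (coordCenter x) := by
  refine contDiffAt_funCoord (coordCenter_mem_target x) ?_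
  rwa [coordCenter, extChartAt_to_inv]

lemma IsDistanceLike.gradNorm_cutoff_le [IsManifold (𝓡 n) ∞ M]
    (h : IsDistanceLike g p l lam Lam C₀ γ) (hw : 0 < w) (hC₀ : 0 ≤ C₀)
    (hball : Metric.ball p (C₀ / √l) ⊆ sublevel γ (ρ - w)) {A : ℝ}
    (hA : ∀ t, |deriv Real.smoothTransition t| ≤ A) (x : M) :
    gradNorm g (fun y ↦ cutoff ρ w (γ y)) x ≤ A * (C₀ / w) := by
  have hA0 : 0 ≤ A := (abs_nonneg _).trans (hA 0)
  rcases lt_or_ge (dist x p) (C₀ / √l) with hx | hx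
  · rw [gradNorm_eq_zero_of_eventuallyEq (cutoff_eventuallyEq_one hw hball hx)]
    positivity
  · rw [gradNorm_comp ((contDiff_cutoff ρ w).differentiable (by simp))
      ((contDiffAt_funCoord_coordCenter (h.smooth x hx)).differentiableAt (by simp)),
      deriv_cutoff, abs_mul, abs_neg, abs_of_pos (inv_pos.2 hw)]
    have h1 : w⁻¹ * |deriv Real.smoothTransition ((ρ - γ x) / w)| ≤ w⁻¹ * A :=
      mul_le_mul_of_nonneg_left (hA _) (inv_pos.2 hw).le
    calc _ ≤ w⁻¹ * A * C₀ := mul_le_mul h1 (h.grad x hx) (Real.sqrt_nonneg _) (by positivity)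
      _ = A * (C₀ / w) := by ring

lemma IsDistanceLike.abs_laplaceBeltrami_cutoff_le [IsManifold (𝓡 n) ∞ M]
    (h : IsDistanceLike g p l lam Lam C₀ γ) (hg : ∀ x, IsMetricNear g x (coordCenter x))
    (hw : 0 < w) (hC₀ : 0 ≤ C₀)
    (hball : Metric.ball p (C₀ / √l) ⊆ sublevel γ (ρ - w)) {A : ℝ}
    (hA : ∀ t, |deriv Real.smoothTransition t| ≤ A ∧
      |deriv (deriv Real.smoothTransition) t| ≤ A) (x : M) :
    |laplaceBeltrami g (fun y ↦ cutoff ρ w (γ y)) x| ≤ A * (C₀ / w) ^ 2 + A * (C₀ / w) * √l := by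
  have hA0 : 0 ≤ A := (abs_nonneg _).trans (hA 0).1
  rcases lt_or_ge (dist x p) (C₀ / √l) with hx | hx
  · rw [laplaceBeltrami_eq_zero_of_eventuallyEq (cutoff_eventuallyEq_one hw hball hx), abs_zero]
    positivity
  · rw [laplaceBeltrami_comp (hg x) ((contDiff_cutoff ρ w).of_le ENat.LEInfty.out)
      ((contDiffAt_funCoord_coordCenter (h.smooth x hx)).of_le ENat.LEInfty.out),
      deriv_cutoff, deriv_deriv_cutoff]
    have hG0 : 0 ≤ gradNorm g γ x := Real.sqrt_nonneg _
    have h1 : |w⁻¹ ^ 2 * deriv (deriv Real.smoothTransition) ((ρ - γ x) / w) * gradNorm g γ x ^ 2|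
        ≤ w⁻¹ ^ 2 * A * C₀ ^ 2 := by
      rw [abs_mul, abs_mul, abs_of_nonneg (sq_nonneg w⁻¹),
        abs_of_nonneg (sq_nonneg (gradNorm _ _ _))]
      have := (hA ((ρ - γ x) / w)).2
      have := h.grad x hx
      gcongr
    have h2 : |-w⁻¹ * deriv Real.smoothTransition ((ρ - γ x) / w) * laplaceBeltrami g γ x|
        ≤ w⁻¹ * A * (C₀ * √l) := by
      rw [abs_mul, abs_mul, abs_neg, abs_of_pos (inv_pos.2 hw)]
      have := (hA ((ρ - γ x) / w)).1
      have := h.lap x hx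
      gcongr
    refine (abs_add_le _ _).trans ((add_le_add h1 h2).trans (le_of_eq ?_))
    ring

end CutoffOfDistanceLike

/-! ### Conformality, the width of the cutoff region and the scalar curvature bound -/

section Estimates

lemma isConformalMetricOn_conformalField {n : ℕ} {M : Type*} [TopologicalSpace M]
    [ChartedSpace (EuclideanSpace ℝ (Fin n)) M] {φ : M → ℝ}
    (hφ : ContMDiff (𝓡 n) 𝓘(ℝ, ℝ) ∞ φ) (G : MetricField n M) :
    IsConformalMetricOn {x | 0 < φ x} G (conformalField G φ) := by
  refine ⟨isOpen_lt continuous_const hφ.continuous, fun x ↦ -Real.log (φ x), ?_, ?_⟩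
  · intro x hx
    have h1 : ContMDiffAt 𝓘(ℝ, ℝ) 𝓘(ℝ, ℝ) ∞ (fun t ↦ -Real.log t) (φ x) :=
      (Real.contDiffAt_log.2 (ne_of_gt hx)).neg.contMDiffAt
    exact (h1.comp x (hφ x)).contMDiffWithinAt
  · intro x hx v w
    have hx' : 0 < φ x := hx
    have e : Real.exp (2 * -Real.log (φ x)) = (φ x ^ 2)⁻¹ := by
      rw [show 2 * -Real.log (φ x) = -(Real.log (φ x) + Real.log (φ x)) by ring, Real.exp_neg,
        Real.exp_add, Real.exp_log hx', sq]
    rw [e, conformalField]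

/-- The factor √(l+1) dominates both 1, needed for the gradient, and √l, needed for the Laplacian.
The bounds thus no longer depend on l or C₀. -/
lemma div_mul_sqrt_add_one_le {c C₀ r l : ℝ} (hc : 0 < c) (hC₀ : 0 < C₀) (hr : 0 < r) (hl : 0 < l) :
    C₀ / (c * C₀ * r * √(l + 1)) ≤ 1 / (c * r) ∧
      C₀ / (c * C₀ * r * √(l + 1)) * √l ≤ 1 / (c * r) := by
  have hs : 0 < √(l + 1) := Real.sqrt_pos.2 (by linarith)
  have h1 : 1 ≤ √(l + 1) := Real.one_le_sqrt.2 (by linarith)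
  have h2 : √l ≤ √(l + 1) := Real.sqrt_le_sqrt (by linarith)
  have e : C₀ / (c * C₀ * r * √(l + 1)) = 1 / (c * r) * (1 / √(l + 1)) := by field_simp
  rw [e]
  refine ⟨mul_le_of_le_one_right (by positivity) ((div_le_one hs).2 h1), ?_⟩
  rw [mul_assoc, one_div_mul_eq_div (√(l + 1))]
  exact mul_le_of_le_one_right (by positivity) ((div_le_one hs).2 h2)

/-- The lower bound for the scalar curvature `φ² S + 2 (n - 1) φ Δφ - n (n - 1) |∇φ|²` of
`φ⁻² g`. -/
lemma scalarCurv_estimate {N A c r k φ S D W : ℝ} (hN : 1 ≤ N) (hA : 0 ≤ A) (hc : 0 < c)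
    (hr : 0 < r) (hk : 0 ≤ k) (hφ0 : 0 ≤ φ) (hφ1 : φ ≤ 1) (hS : -k ≤ S)
    (hD : |D| ≤ A * (1 / (c * r)) ^ 2 + A * (1 / (c * r))) (hW0 : 0 ≤ W)
    (hW : W ≤ A * (1 / (c * r))) :
    -k - (2 * (N - 1) * (A / c ^ 2 + A / c) + N * (N - 1) * (A / c) ^ 2 + 1) *
      max (1 / r) (1 / r ^ 2) ≤ φ ^ 2 * S + 2 * (N - 1) * φ * D - N * (N - 1) * W ^ 2 := by
  set m := max (1 / r) (1 / r ^ 2)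
  have hm0 : 0 < m := lt_max_of_lt_left (by positivity)
  have hm1 : 1 / r ≤ m := le_max_left _ _
  have hm2 : 1 / r ^ 2 ≤ m := le_max_right _ _
  have hN0 : 0 ≤ N - 1 := by linarith
  -- Since k ≥ 0, shrinking S by φ² ≤ 1 preserves the lower bound.
  have h1 : -k ≤ φ ^ 2 * S := by
    have : φ ^ 2 ≤ 1 := pow_le_one₀ hφ0 hφ1
    nlinarith [sq_nonneg φ]
  have h2 : |D| ≤ (A / c ^ 2 + A / c) * m := by
    refine hD.trans ?_
    calc A * (1 / (c * r)) ^ 2 + A * (1 / (c * r)) = A / c ^ 2 * (1 / r ^ 2) + A / c * (1 / r) := by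
          field_simp
      _ ≤ A / c ^ 2 * m + A / c * m := by gcongr
      _ = _ := by ring
  have h3 : -((A / c ^ 2 + A / c) * m) ≤ φ * D := by
    have h4 : |φ * D| ≤ |D| := by
      rw [abs_mul, abs_of_nonneg hφ0]
      exact mul_le_of_le_one_left (abs_nonneg _) hφ1
    linarith [(abs_le.1 (h4.trans h2)).1]
  have h5 : W ^ 2 ≤ (A / c) ^ 2 * m := by
    calc W ^ 2 ≤ (A * (1 / (c * r))) ^ 2 := pow_le_pow_left₀ hW0 hW 2
      _ = (A / c) ^ 2 * (1 / r ^ 2) := by field_simp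
      _ ≤ _ := by gcongr
  have h6 := mul_le_mul_of_nonneg_left h3 (show 0 ≤ 2 * (N - 1) by positivity)
  have h7 := mul_le_mul_of_nonneg_left h5 (show 0 ≤ N * (N - 1) by positivity)
  linarith

end Estimates

/-! ### The choice of constants and the construction of h -/

theorem lemma2p3 (n : ℕ) (hn : 2 ≤ n) (δ₁ : ℝ) (hδ₁ : 0 < δ₁) :
    ∃ C c : ℝ, 0 < C ∧ 0 < c ∧
      ∀ (M : Type*) [MetricSpace M] [ChartedSpace (EuclideanSpace ℝ (Fin n)) M]
        [IsManifold (𝓡 n) ∞ M]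
        [RiemannianBundle (fun x : M ↦ TangentSpace (𝓡 n) x)]
        [IsContMDiffRiemannianBundle (𝓡 n) ∞ (EuclideanSpace ℝ (Fin n))
          (fun x : M ↦ TangentSpace (𝓡 n) x)]
        [IsRiemannianManifold (𝓡 n) M] [CompleteSpace M]
        (p : M) (γ : M → ℝ) (l lam Lam C₀ k r ρ : ℝ),
        0 < l → 0 < lam → 0 < Lam → 0 < C₀ → 0 ≤ k → 0 < r →
        (∀ x : M, RicciLowerBoundAt (riemannianField n M) l x) →
        IsDistanceLike (riemannianField n M) p l lam Lam C₀ γ →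
        (∀ x ∈ sublevel γ ρ, -k ≤ scalarCurv (riemannianField n M) x) →
        (∀ (x : M) (s : ℝ), 0 < s → s ≤ r → Metric.ball x s ⊆ sublevel γ ρ →
          AlmostEuclideanIsoperimetric (riemannianField n M) δ₁ (Metric.ball x s)) →
        2 * c * C₀ * r * Real.sqrt (l + 1) < ρ →
        Metric.ball p (C₀ / Real.sqrt l) ⊆ sublevel γ (ρ - c * C₀ * r * Real.sqrt (l + 1)) →
        ∃ h : MetricField n M,
          IsConformalMetricOn (sublevel γ ρ) (riemannianField n M) h ∧
          IsCompleteMetricOn (sublevel γ ρ) h ∧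
          HasBoundedCurvatureOn (sublevel γ ρ) h ∧
          (∀ x ∈ sublevel γ (ρ - c * C₀ * r * Real.sqrt (l + 1)),
            h x = riemannianField n M x) ∧
          (∀ x ∈ sublevel γ ρ, -k - C * max (1 / r) (1 / r ^ 2) ≤ scalarCurv h x) ∧
          (∀ y ∈ sublevel γ ρ,
            AlmostEuclideanIsoperimetric h (2 * δ₁) (ballIn (sublevel γ ρ) h y (r / 8))) := by
  obtain ⟨A, hA0, hA⟩ := exists_abs_deriv_smoothTransition_le
  have hn1 : (1 : ℝ) ≤ n := by exact_mod_cast (by omega : 1 ≤ n)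
  -- The factor A + 1 gives A/c ≤ 1, and the summand n²/δ₁ gives n² A/c ≤ δ₁. Since K r = A/c, these
  -- are the two smallness conditions for the isoperimetric step.
  set c : ℝ := (A + 1) * (1 + (n : ℝ) ^ 2 / δ₁) with hc_def
  have hc : 0 < c := by positivity
  have hAc : A / c ≤ 1 := by
    rw [div_le_one hc, hc_def]
    have : (0 : ℝ) ≤ (n : ℝ) ^ 2 / δ₁ := by positivity
    nlinarith
  have hAcδ : (n : ℝ) ^ 2 * (A / c) ≤ δ₁ := by
    rw [mul_div_assoc', div_le_iff₀ hc, hc_def]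
    have e : δ₁ * ((A + 1) * (1 + (n : ℝ) ^ 2 / δ₁)) =
        (n : ℝ) ^ 2 * A + (n : ℝ) ^ 2 + (A + 1) * δ₁ := by field_simp; ring
    rw [e]
    have : 0 ≤ (A + 1) * δ₁ := by positivity
    nlinarith
  -- The constant of `scalarCurv_estimate`; the final 1 only makes it positive when A = 0.
  refine ⟨2 * ((n : ℝ) - 1) * (A / c ^ 2 + A / c) + n * ((n : ℝ) - 1) * (A / c) ^ 2 + 1, c, ?_, hc,
    ?_⟩
  · have : (0 : ℝ) ≤ (n : ℝ) - 1 := by linarith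
    positivity
  intro M _ _ _ _ _ _ _ p γ l lam Lam C₀ k r ρ hl hlam _ hC₀ hk hr _ hγ hS hiso _ hball
  set w : ℝ := c * C₀ * r * √(l + 1) with hw_def
  have hw : 0 < w := by
    have : 0 < √(l + 1) := Real.sqrt_pos.2 (by linarith)
    positivity
  obtain ⟨hw1, hw2⟩ := div_mul_sqrt_add_one_le hc hC₀ hr hl
  rw [← hw_def] at hw1 hw2
  set φ : M → ℝ := fun y ↦ cutoff ρ w (γ y) with hφ_def
  have hg : ∀ x : M, IsMetricNear (riemannianField n M) x (coordCenter x) := fun x ↦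
    isMetricNear_riemannianField (coordCenter_mem_target x)
  have hφ : ContMDiff (𝓡 n) 𝓘(ℝ, ℝ) ∞ φ := hγ.contMDiff_cutoff hw hball
  have hφ0 : ∀ x, 0 ≤ φ x := fun x ↦ Real.smoothTransition.nonneg _
  have hφ1 : ∀ x, φ x ≤ 1 := fun x ↦ Real.smoothTransition.le_one _
  have hU : sublevel γ ρ = {x | 0 < φ x} := sublevel_eq_setOf_cutoff_pos hγ.nonneg hw
  have hgrad : ∀ x, gradNorm (riemannianField n M) φ x ≤ A * (1 / (c * r)) := fun x ↦
    (hγ.gradNorm_cutoff_le hw hC₀.le hball (fun t ↦ (hA t).1) x).trans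
      (mul_le_mul_of_nonneg_left hw1 hA0)
  have hlap : ∀ x, |laplaceBeltrami (riemannianField n M) φ x| ≤
      A * (1 / (c * r)) ^ 2 + A * (1 / (c * r)) := fun x ↦ by
    refine (hγ.abs_laplaceBeltrami_cutoff_le hg hw hC₀.le hball hA x).trans ?_
    rw [mul_assoc A (C₀ / w)]
    gcongr
  have hK0 : 0 ≤ A * (1 / (c * r)) := by positivity
  have hKr : A * (1 / (c * r)) * r = A / c := by field_simp
  have hcompact := isCompact_closedBall_of_isRiemannianManifold n p (max (C₀ / √l) (ρ / lam))
  have hsub := hγ.sublevel_subset_closedBall (ρ := ρ) hlam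
  -- From here on the domain is {φ > 0}, the form in which the conformal results are stated.
  rw [hU] at hS hiso hsub ⊢
  refine ⟨conformalField (riemannianField n M) φ, isConformalMetricOn_conformalField hφ _,
    isCompleteMetricOn_conformalField hK0 hφ hgrad hφ1,
    hasBoundedCurvatureOn_conformalField hφ hcompact hsub (fun x _ ↦ hgrad x) (fun x hx ↦ hx)
      (fun x _ ↦ hφ1 x), fun x hx ↦ ?_, fun x hx ↦ ?_, fun y hy ↦
    almostEuclideanIsoperimetric_conformalField hK0 hr hδ₁ hφ hgrad hφ1 (hKr.trans_le hAc)
      (by rwa [hKr]) hiso hy⟩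
  · funext v u
    have h1 : φ x = 1 := cutoff_eq_one hw hx.2.le
    rw [conformalField, h1]
    simp
  · rw [scalarCurv_conformalField
      (eventually_isMetricNear_riemannianField (coordCenter_mem_target x))
      (contDiffAt_funCoord_coordCenter (hφ x)) (ne_of_gt hx)]
    exact scalarCurv_estimate hn1 hA0 hc hr hk (hφ0 x) (hφ1 x) (hS x hx) (hlap x)
      (Real.sqrt_nonneg _) (hgrad x)
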